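/- Let $p$ be a prime, $F$ a finite extension of $\mathbb{Q}_p$ and $E$ a finite extension of $F$. Let $\mathfrak g$ be a finite-dimensional split reductive Lie algebra over $F$, $\mathfrak t \subset \mathfrak g$ a splitting Cartan subalgebra (i.e. $\mathrm{ad}\,h$ is triangularizable over $F$ for every $h \in \mathfrak t$), $\mathfrak b \supset \mathfrak t$ a Borel subalgebra (a maximal solvable subalgebra), and $\mathfrak t^*_{\rm alg} \subset \mathfrak t^*$ a subgroup, whose elements are called algebraic weights. (For example, $\mathfrak g, \mathfrak b, \mathfrak t$ are the Lie algebras of a connected split reductive group $\mathbf G$ over $F$, a Borel subgroup $\mathbf B$ and a maximal split torus $\mathbf T \subset \mathbf B$, and $\mathfrak t^*_{\rm alg}$ is the image of the derivative $\mathrm d : X^*(\mathbf T) \to \mathfrak t^*$.) A subscript $E$ denotes $-\otimes_F E$, and $\mathfrak t_E^* = \mathrm{Hom}_F(\mathfrak t, E)$. For a $U(\mathfrak g_E)$-module $M$, $\lambda \in \mathfrak t_E^*$ and $i \ge 1$ put $M^i_\lambda = \{m \in M : (h - \lambda(h))^i m = 0 \text{ for all } h \in \mathfrak t_E\}$, $M_\lambda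 = M^1_\lambda$ and $M^\infty_\lambda = \bigcup_{i \ge 1} M^i_\lambda$. Call $M$ diagonalizable if $M = \bigoplus_{\lambda \in \mathfrak t_E^*} M_\lambda$, $E$-split if $M = \bigoplus_{\lambda \in \mathfrak t_E^*} M^\infty_\lambda$, and algebraic if it is $E$-split and $M = \bigoplus_{\lambda \in \mathfrak t^*_{\rm alg}} M^\infty_\lambda$. Let $\mathcal O$ (resp. $\mathcal O^\infty$) be the full subcategory of the category $U(\mathfrak g_E)\text{-mod}$ of all left $U(\mathfrak g_E)$-modules consisting of the finitely generated modules $M$ that are diagonalizable (resp. $E$-split) and such that $U(\mathfrak b_E)m$ is finite-dimensional over $E$ for every $m \in M$. Let $\mathcal O_{\rm alg} \subset \mathcal O$ and $\mathcal O^\infty_{\rm alg} \subset \mathcal O^\infty$ be the full subcategories of algebraic modules. Then: (i) $\mathcal O^\infty$ and $\mathcal O^\infty_{\rm alg}$ are closed under extensions and are Serre subcategories of $U(\mathfrak g_E)\text{-mod}$. (ii) A $U(\mathfrak g_E)$-module $M$ belongs to $\mathcal O^\infty$ if and only if there is a finite filtration $0 = M_0 \subset M_1 \subset \dots \subset M_n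 = M$ by submodules such that all quotients $M_k/M_{k-1}$, $1 \le k \le n$, are in $\mathcal O$. (iii) A $U(\mathfrak g_E)$-module $M$ belongs to $\mathcal O^\infty_{\rm alg}$ if and only if there is a finite filtration $0 = M_0 \subset M_1 \subset \dots \subset M_n = M$ by submodules such that all quotients $M_k/M_{k-1}$, $1 \le k \le n$, are in $\mathcal O_{\rm alg}$. (iv) Simple objects of $\mathcal O^\infty$ (resp. $\mathcal O^\infty_{\rm alg}$) lie in $\mathcal O$ (resp. $\mathcal O_{\rm alg}$), and every object of $\mathcal O^\infty$ (resp. $\mathcal O^\infty_{\rm alg}$) has finite length as a $U(\mathfrak g_E)$-module. -/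

import Mathlib

open scoped TensorProduct ModuleCat
open CategoryTheory

universe v

noncomputable section

namespace ThickCategoryO

section Definitions

attribute [local instance] LieRing.ofAssociativeRing

variable {F : Type*} [Field F] (E : Type*) [Field E] [Algebra F E]
variable {g : Type*} [LieRing g] [LieAlgebra F g]

variable (F g) in
/-- The universal enveloping algebra `U(g_E)` of the base change `g_E = E ⊗[F] g`. -/
abbrev UgE : Type _ := UniversalEnvelopingAlgebra E (E ⊗[F] g)

/-- For a subalgebra `s` of `g`, the homomorphism `s_E → g_E` of Lie algebras over `E`. -/
def baseChangeIncl (s : LieSubalgebra F g) : (E ⊗[F] s) →ₗ⁅E⁆ (E ⊗[F] g) :=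
  { s.toSubmodule.subtype.baseChange E with
    map_lie' := by
      intro x y
      induction x using TensorProduct.induction_on with
      | zero => simp
      | add x₁ x₂ h₁ h₂ => simp_all [add_lie]
      | tmul a x =>
        induction y using TensorProduct.induction_on with
        | zero => simp
        | add y₁ y₂ h₁ h₂ => simp_all [lie_add]
        | tmul c y => simp [LinearMap.baseChange_tmul] }

/-- The homomorphism `U(s_E) → U(g_E)` induced by the inclusion of a subalgebra `s` of `g`. -/
def envelopingIncl (s : LieSubalgebra F g) :
    UniversalEnvelopingAlgebra E (E ⊗[F] s) →ₐ[E] UgE F E g :=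
  UniversalEnvelopingAlgebra.lift E
    ((UniversalEnvelopingAlgebra.ι E).comp (baseChangeIncl E s))

section Modules

variable (t : LieSubalgebra F g) (M : Type*) [AddCommGroup M] [Module E M]
  [Module (UgE F E g) M] [IsScalarTower E (UgE F E g) M]

/-- For a weight `μ ∈ t_E^* = Hom_F(t, E)`, the subspace
`M^i_μ = {m | (h - μ(h))^i m = 0 for all h ∈ t_E}`; here `μ` is extended `E`-linearly to `t_E`. -/
def weightSpace (μ : t →ₗ[F] E) (i : ℕ) : Submodule E M :=
  ⨅ h : E ⊗[F] t, LinearMap.ker (Algebra.lsmul E E M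
    ((UniversalEnvelopingAlgebra.ι E (baseChangeIncl E t h)
      - algebraMap E (UgE F E g) (μ.liftBaseChange E h)) ^ i))

variable {M} in
lemma mem_weightSpace_iff (μ : t →ₗ[F] E) (i : ℕ) (m : M) :
    m ∈ weightSpace E t M μ i ↔ ∀ h : E ⊗[F] t,
      (UniversalEnvelopingAlgebra.ι E (baseChangeIncl E t h)
        - algebraMap E (UgE F E g) (μ.liftBaseChange E h)) ^ i • m = 0 := by
  simp only [weightSpace, Submodule.mem_iInf, LinearMap.mem_ker, Algebra.lsmul_coe]

lemma weightSpace_mono (μ : t →ₗ[F] E) : Monotone (weightSpace E t M μ) := by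
  intro i j hij m hm
  rw [mem_weightSpace_iff] at hm ⊢
  intro h
  obtain ⟨k, rfl⟩ := Nat.exists_eq_add_of_le' hij
  rw [pow_add, mul_smul, hm h, smul_zero]

/-- The generalized eigenspace `M^∞_μ = ⋃_{i ≥ 1} M^i_μ`. -/
def genWeightSpace (μ : t →ₗ[F] E) : Submodule E M :=
  ⨆ i : ℕ, weightSpace E t M μ (i + 1)

variable {M} in
lemma mem_genWeightSpace_iff (μ : t →ₗ[F] E) (m : M) :
    m ∈ genWeightSpace E t M μ ↔ ∃ i : ℕ, 1 ≤ i ∧ m ∈ weightSpace E t M μ i := by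
  rw [genWeightSpace, Submodule.mem_iSup_of_directed]
  · constructor
    · rintro ⟨i, hi⟩
      exact ⟨i + 1, by omega, hi⟩
    · rintro ⟨i, h1, hi⟩
      exact ⟨i - 1, by rwa [Nat.sub_add_cancel h1]⟩
  · exact Monotone.directed_le fun i j hij => weightSpace_mono E t M μ (by omega)

open scoped Classical in
/-- `M` is diagonalizable: `M = ⨁_{μ ∈ t_E^*} M_μ` with `M_μ = M^1_μ`. -/
def IsDiagonalizable : Prop :=
  DirectSum.IsInternal fun μ : t →ₗ[F] E => weightSpace E t M μ 1

open scoped Classical in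
/-- `M` is `E`-split: `M = ⨁_{μ ∈ t_E^*} M^∞_μ`. -/
def IsESplit : Prop :=
  DirectSum.IsInternal fun μ : t →ₗ[F] E => genWeightSpace E t M μ

variable {t} in
/-- The image in `t_E^* = Hom_F(t, E)` of a subgroup `X` of `t^*`. -/
def algWeights (X : AddSubgroup (Module.Dual F t)) : Set (t →ₗ[F] E) :=
  {μ | ∃ χ ∈ X, μ = Algebra.linearMap F E ∘ₗ χ}

open scoped Classical in
/-- `M` is algebraic with respect to `X ⊆ t^*`: it is `E`-split and is the direct sum of the
generalized eigenspaces `M^∞_μ` for `μ` in (the image of) `X`. -/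
def IsAlgebraicModule (X : AddSubgroup (Module.Dual F t)) : Prop :=
  IsESplit E t M ∧
    DirectSum.IsInternal fun μ : algWeights E X => genWeightSpace E t M μ.1

/-- The action of `b_E` on `M` is locally finite: `U(b_E).m` is finite-dimensional over `E`
for every `m`. -/
def IsLocallyFinite (b : LieSubalgebra F g) : Prop :=
  ∀ m : M, FiniteDimensional E (LinearMap.range
    ((LinearMap.toSpanSingleton (UgE F E g) M m).restrictScalars E ∘ₗ
      (envelopingIncl E b).toLinearMap))

end Modules

/-- Category `O` for `(g, b, t)` with coefficient field `E`, a full subcategory of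
`U(g_E)`-modules. -/
def catO (b t : LieSubalgebra F g) : ObjectProperty (ModuleCat.{v} (UgE F E g)) := fun M =>
  Module.Finite (UgE F E g) M ∧ IsDiagonalizable E t M ∧ IsLocallyFinite E M b

/-- The full subcategory `O_alg` of `O`. -/
def catOAlg (b t : LieSubalgebra F g) (X : AddSubgroup (Module.Dual F t)) :
    ObjectProperty (ModuleCat.{v} (UgE F E g)) := fun M =>
  catO E b t M ∧ IsAlgebraicModule E t M X

/-- The thick category `O^∞` for `(g, b, t)` with coefficient field `E`. -/
def catOInf (b t : LieSubalgebra F g) : ObjectProperty (ModuleCat.{v} (UgE F E g)) := fun M =>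
  Module.Finite (UgE F E g) M ∧ IsESplit E t M ∧ IsLocallyFinite E M b

/-- The full subcategory `O^∞_alg` of `O^∞`. -/
def catOInfAlg (b t : LieSubalgebra F g) (X : AddSubgroup (Module.Dual F t)) :
    ObjectProperty (ModuleCat.{v} (UgE F E g)) := fun M =>
  catOInf E b t M ∧ IsAlgebraicModule E t M X

end Definitions

/-- `M` has a finite filtration `0 = M_0 ⊆ M_1 ⊆ ... ⊆ M_n = M` by submodules such that all
quotients `M_{k+1} / M_k` satisfy `P`. -/
def HasFiltrationBy {A : Type*} [Ring A] (P : ObjectProperty (ModuleCat A))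
    (M : ModuleCat A) : Prop :=
  ∃ (n : ℕ) (N : Fin (n + 1) → Submodule A M), Monotone N ∧ N 0 = ⊥ ∧ N (Fin.last n) = ⊤ ∧
    ∀ k : Fin n, P (ModuleCat.of A (N k.succ ⧸ (N k.castSucc).submoduleOf (N k.succ)))

/-- A Borel subalgebra: a maximal solvable subalgebra. (Over a field that is not algebraically
closed this is used only for subalgebras that contain a splitting Cartan subalgebra.) -/
def IsBorelSubalgebra {F g : Type*} [Field F] [LieRing g] [LieAlgebra F g]
    (b : LieSubalgebra F g) : Prop :=
  Maximal (fun s : LieSubalgebra F g => LieAlgebra.IsSolvable s) b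

/-- The standing assumptions on `(g, b, t)`: `g` is a finite-dimensional reductive Lie algebra
(its radical is its center), `t` is a splitting Cartan subalgebra (`ad h` is triangularizable
for all `h ∈ t`), and `b` is a Borel subalgebra that contains `t`. -/
structure IsSplitReductiveTriple {F g : Type*} [Field F] [LieRing g] [LieAlgebra F g]
    (b t : LieSubalgebra F g) : Prop where
  finiteDimensional : FiniteDimensional F g
  reductive : LieAlgebra.HasCentralRadical F g
  cartan : t.IsCartanSubalgebra
  split : ∀ h : t, ⨆ c : F, (LieAlgebra.ad F g h).maxGenEigenspace c = ⊤
  borel : IsBorelSubalgebra b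
  le_borel : t ≤ b

end ThickCategoryO

end

-- The theorem rests on two facts about an object `M` of `O^∞`: it is Noetherian and Artinian, and
-- if it is nonzero then it has a nonzero diagonalizable submodule.
--
-- The second fact is linear algebra. A finite-dimensional `b`-stable subspace contains a common
-- eigenvector of `t_E`, and the sum of all weight spaces `M_μ` is `g`-stable because root vectors
-- shift weights (`diagonalPart`). Repeating this on quotients gives an ascending filtration with
-- pieces in `O`; it reaches `M` because `M` is Noetherian. A simple object equals its diagonal
-- part.
--
-- Finite length is obtained from the Casimir element alone. A finite-dimensional `b`-stable
-- generating space has a highest weight vector, so induction on its dimension reduces to a cyclic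
-- module generated by a highest weight vector of weight `μ`. The Casimir element acts on it by one
-- scalar. Every nonzero subquotient has a highest weight vector, whose weight `ν = μ - ∑ nᵢ αᵢ`
-- must give the same scalar. This is an equation in `n` whose quadratic part is a rational sum of
-- squares, so it has finitely many solutions in natural numbers. Hence every strict inclusion of
-- submodules is visible in one finite-dimensional subspace (`exists_mem_linkedSubspace`), and both
-- chain conditions follow.
--
-- For the Serre property, being `E`-split is replaced by a condition on single elements, namely
-- annihilation by split polynomials in each `h` (`IsLocallySplit`). This passes to submodules and
-- extensions, and is equivalent to being `E`-split in the presence of local finiteness. Finite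
-- generation of submodules comes from the Noetherian property.
--
-- What is needed from `g` is collected in `TriangularData`. The quotient of `g` by its center has
-- nondegenerate Killing form and the central extension splits (`exists_lieHom_section`), so the
-- data are built for the quotient and lifted. There the Borel subalgebra is shown to be the Cartan
-- subalgebra plus the root spaces of a set of roots that meets every pair `±α` and satisfies no
-- relation over `ℕ` (`exists_eq_parabolicSubmodule`).

universe u₁ u₂

set_option linter.unusedSectionVars false

noncomputable section

namespace ThickCategoryO

/-! ### Relations over `ℕ` and integral quadrics. -/

section Combinatorics

/-- A finite set of vectors without nontrivial relations with coefficients in `ℕ`. -/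
def NatIndependent {V : Type*} [AddCommMonoid V] (P : Finset V) : Prop :=
  ∀ n : V → ℕ, ∑ v ∈ P, n v • v = 0 → ∀ v ∈ P, n v = 0

/-- In a nonempty relation, pairing with a member `a` forces the other terms to sum to `-2`, so some
`b` pairs negatively with `a`. Replacing `a, b` by `a + b` gives a shorter nonempty relation. This
is applied with `c` the coroot pairing. -/
lemma eq_zero_of_sum_eq_zero_of_add_mem {V K : Type*} [AddCommGroup V] [Field K] [CharZero K]
    (Ψ : Set V) (c : V → V →+ K) (h2 : ∀ α ∈ Ψ, c α α = 2)
    (hc : ∀ α ∈ Ψ, ∀ β ∈ Ψ, ∃ k : ℤ, c α β = k ∧ (k < 0 → α + β ∈ Ψ)) (s : Multiset V)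
    (hs : ∀ v ∈ s, v ∈ Ψ) (h0 : s.sum = 0) : s = 0 := by
  induction hk : s.card using Nat.strong_induction_on generalizing s with
  | _ k ih =>
    by_contra hne
    obtain ⟨a, ha⟩ := Multiset.exists_mem_of_ne_zero hne
    obtain ⟨s', rfl⟩ := Multiset.exists_cons_of_mem ha
    have haΨ := hs a ha
    have hsum : c a s'.sum = -2 := by
      have := congrArg (c a) h0
      rw [Multiset.sum_cons, map_add, h2 a haΨ, map_zero] at this
      linear_combination this
    have hex : ∃ b ∈ s', a + b ∈ Ψ := by
      by_contra hno
      push Not at hno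
      have key : ∀ t : Multiset V, t ≤ s' → ∃ k : ℕ, c a t.sum = k := by
        intro t
        induction t using Multiset.induction_on with
        | empty => exact fun _ => ⟨0, by simp⟩
        | cons b t iht =>
          intro ht
          obtain ⟨k, hk⟩ := iht ((Multiset.le_cons_self t b).trans ht)
          have hb : b ∈ s' := Multiset.mem_of_le ht (Multiset.mem_cons_self b t)
          obtain ⟨l, hl, hl'⟩ := hc a haΨ b (hs b (Multiset.mem_cons_of_mem hb))
          have hl0 : 0 ≤ l := by
            by_contra hneg
            exact hno b hb (hl' (not_le.mp hneg))
          lift l to ℕ using hl0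
          exact ⟨l + k, by rw [Multiset.sum_cons, map_add, hk, hl]; push_cast; rfl⟩
      obtain ⟨k, hk⟩ := key s' le_rfl
      rw [hsum] at hk
      have : ((k + 2 : ℕ) : K) = 0 := by push_cast; rw [← hk]; ring
      rw [Nat.cast_eq_zero] at this
      omega
    obtain ⟨b, hb, hab⟩ := hex
    obtain ⟨s'', rfl⟩ := Multiset.exists_cons_of_mem hb
    have := ih (s''.card + 1) (by rw [← hk]; simp) ((a + b) ::ₘ s'') (by
      intro v hv
      rcases Multiset.mem_cons.mp hv with rfl | hv
      · exact hab
      · exact hs v (by simp [hv])) (by simpa [add_assoc] using h0) (by simp)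
    simp at this

lemma natIndependent_of_multiset {V : Type*} [AddCommMonoid V] (P : Finset V)
    (h : ∀ s : Multiset V, (∀ v ∈ s, v ∈ P) → s.sum = 0 → s = 0) : NatIndependent P := by
  classical
  intro n hn v hv
  have := h (∑ v ∈ P, n v • {v}) (by
    intro w hw
    obtain ⟨u, hu, hwu⟩ := Multiset.mem_sum.mp hw
    have := Multiset.mem_of_mem_nsmul hwu
    rw [Multiset.mem_singleton] at this
    exact this ▸ hu) (by
    rw [← hn, Multiset.sum_sum]
    simp [Multiset.sum_nsmul])
  rw [Finset.sum_eq_zero_iff] at this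
  have := congrArg Multiset.card (this v hv)
  simpa using this

open scoped Classical in
-- A maximal independent `P` works. If neither `α` nor `-α` could be added, there would be relations
-- with positive coefficients `k` at `α` and `l` at `-α`. In `l` times the first plus `k` times the
-- second these terms cancel, so the coefficients on `P` vanish and `k • α = 0`.
lemma NatIndependent.exists_extension {V : Type*} [AddCommGroup V] [IsAddTorsionFree V]
    {Φ Ψ : Finset V} (h0 : (0 : V) ∉ Φ) (hΨΦ : Ψ ⊆ Φ) (hΨ : NatIndependent Ψ) :
    ∃ P : Finset V, Ψ ⊆ P ∧ P ⊆ Φ ∧ NatIndependent P ∧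
      ∀ α ∈ Φ, -α ∈ Φ → α ∈ P ∨ -α ∈ P := by
  obtain ⟨P, hΨP, hP⟩ := (Φ.powerset.filter NatIndependent).exists_le_maximal
    (Finset.mem_filter.mpr ⟨Finset.mem_powerset.mpr hΨΦ, hΨ⟩)
  obtain ⟨hPΦ, hPi⟩ := Finset.mem_filter.mp hP.prop
  rw [Finset.mem_powerset] at hPΦ
  have step : ∀ α ∈ Φ, α ∉ P → ∃ (n : V → ℕ) (k : ℕ), 0 < k ∧ ∑ v ∈ P, n v • v + k • α = 0 := by
    intro α hα hαP
    by_contra hno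
    push Not at hno
    refine hαP (hP.le_of_ge (y := insert α P) (Finset.mem_filter.mpr
      ⟨Finset.mem_powerset.mpr (Finset.insert_subset hα hPΦ), ?_⟩)
      (Finset.subset_insert α P) (Finset.mem_insert_self α P))
    intro n hn
    rw [Finset.sum_insert hαP, add_comm] at hn
    have hk : n α = 0 := by
      by_contra hk
      exact hno n (n α) (Nat.pos_of_ne_zero hk) hn
    rw [hk, zero_smul, add_zero] at hn
    intro v hv
    rcases Finset.mem_insert.mp hv with rfl | hv
    · exact hk
    · exact hPi n hn v hv
  refine ⟨P, hΨP, hPΦ, hPi, fun α hα hα' => ?_⟩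
  by_contra hno
  push Not at hno
  obtain ⟨n, k, hk, hn⟩ := step α hα hno.1
  obtain ⟨m, l, hl, hm⟩ := step (-α) hα' hno.2
  have hsum : ∑ v ∈ P, (l * n v + k * m v) • v = 0 := by
    have : ∑ v ∈ P, (l * n v + k * m v) • v =
        l • (∑ v ∈ P, n v • v + k • α) + k • (∑ v ∈ P, m v • v + l • -α) := by
      simp only [smul_add, Finset.smul_sum, add_smul, mul_smul, Finset.sum_add_distrib, smul_neg]
      rw [smul_comm l k α]
      abel
    rw [this, hn, hm]
    simp
  have hz := hPi _ hsum
  have hn0 : ∀ v ∈ P, n v = 0 := fun v hv => by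
    have := hz v hv
    have : l * n v = 0 := by omega
    rcases Nat.mul_eq_zero.mp this with h | h
    · omega
    · exact h
  rw [Finset.sum_eq_zero (fun v hv => by rw [hn0 v hv, zero_smul]), zero_add] at hn
  rcases (smul_eq_zero.mp hn) with h | h
  · omega
  · exact h0 (h ▸ hα)

lemma NatIndependent.eq_zero_of_sum_eq_zero {V : Type*} [AddCommMonoid V] {P : Finset V}
    (hP : NatIndependent P) {s : Multiset V} (hs : ∀ v ∈ s, v ∈ P) (h0 : s.sum = 0) : s = 0 := by
  classical
  have := hP (fun v => s.count v) (by
    rw [← h0, Finset.sum_multiset_count_of_subset s P (fun v hv => hs v (Multiset.mem_toFinset.mp hv))])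
  by_contra hne
  obtain ⟨a, ha⟩ := Multiset.exists_mem_of_ne_zero hne
  exact Multiset.count_ne_zero.mpr ha (this a (hs a ha))

/-- A height function on a finite set without nontrivial relations with coefficients in `ℕ`. -/
lemma NatIndependent.exists_height {V : Type*} [AddCommGroup V] {P : Finset V}
    (hP : NatIndependent P) : ∃ (ht : V → ℕ) (N : ℕ), (∀ v ∈ P, ht v < N) ∧
      ∀ v ∈ P, ∀ w ∈ P, ht v < ht (v + w) := by
  classical
  let lt : V → V → Prop := fun v w => ∃ s : Multiset V, s ≠ 0 ∧ (∀ x ∈ s, x ∈ P) ∧ w = v + s.sum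
  -- The height of `v` is the number of elements of `P` strictly below it. Passing from `v` to `v +
  -- w` keeps these and adds `v` itself, which is not below `v` by independence.
  refine ⟨fun v => (P.filter fun x => lt x v).card, P.card + 1, fun v _ =>
    Nat.lt_succ_of_le (Finset.card_filter_le _ _), fun v hv w hw => Finset.card_lt_card ?_⟩
  rw [Finset.ssubset_iff_of_subset]
  · refine ⟨v, Finset.mem_filter.mpr ⟨hv, {w}, by simp, by simpa using hw, by simp⟩, ?_⟩
    rintro h
    obtain ⟨s, hs, hsP, hsv⟩ := (Finset.mem_filter.mp h).2
    exact hs (hP.eq_zero_of_sum_eq_zero hsP (by simpa using hsv))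
  · intro x hx
    obtain ⟨hxP, s, hs, hsP, rfl⟩ := Finset.mem_filter.mp hx
    refine Finset.mem_filter.mpr ⟨hxP, w ::ₘ s, by simp, ?_, by
      rw [Multiset.sum_cons]; abel⟩
    intro y hy
    rcases Multiset.mem_cons.mp hy with rfl | hy
    · exact hw
    · exact hsP y hy

/-- An integral quadric whose quadratic part is a sum of squares has finitely many points with
coordinates in `ℕ`. -/
lemma finite_setOf_sum_sq_add_eq_zero {E ι Γ : Type*} [Field E] [CharZero E] [Fintype ι]
    [Fintype Γ] (q : ι → Γ → ℚ) (hq : ∀ n : ι → ℕ, (∀ γ, ∑ i, n i * q i γ = 0) → n = 0)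
    (c : Γ → E) :
    {n : ι → ℕ | ∑ γ, (((∑ i, n i * q i γ : ℚ) : E) ^ 2 - c γ * (∑ i, n i * q i γ : ℚ)) = 0}.Finite := by
  classical
  set B : (ι → ℕ) → Γ → ℚ := fun n γ => ∑ i, n i * q i γ with hB
  -- The linear coefficients lie in `E`, which has no order. A `ℚ`-linear retraction onto `ℚ` turns
  -- the equation into a rational one, where completing the square gives bounds.
  obtain ⟨π, hπ⟩ : ∃ π : E →ₗ[ℚ] ℚ, π 1 = 1 := by
    obtain ⟨π, hπ⟩ := (Algebra.linearMap ℚ E).exists_leftInverse_of_injective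
      (LinearMap.ker_eq_bot.mpr (algebraMap ℚ E).injective)
    exact ⟨π, by simpa using LinearMap.congr_fun hπ 1⟩
  have hπq : ∀ r : ℚ, π (r : E) = r := fun r => by
    have := π.map_smul r 1
    rwa [hπ, Rat.smul_def, mul_one, smul_eq_mul, mul_one] at this
  set C : ℚ := ∑ γ, (π (c γ) / 2) ^ 2
  -- bounded coordinates
  have hbound : ∀ n ∈ {n : ι → ℕ | ∑ γ, ((B n γ : E) ^ 2 - c γ * (B n γ : ℚ)) = 0}, ∀ γ,
      (B n γ - π (c γ) / 2) ^ 2 ≤ C := by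
    intro n hn γ
    have h1 : ∑ γ, ((B n γ) ^ 2 - π (c γ) * B n γ) = 0 := by
      have := congrArg π hn
      rw [map_sum, map_zero] at this
      rw [← this]
      refine Finset.sum_congr rfl fun γ _ => ?_
      rw [map_sub, ← Rat.cast_pow, hπq, mul_comm (c γ), ← Rat.smul_def, map_smul, smul_eq_mul,
        mul_comm]
    have h2 : ∑ γ, (B n γ - π (c γ) / 2) ^ 2 = C := by
      rw [← sub_eq_zero, ← h1, ← Finset.sum_sub_distrib]
      exact Finset.sum_congr rfl fun γ _ => by ring
    rw [← h2]
    exact Finset.single_le_sum (f := fun γ => (B n γ - π (c γ) / 2) ^ 2)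
      (fun _ _ => sq_nonneg _) (Finset.mem_univ γ)
  -- common denominator
  obtain ⟨D, hD0, hD⟩ : ∃ D : ℕ, 0 < D ∧ ∀ i γ, ∃ k : ℤ, D * q i γ = k := by
    refine ⟨∏ i, ∏ γ, (q i γ).den, Finset.prod_pos fun i _ => Finset.prod_pos fun γ _ => (q i γ).pos,
      fun i γ => ?_⟩
    have : (q i γ).den ∣ ∏ i, ∏ γ, (q i γ).den :=
      (Finset.dvd_prod_of_mem (fun γ => (q i γ).den) (Finset.mem_univ γ)).trans
        (Finset.dvd_prod_of_mem (fun i => ∏ γ, (q i γ).den) (Finset.mem_univ i))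
    obtain ⟨m, hm⟩ := this
    refine ⟨m * (q i γ).num, ?_⟩
    rw [hm]
    push_cast
    rw [mul_right_comm, mul_comm ((q i γ).den : ℚ), Rat.mul_den_eq_num, mul_comm]
  choose k hk using hD
  let K : (ι → ℕ) → Γ → ℤ := fun n γ => ∑ i, n i * k i γ
  have hK : ∀ n γ, (K n γ : ℚ) = D * B n γ := fun n γ => by
    simp only [K, hB, Finset.mul_sum]
    push_cast
    exact Finset.sum_congr rfl fun i _ => by rw [← hk]; ring
  set S := {n : ι → ℕ | ∑ γ, ((B n γ : E) ^ 2 - c γ * (B n γ : ℚ)) = 0}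
  have hfinK : (K '' S).Finite := by
    have hR : ∀ γ, ∃ R : ℤ, ∀ n ∈ S, -R ≤ K n γ ∧ K n γ ≤ R := by
      intro γ
      obtain ⟨R, hR⟩ := exists_int_gt (D * (C + 1 + |π (c γ) / 2|) : ℚ)
      refine ⟨R, fun n hn => ?_⟩
      have hb := hbound n hn γ
      have hC : 0 ≤ C := (sq_nonneg _).trans hb
      -- The bound `C + 1` stands in for the square root of `C`: for `C ≥ 0` one has `C ≤ (C + 1) ^
      -- 2`.
      have habs : |B n γ - π (c γ) / 2| ≤ C + 1 := abs_le_of_sq_le_sq (by nlinarith) (by linarith)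
      have h3 : |B n γ| ≤ C + 1 + |π (c γ) / 2| := by
        have := abs_sub_abs_le_abs_sub (B n γ) (π (c γ) / 2)
        linarith
      have h4 : |(K n γ : ℚ)| ≤ R := by
        rw [hK, abs_mul, Nat.abs_cast]
        exact (mul_le_mul_of_nonneg_left h3 (Nat.cast_nonneg D)).trans hR.le
      rw [abs_le] at h4
      exact ⟨by exact_mod_cast h4.1, by exact_mod_cast h4.2⟩
    choose R hR using hR
    refine (Set.Finite.pi' fun γ => Set.finite_Icc (-R γ) (R γ)).subset ?_
    rintro _ ⟨n, hn, rfl⟩ γ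
    exact hR γ n hn
  refine Set.Finite.of_finite_fibers K hfinK fun x _ => ?_
  -- Two comparable points of a fibre differ by a vector of natural numbers in the kernel of `q`,
  -- which is zero by `hq`. So each fibre is an antichain in `ℕ^ι`, and Dickson's lemma makes it
  -- finite.
  have hanti : IsAntichain (· ≤ ·) (S ∩ K ⁻¹' {x}) := by
    rintro n ⟨_, hn⟩ m ⟨_, hm⟩ hne hle
    refine hne (le_antisymm hle fun i => ?_)
    have : (fun i => m i - n i) = 0 := hq _ fun γ => by
      have h1 : B m γ = B n γ := by
        have h2 : K m γ = K n γ := by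
          rw [Set.mem_preimage, Set.mem_singleton_iff] at hn hm
          rw [hn, hm]
        have h3 : (D : ℚ) * B m γ = D * B n γ := by rw [← hK, ← hK, h2]
        exact mul_left_cancel₀ (Nat.cast_ne_zero.mpr hD0.ne') h3
      have h4 : ∑ i, ((m i - n i : ℕ) : ℚ) * q i γ = B m γ - B n γ := by
        rw [hB, ← Finset.sum_sub_distrib]
        exact Finset.sum_congr rfl fun i _ => by rw [Nat.cast_sub (hle i)]; ring
      rw [h4, h1, sub_self]
    exact Nat.sub_eq_zero_iff_le.mp (congrFun this i)
  exact hanti.finite_of_partiallyWellOrderedOn (Set.isPWO_of_wellQuasiOrderedLE _)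

end Combinatorics

/-- The part of the structure of a split reductive Lie algebra that is needed to study
category `O`: positive root vectors `e i`, opposite root vectors `f i`, and an invariant tensor. -/
structure TriangularData {F g : Type*} [Field F] [LieRing g] [LieAlgebra F g]
    (b t : LieSubalgebra F g) (ι Γ : Type*) [Fintype ι] [Fintype Γ] where
  root : ι → Module.Dual F t
  e : ι → g
  f : ι → g
  u : Γ → t
  r : ι → Γ
  lie_t : ∀ h h' : t, ⁅(h : g), (h' : g)⁆ = 0
  lie_e : ∀ i (h : t), ⁅(h : g), e i⁆ = root i h • e i
  lie_f : ∀ i (h : t), ⁅(h : g), f i⁆ = -(root i h • f i)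
  lie_e_f : ∀ i, ⁅e i, f i⁆ = u (r i)
  sup_e : t.toSubmodule ⊔ Submodule.span F (Set.range e) = b.toSubmodule
  sup_f : b.toSubmodule ⊔ Submodule.span F (Set.range f) = ⊤
  -- Together with `indep` this makes the quadratic part of the Casimir equation a sum of rational
  -- squares that separates vectors over `ℕ`. The roots may be linearly dependent, so all positive
  -- roots are allowed and not only simple ones.
  rational : ∀ i γ, ∃ q : ℚ, root i (u γ) = q
  indep : ∀ n : ι → ℕ, (∀ γ, ∑ i, n i • root i (u γ) = 0) → n = 0
  -- Invariance of this tensor is what makes the corresponding element of `U(g_E)` central.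
  casimir : ∀ x : g, ⁅x, ∑ γ, (u γ : g) ⊗ₜ[F] (u γ : g) +
    ∑ i, (e i ⊗ₜ[F] f i + f i ⊗ₜ[F] e i)⁆ = 0

/-! ### Criteria for solvability. -/

section Solvable

variable {F L : Type*} [Field F] [LieRing L] [LieAlgebra F L]

lemma isSolvable_of_filtration (S : ℕ → Submodule F L) (h0 : S 0 = ⊤)
    (hS : ∀ k, ∀ x ∈ S k, ∀ y ∈ S k, ⁅x, y⁆ ∈ S (k + 1)) {n : ℕ} (hn : S n = ⊥) :
    LieAlgebra.IsSolvable L := by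
  have key : ∀ k, (LieAlgebra.derivedSeries F L k).toSubmodule ≤ S k := by
    intro k
    induction k with
    | zero => simp [h0]
    | succ k ih =>
      rw [LieAlgebra.derivedSeries_def, LieAlgebra.derivedSeriesOfIdeal_succ,
        LieSubmodule.lieIdeal_oper_eq_linear_span', Submodule.span_le]
      rintro _ ⟨x, hx, y, hy, rfl⟩
      exact hS k x (ih hx) y (ih hy)
  refine LieAlgebra.IsSolvable.mk (R := F) (k := n) ?_
  rw [← LieSubmodule.toSubmodule_eq_bot, eq_bot_iff, ← hn]
  exact key n

/-- Up to the invertible scalars `±2`, each of `h`, `e`, `f` is a bracket of two members of the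
triple, so the triple stays in every term of the derived series. -/
lemma not_isSolvable_of_isSl2Triple [LieAlgebra.IsSolvable L] {h e f : L} (t : IsSl2Triple h e f)
    [CharZero F] : False := by
  have key : ∀ k, h ∈ LieAlgebra.derivedSeries F L k ∧ e ∈ LieAlgebra.derivedSeries F L k ∧
      f ∈ LieAlgebra.derivedSeries F L k := by
    intro k
    induction k with
    | zero => simp
    | succ k ih =>
      obtain ⟨h1, h2, h3⟩ := ih
      rw [LieAlgebra.derivedSeries_def, LieAlgebra.derivedSeriesOfIdeal_succ]
      rw [LieAlgebra.derivedSeries_def] at h1 h2 h3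
      have e1 : e = (2 : F)⁻¹ • ⁅h, e⁆ := by
        rw [t.lie_h_e_smul F, smul_smul, inv_mul_cancel₀ two_ne_zero, one_smul]
      have f1 : f = (-2 : F)⁻¹ • ⁅h, f⁆ := by
        rw [t.lie_lie_smul_f F, ← neg_smul, smul_smul, inv_mul_cancel₀ (neg_ne_zero.mpr two_ne_zero),
          one_smul]
      refine ⟨?_, ?_, ?_⟩
      · rw [← t.lie_e_f]
        exact LieSubmodule.lie_mem_lie h2 h3
      · rw [e1]
        exact Submodule.smul_mem _ _ (LieSubmodule.lie_mem_lie h1 h2)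
      · rw [f1]
        exact Submodule.smul_mem _ _ (LieSubmodule.lie_mem_lie h1 h3)
  obtain ⟨k, hk⟩ := LieAlgebra.IsSolvable.solvable F L
  have := (key k).1
  rw [hk] at this
  exact t.h_ne_zero (by simpa using this)

end Solvable

/-! ### Roots of a solvable subalgebra, and solvable subalgebras from sets of roots. -/

section Killing

open LieAlgebra LieAlgebra.IsKilling LieModule

variable {F L : Type*} [Field F] [CharZero F] [LieRing L] [LieAlgebra F L] [FiniteDimensional F L]
  [IsKilling F L] (H : LieSubalgebra F L) [H.IsCartanSubalgebra] [IsTriangularizable F H L]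

/-- The set of roots of `H`, as linear functionals. -/
def rootSet : Finset (Module.Dual F H) := by
  classical exact H.root.image (Weight.toLinear F H L)

variable {H}

lemma mem_rootSet {α : Module.Dual F H} :
    α ∈ rootSet H ↔ α ≠ 0 ∧ rootSpace H α ≠ ⊥ := by
  classical
  simp only [rootSet, Finset.mem_image, Finset.mem_filter, Finset.mem_univ, true_and]
  constructor
  · rintro ⟨β, hβ, rfl⟩
    exact ⟨by simpa using hβ, β.genWeightSpace_ne_bot⟩
  · rintro ⟨h1, h2⟩
    refine ⟨⟨α, h2⟩, fun h => h1 ?_, ?_⟩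
    · ext x
      exact congrFun h x
    · ext x
      rfl

/-- The root attached to an element of `rootSet H`. -/
def weightOfMem {α : Module.Dual F H} (hα : α ∈ rootSet H) : Weight F H L :=
  ⟨α, (mem_rootSet.mp hα).2⟩

lemma weightOfMem_isNonZero {α : Module.Dual F H} (hα : α ∈ rootSet H) :
    (weightOfMem hα).IsNonZero := fun h =>
  (mem_rootSet.mp hα).1 (by ext x; exact congrFun h x)

lemma neg_mem_rootSet {α : Module.Dual F H} (hα : α ∈ rootSet H) : -α ∈ rootSet H := by
  rw [mem_rootSet]
  exact ⟨neg_ne_zero.mpr (mem_rootSet.mp hα).1, (-weightOfMem hα).genWeightSpace_ne_bot⟩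

/-- Root spaces are lines, so one nonzero vector in `N` suffices. -/
lemma rootSpace_le_of_inf_ne_bot {α : Module.Dual F H} (hα : α ∈ rootSet H) {N : Submodule F L}
    {x : L} (hx : x ∈ rootSpace H α) (hx0 : x ≠ 0) (hxN : x ∈ N) :
    (rootSpace H α).toSubmodule ≤ N := by
  have h1 := finrank_rootSpace_eq_one (weightOfMem hα) (weightOfMem_isNonZero hα)
  intro y hy
  obtain ⟨c, hc⟩ := (finrank_eq_one_iff_of_nonzero' (⟨x, hx⟩ : rootSpace H α)
    (by simpa [Subtype.ext_iff] using hx0)).mp h1 ⟨y, hy⟩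
  rw [show y = c • x from (congrArg Subtype.val hc).symm]
  exact N.smul_mem c hxN

lemma exists_int_apply_coroot {α β : Module.Dual F H} (hα : α ∈ rootSet H) (hβ : β ∈ rootSet H) :
    ∃ k : ℤ, β (coroot (weightOfMem hα)) = k :=
  ⟨_, apply_coroot_eq_cast (weightOfMem hα) (weightOfMem hβ)⟩

/-- If `β(α^∨) < 0` then the bracket of nonzero vectors of weights `α` and `β` is nonzero. -/
lemma lie_ne_zero_of_apply_coroot_neg {α β : Module.Dual F H} (hα : α ∈ rootSet H)
    {x y : L} (hx : x ∈ rootSpace H α) (hx0 : x ≠ 0) (hy : y ∈ rootSpace H β) (hy0 : y ≠ 0)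
    {k : ℤ} (hk : β (coroot (weightOfMem hα)) = k) (hk0 : k < 0) : ⁅x, y⁆ ≠ 0 := by
  intro h0
  obtain ⟨h, e, f, t, he, hf⟩ := exists_isSl2Triple_of_weight_isNonZero (weightOfMem_isNonZero hα)
  have hh := t.h_eq_coroot (weightOfMem_isNonZero hα) he hf
  have hex : e ∈ Submodule.span F {x} :=
    rootSpace_le_of_inf_ne_bot hα hx hx0 (Submodule.mem_span_singleton_self x) he
  obtain ⟨c, rfl⟩ := Submodule.mem_span_singleton.mp hex
  -- If the bracket vanished, `y` would be a primitive vector of negative weight `k`, whereas in a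
  -- finite-dimensional representation of `sl₂` such a weight is a natural number.
  have P : t.HasPrimitiveVectorWith y (k : F) :=
    { ne_zero := hy0
      lie_h := by
        rw [hh, ← hk]
        exact lie_eq_smul_of_mem_rootSpace hy _
      lie_e := by rw [smul_lie, h0, smul_zero] }
  obtain ⟨n, hn⟩ := P.exists_nat
  have : k = n := by exact_mod_cast hn
  omega

/-- The roots whose root spaces lie in a solvable subalgebra are independent over `ℕ`. -/
lemma natIndependent_of_isSolvable (b : LieSubalgebra F L) [IsSolvable b]
    (Ψ : Finset (Module.Dual F H))
    (hΨ : ∀ α, α ∈ Ψ ↔ α ∈ rootSet H ∧ (rootSpace H α).toSubmodule ≤ b.toSubmodule) :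
    NatIndependent Ψ := by
  classical
  refine natIndependent_of_multiset Ψ fun s hs h0 => ?_
  let c : Module.Dual F H → Module.Dual F H →+ F := fun α =>
    if hα : α ∈ rootSet H then
      ((Module.Dual.eval F H) (coroot (weightOfMem hα))).toAddMonoidHom else 0
  have hcdef : ∀ α (hα : α ∈ rootSet H) β, c α β = β (coroot (weightOfMem hα)) := by
    intro α hα β
    simp only [c, dif_pos hα]
    rfl
  -- Opposite root spaces inside `b` would put an `sl₂`-triple into a solvable algebra.
  have hneg : ∀ α ∈ Ψ, -α ∉ Ψ := by
    intro α hα hα'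
    have hαr := ((hΨ α).mp hα).1
    obtain ⟨h, e, f, t, he, hf⟩ :=
      exists_isSl2Triple_of_weight_isNonZero (weightOfMem_isNonZero hαr)
    have heb : e ∈ b := ((hΨ α).mp hα).2 he
    have hfb : f ∈ b := ((hΨ _).mp hα').2 hf
    have hhb : h ∈ b := by rw [← t.lie_e_f]; exact b.lie_mem heb hfb
    have t' : IsSl2Triple (⟨h, hhb⟩ : b) ⟨e, heb⟩ ⟨f, hfb⟩ :=
      { h_ne_zero := fun h => t.h_ne_zero (congrArg Subtype.val h)
        lie_e_f := Subtype.ext t.lie_e_f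
        lie_h_e_nsmul := Subtype.ext t.lie_h_e_nsmul
        lie_h_f_nsmul := Subtype.ext t.lie_h_f_nsmul }
    exact not_isSolvable_of_isSl2Triple (F := F) t'
  refine eq_zero_of_sum_eq_zero_of_add_mem (↑Ψ) c (fun α hα => ?_) (fun α hα β hβ => ?_) s hs h0
  · rw [hcdef α ((hΨ α).mp hα).1]
    exact root_apply_coroot (weightOfMem_isNonZero _)
  · have hαr := ((hΨ α).mp hα).1
    have hβr := ((hΨ β).mp hβ).1
    obtain ⟨k, hk⟩ := exists_int_apply_coroot hαr hβr
    refine ⟨k, by rw [hcdef α hαr, hk], fun hk0 => ?_⟩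
    obtain ⟨x, hx, hx0⟩ := (weightOfMem hαr).exists_ne_zero
    obtain ⟨y, hy, hy0⟩ := (weightOfMem hβr).exists_ne_zero
    have hne := lie_ne_zero_of_apply_coroot_neg hαr hx hx0 hy hy0 hk hk0
    have hxy : ⁅x, y⁆ ∈ rootSpace H (α + β : Module.Dual F H) :=
      lie_mem_genWeightSpace_of_mem_genWeightSpace hx hy
    have hxyb : ⁅x, y⁆ ∈ b := b.lie_mem (((hΨ α).mp hα).2 hx) (((hΨ β).mp hβ).2 hy)
    have hab : α + β ∈ rootSet H := by
      refine mem_rootSet.mpr ⟨fun h => ?_, fun h => ?_⟩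
      · rw [eq_neg_of_add_eq_zero_left h] at hα
        exact hneg β hβ hα
      · rw [h] at hxy
        exact hne (by simpa using hxy)
    exact (hΨ _).mpr ⟨hab, rootSpace_le_of_inf_ne_bot hab hxy hne hxyb⟩

/-- The subspace `H + ∑_{α ∈ P} L_α`. -/
def parabolicSubmodule (P : Finset (Module.Dual F H)) : Submodule F L :=
  H.toSubmodule ⊔ ⨆ α ∈ P, (rootSpace H (α : Module.Dual F H)).toSubmodule

/-- The target set `R` is kept separate so that the lemma covers both closedness under brackets and
the raising of heights. -/
lemma lie_mem_iSup_rootSpace {P Q R : Finset (Module.Dual F H)}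
    (hPQ : ∀ α ∈ P, ∀ β ∈ Q, rootSpace H (α + β : Module.Dual F H) ≠ ⊥ → α + β ∈ R) {x y : L}
    (hx : x ∈ ⨆ α ∈ P, (rootSpace H (α : Module.Dual F H)).toSubmodule)
    (hy : y ∈ ⨆ α ∈ Q, (rootSpace H (α : Module.Dual F H)).toSubmodule) :
    ⁅x, y⁆ ∈ ⨆ α ∈ R, (rootSpace H (α : Module.Dual F H)).toSubmodule := by
  induction hx using Submodule.iSup_induction' with
  | zero => simp
  | add x x' _ _ h h' => rw [add_lie]; exact Submodule.add_mem _ h h'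
  | mem α x hx =>
    by_cases hα : α ∈ P
    swap
    · simp only [hα, iSup_false, Submodule.mem_bot] at hx
      simp [hx]
    simp only [hα, iSup_true] at hx
    induction hy using Submodule.iSup_induction' with
    | zero => simp
    | add y y' _ _ h h' => rw [lie_add]; exact Submodule.add_mem _ h h'
    | mem β y hy =>
      by_cases hβ : β ∈ Q
      swap
      · simp only [hβ, iSup_false, Submodule.mem_bot] at hy
        simp [hy]
      simp only [hβ, iSup_true] at hy
      have hxy : ⁅x, y⁆ ∈ rootSpace H (α + β : Module.Dual F H) :=
        lie_mem_genWeightSpace_of_mem_genWeightSpace hx hy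
      by_cases h : rootSpace H (α + β : Module.Dual F H) = ⊥
      · rw [h] at hxy
        rw [show ⁅x, y⁆ = 0 by simpa using hxy]
        exact Submodule.zero_mem _
      · exact Submodule.mem_iSup_of_mem (α + β)
          (Submodule.mem_iSup_of_mem (hPQ α hα β hβ h) hxy)

lemma lie_cartan_mem_iSup_rootSpace {P : Finset (Module.Dual F H)} {x y : L} (hx : x ∈ H)
    (hy : y ∈ ⨆ α ∈ P, (rootSpace H (α : Module.Dual F H)).toSubmodule) :
    ⁅x, y⁆ ∈ ⨆ α ∈ P, (rootSpace H (α : Module.Dual F H)).toSubmodule := by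
  induction hy using Submodule.iSup_induction' with
  | zero => simp
  | add y y' _ _ h h' => rw [lie_add]; exact Submodule.add_mem _ h h'
  | mem β y hy =>
    by_cases hβ : β ∈ P
    swap
    · simp only [hβ, iSup_false, Submodule.mem_bot] at hy
      simp [hy]
    simp only [hβ, iSup_true] at hy
    exact Submodule.mem_iSup_of_mem β (Submodule.mem_iSup_of_mem hβ
      ((rootSpace H (β : Module.Dual F H)).lie_mem (x := (⟨x, hx⟩ : H)) hy))

/-- The Cartan part drops out because `H` is abelian. This is the first step down the derived
series. -/
lemma lie_mem_of_mem_parabolicSubmodule {P : Finset (Module.Dual F H)}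
    (hP : ∀ α ∈ P, ∀ β ∈ P, rootSpace H (α + β : Module.Dual F H) ≠ ⊥ → α + β ∈ P) {x y : L}
    (hx : x ∈ parabolicSubmodule P) (hy : y ∈ parabolicSubmodule P) :
    ⁅x, y⁆ ∈ ⨆ α ∈ P, (rootSpace H (α : Module.Dual F H)).toSubmodule := by
  obtain ⟨h, hh, n, hn, rfl⟩ := Submodule.mem_sup.mp hx
  obtain ⟨h', hh', n', hn', rfl⟩ := Submodule.mem_sup.mp hy
  have h0 : ⁅h, h'⁆ = 0 := congrArg Subtype.val (trivial_lie_zero H H ⟨h, hh⟩ ⟨h', hh'⟩)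
  rw [lie_add, add_lie, add_lie, h0, zero_add]
  refine Submodule.add_mem _ ?_ (Submodule.add_mem _ (lie_cartan_mem_iSup_rootSpace hh hn')
    (lie_mem_iSup_rootSpace hP hn hn'))
  rw [← lie_skew]
  exact Submodule.neg_mem _ (lie_cartan_mem_iSup_rootSpace hh' hn)

/-- The subalgebra `H + ∑_{α ∈ P} L_α` for a closed set `P` of roots. -/
def parabolicSubalgebra (P : Finset (Module.Dual F H))
    (hP : ∀ α ∈ P, ∀ β ∈ P, rootSpace H (α + β : Module.Dual F H) ≠ ⊥ → α + β ∈ P) :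
    LieSubalgebra F L :=
  { parabolicSubmodule P with
    lie_mem' := fun hx hy =>
      le_sup_right (a := H.toSubmodule) (lie_mem_of_mem_parabolicSubmodule hP hx hy) }

lemma isSolvable_parabolicSubalgebra {P : Finset (Module.Dual F H)} (hPi : NatIndependent P)
    (hP : ∀ α ∈ P, ∀ β ∈ P, rootSpace H (α + β : Module.Dual F H) ≠ ⊥ → α + β ∈ P) :
    IsSolvable (parabolicSubalgebra P hP) := by
  classical
  obtain ⟨ht, N, hN, hht⟩ := hPi.exists_height
  -- After the first step of the filtration only root spaces remain, and bracketing raises the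
  -- height. The index of `S` is shifted by one against the height because `S 0` is the whole
  -- algebra; thus `S (N + 1) = 0`.
  let Q : ℕ → Finset (Module.Dual F H) := fun k => P.filter fun α => k ≤ ht α
  let S : ℕ → Submodule F L
    | 0 => ⊤
    | k + 1 => ⨆ α ∈ Q k, (rootSpace H (α : Module.Dual F H)).toSubmodule
  refine isSolvable_of_filtration (F := F)
    (fun k => (S k).comap (parabolicSubalgebra P hP).toSubmodule.subtype) (by simp [S]) ?_
    (n := N + 1) ?_
  · rintro (_ | k) ⟨x, hx⟩ hxS ⟨y, hy⟩ hyS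
    · have : Q 0 = P := by simp [Q]
      simp only [S, zero_add, Submodule.mem_comap, this]
      exact lie_mem_of_mem_parabolicSubmodule hP hx hy
    · refine lie_mem_iSup_rootSpace (P := Q k) (Q := Q k) ?_ hxS hyS
      intro α hα β hβ h
      obtain ⟨hα, hk⟩ := Finset.mem_filter.mp hα
      obtain ⟨hβ, -⟩ := Finset.mem_filter.mp hβ
      exact Finset.mem_filter.mpr ⟨hP α hα β hβ h, hk.trans_lt (hht α hα β hβ)⟩
  · have : Q N = ∅ := Finset.filter_eq_empty_iff.mpr fun α hα => not_le.mpr (hN α hα)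
    simp only [S, this, Finset.notMem_empty, iSup_false, iSup_bot]
    exact (parabolicSubalgebra P hP).toSubmodule.ker_subtype

end Killing

/-! ### Borel subalgebras and the Casimir tensor for a nondegenerate Killing form. -/

section Borel

open LieAlgebra LieAlgebra.IsKilling LieModule

variable {F L : Type*} [Field F] [CharZero F] [LieRing L] [LieAlgebra F L] [FiniteDimensional F L]
  [IsKilling F L] {H : LieSubalgebra F L} [H.IsCartanSubalgebra] [IsTriangularizable F H L]

/-- The roots occurring in `b` are independent over `ℕ`, hence extend to an independent set `P` that
meets each pair `±α`. The subalgebra attached to `P` is solvable and contains `b`, so it equals `b`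
by maximality. -/
lemma exists_eq_parabolicSubmodule {b : LieSubalgebra F L} (hb : IsBorelSubalgebra b)
    (hH : H ≤ b) : ∃ P : Finset (Module.Dual F H), P ⊆ rootSet H ∧ NatIndependent P ∧
      (∀ α ∈ rootSet H, α ∈ P ∨ -α ∈ P) ∧ b.toSubmodule = parabolicSubmodule P := by
  classical
  have : IsSolvable b := hb.prop
  let Ψ : Finset (Module.Dual F H) :=
    (rootSet H).filter fun α => (rootSpace H α).toSubmodule ≤ b.toSubmodule
  have hΨ : NatIndependent Ψ := natIndependent_of_isSolvable b Ψ fun α => Finset.mem_filter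
  have h0 : (0 : Module.Dual F H) ∉ rootSet H := fun h => (mem_rootSet.mp h).1 rfl
  have : IsAddTorsionFree (Module.Dual F H) := .of_isTorsionFree F _
  obtain ⟨P, hΨP, hPr, hPi, hP⟩ := hΨ.exists_extension h0 (Finset.filter_subset _ _)
  have hPn : ∀ α ∈ rootSet H, α ∈ P ∨ -α ∈ P := fun α hα => hP α hα (neg_mem_rootSet hα)
  have hsum : ∀ α ∈ P, ∀ β ∈ P, rootSpace H (α + β : Module.Dual F H) ≠ ⊥ → α + β ∈ P := by
    intro α hα β hβ h
    have hne : α + β ≠ 0 := fun h => by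
      have := hPi.eq_zero_of_sum_eq_zero (s := {α, β}) (by simp [hα, hβ]) (by simpa using h)
      simp at this
    -- Otherwise `-(α + β)` is in `P`, and `α + β - (α + β) = 0` is a relation over `ℕ`.
    refine (hPn _ (mem_rootSet.mpr ⟨hne, h⟩)).resolve_right fun hn => ?_
    have := hPi.eq_zero_of_sum_eq_zero (s := {α, β, -(α + β)}) (by
      intro v hv
      simp only [Multiset.insert_eq_cons, Multiset.mem_cons, Multiset.mem_singleton] at hv
      rcases hv with rfl | rfl | rfl
      · exact hα
      · exact hβ
      · exact hn) (by simp)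
    simp at this
  refine ⟨P, hPr, hPi, hPn, ?_⟩
  have hle : b ≤ parabolicSubalgebra P hsum := by
    -- Being stable under `H`, `b` is the sum of its intersections with the weight spaces of `H`.
    let N : LieSubmodule F H L :=
      { b.toSubmodule with lie_mem := fun {x m} hm => b.lie_mem (hH x.2) hm }
    have hN := eq_iSup_inf_genWeightSpace F H L N
    have hN' : N.toSubmodule ≤ parabolicSubmodule P := by
      rw [hN, LieSubmodule.iSup_toSubmodule, iSup_le_iff]
      rintro χ x ⟨hxN, hx⟩
      by_cases hx0 : x = 0
      · rw [hx0]
        exact Submodule.zero_mem _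
      by_cases hχ : χ.IsZero
      · refine Submodule.mem_sup_left ?_
        have : x ∈ rootSpace H (0 : H → F) := by rw [← hχ.eq]; exact hx
        rwa [rootSpace_zero_eq] at this
      · have hχ' : χ.toLinear ∈ rootSet H :=
          mem_rootSet.mpr ⟨by simpa using hχ, χ.genWeightSpace_ne_bot⟩
        have := rootSpace_le_of_inf_ne_bot hχ' hx hx0 (N := b.toSubmodule) hxN
        exact Submodule.mem_sup_right (Submodule.mem_iSup_of_mem χ.toLinear
          (Submodule.mem_iSup_of_mem (hΨP (Finset.mem_filter.mpr ⟨hχ', this⟩)) hx))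
    exact hN'
  exact congrArg LieSubalgebra.toSubmodule
    (le_antisymm hle (hb.le_of_ge (isSolvable_parabolicSubalgebra hPi hsum) hle))

/-- The element of `H` dual to the functional `α` with respect to the Killing form. -/
def dualVec (α : Module.Dual F H) : H := (cartanEquivDual H).symm α

lemma killingForm_dualVec (α : Module.Dual F H) (h : H) :
    killingForm F L (dualVec α) h = α h := by
  have : cartanEquivDual H (dualVec α) h = α h := by
    rw [dualVec, LinearEquiv.apply_symm_apply]
  exact this

lemma killingForm_cartan (h h' : H) :
    killingForm F L h h' = ∑ γ : rootSet H, γ.1 h * γ.1 h' := by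
  classical
  have h1 := LinearMap.congr_fun₂ (restrict_killingForm_eq_sum (K := F) (L := L) (H := H)) h h'
  have h2 : killingForm F L h h' = (killingForm F L).restrict H h h' := rfl
  rw [h2, h1, Finset.sum_coe_sort (rootSet H) fun γ => γ h * γ h', rootSet, Finset.sum_image]
  · simp only [LinearMap.sum_apply, LinearMap.smulRight_apply, LinearMap.smul_apply, smul_eq_mul]
  · intro α _ β _ h
    ext x
    exact LinearMap.congr_fun h x

/-- On `H` the Killing form is the sum of the squares of all roots, so `∑ dualVec γ ⊗ dualVec γ` is
the Cartan part of the Casimir tensor. Summing over all roots instead of a basis keeps the quadratic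
form a sum of squares. -/
lemma sum_smul_dualVec (h : H) : ∑ γ : rootSet H, γ.1 h • dualVec γ.1 = h := by
  apply (cartanEquivDual (K := F) (L := L) H).injective
  ext h'
  have h1 : cartanEquivDual H h h' = killingForm F L h h' := rfl
  rw [h1, killingForm_cartan, map_sum, LinearMap.sum_apply]
  refine Finset.sum_congr rfl fun γ _ => ?_
  rw [map_smul, dualVec, LinearEquiv.apply_symm_apply]
  rfl

/-- With `c = γ (dualVec γ)`, the vector `dualVec γ` is `c / 2` times the coroot, on which every
root `δ` takes an integer value `k δ`. Evaluating the Killing form on it gives `c = (c / 2) ^ 2 * ∑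
(k δ) ^ 2`, so `c = 4 / ∑ (k δ) ^ 2` is rational. -/
lemma dualVec_rational {α γ : Module.Dual F H} (hα : α ∈ rootSet H) (hγ : γ ∈ rootSet H) :
    ∃ q : ℚ, α (dualVec γ) = q := by
  set c : F := γ (dualVec γ) with hc
  have hc0 : c ≠ 0 := root_apply_cartanEquivDual_symm_ne_zero (weightOfMem_isNonZero hγ)
  have hco : dualVec γ = (c / 2) • coroot (weightOfMem hγ) := by
    have : coroot (weightOfMem hγ) = 2 • c⁻¹ • dualVec γ := rfl
    rw [this, ← Nat.cast_smul_eq_nsmul F, smul_smul, smul_smul]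
    rw [show c / 2 * (2 : ℕ) * c⁻¹ = 1 by push_cast; field_simp, one_smul]
  have hint : ∀ δ : rootSet H, ∃ k : ℤ, δ.1 (coroot (weightOfMem hγ)) = k := fun δ =>
    exists_int_apply_coroot hγ δ.2
  choose k hk using hint
  have hδ : ∀ δ : rootSet H, δ.1 (dualVec γ) = c / 2 * k δ := fun δ => by
    rw [hco, map_smul, hk, smul_eq_mul]
  have hcc : c = (c / 2) ^ 2 * (∑ δ, k δ ^ 2 : ℤ) := by
    have := killingForm_cartan (dualVec γ) (dualVec γ)
    rw [killingForm_dualVec] at this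
    rw [← hc] at this
    refine this.trans ?_
    push_cast
    rw [Finset.mul_sum]
    exact Finset.sum_congr rfl fun δ _ => by rw [hδ]; ring
  have hK : c * (∑ δ, k δ ^ 2 : ℤ) = 4 := by
    have : c * (c * (∑ δ, k δ ^ 2 : ℤ)) = c * 4 := by linear_combination (-4) * hcc
    exact mul_left_cancel₀ hc0 this
  have hK0 : ((∑ δ, k δ ^ 2 : ℤ) : F) ≠ 0 := fun h => by
    rw [h, mul_zero] at hK
    norm_num at hK
  refine ⟨2 * k ⟨α, hα⟩ / (∑ δ, k δ ^ 2 : ℤ), ?_⟩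
  rw [hδ ⟨α, hα⟩, eq_div_of_mul_eq hK0 hK]
  push_cast
  ring

lemma exists_rootVectors {α : Module.Dual F H} (hα : α ∈ rootSet H) :
    ∃ e f : L, e ∈ rootSpace H α ∧ f ∈ rootSpace H (-α : Module.Dual F H) ∧
      killingForm F L e f = 1 := by
  obtain ⟨h, e, f, t, he, hf⟩ := exists_isSl2Triple_of_weight_isNonZero (weightOfMem_isNonZero hα)
  have hef := lie_eq_killingForm_smul_of_mem_rootSpace_of_mem_rootSpace_neg he hf
  rw [t.lie_e_f] at hef
  have h0 : killingForm F L e f ≠ 0 := fun h0 => t.h_ne_zero (by rw [hef, h0, zero_smul])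
  refine ⟨e, (killingForm F L e f)⁻¹ • f, he, Submodule.smul_mem _ _ hf, ?_⟩
  rw [map_smul, smul_eq_mul, inv_mul_cancel₀ h0]

lemma rootSpace_eq_span {α : Module.Dual F H} (hα : α ∈ rootSet H) {e : L}
    (he : e ∈ rootSpace H α) (he0 : e ≠ 0) :
    (rootSpace H α).toSubmodule = Submodule.span F {e} :=
  le_antisymm (rootSpace_le_of_inf_ne_bot hα he he0 (Submodule.mem_span_singleton_self e))
    ((Submodule.span_singleton_le_iff_mem e _).mpr he)

/-- The linear endomorphism attached to a tensor by means of the Killing form. -/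
def killingTensorHom : L ⊗[F] L →ₗ[F] (L →ₗ[F] L) :=
  dualTensorHom F L L ∘ₗ LinearMap.rTensor L (killingForm F L)

lemma killingTensorHom_tmul (a b y : L) :
    killingTensorHom (F := F) (a ⊗ₜ[F] b) y = killingForm F L a y • b := rfl

lemma killingTensorHom_injective : Function.Injective (killingTensorHom (F := F) (L := L)) := by
  have h1 : Function.Injective (LinearMap.rTensor L (killingForm F L)) :=
    Module.Flat.rTensor_preserves_injective_linearMap _
      (LinearMap.ker_eq_bot.mp (ker_killingForm_eq_bot F L))
  have h2 : Function.Injective (dualTensorHom F L L) := by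
    have := (dualTensorHomEquiv F L L).injective
    intro x y hxy
    exact this (by simpa [dualTensorHomEquiv] using hxy)
  exact h2.comp h1

lemma killingTensorHom_lie (x y : L) (ω : L ⊗[F] L) :
    killingTensorHom ⁅x, ω⁆ y = ⁅x, killingTensorHom ω y⁆ - killingTensorHom ω ⁅x, y⁆ := by
  induction ω using TensorProduct.induction_on with
  | zero => simp
  | add a b ha hb =>
    rw [lie_add, map_add, LinearMap.add_apply, ha, hb, map_add, LinearMap.add_apply,
      LinearMap.add_apply, lie_add]
    abel
  | tmul a b =>
    rw [TensorProduct.LieModule.lie_tmul_right, map_add, LinearMap.add_apply,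
      killingTensorHom_tmul, killingTensorHom_tmul, killingTensorHom_tmul, killingTensorHom_tmul,
      lie_smul]
    have : killingForm F L ⁅x, a⁆ y = - killingForm F L a ⁅x, y⁆ := by
      rw [← lie_skew, map_neg, LinearMap.neg_apply, LieModule.traceForm_apply_lie_apply]
    rw [this, neg_smul]
    abel

/-- The identity of `L` is `ad`-invariant, and the passage from tensors to endomorphisms is
equivariant and injective. -/
lemma lie_eq_zero_of_killingTensorHom_eq_id {ω : L ⊗[F] L}
    (hω : killingTensorHom ω = LinearMap.id) (x : L) : ⁅x, ω⁆ = 0 := by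
  apply killingTensorHom_injective
  ext y
  rw [killingTensorHom_lie, hω]
  simp

lemma killingForm_eq_zero {α β : Module.Dual F H} {x y : L} (hx : x ∈ rootSpace H α)
    (hy : y ∈ rootSpace H β) (h : α + β ≠ 0) : killingForm F L x y = 0 :=
  killingForm_apply_eq_zero_of_mem_rootSpace_of_add_ne_zero F L H hx hy fun h0 =>
    h (by ext x; exact congrFun h0 x)

lemma mem_rootSpace_zero {h : L} (hh : h ∈ H) : h ∈ rootSpace H (0 : Module.Dual F H) := by
  have : h ∈ rootSpace H (0 : H → F) := by rwa [rootSpace_zero_eq]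
  exact this

lemma iSup_rootSpace_eq_top :
    H.toSubmodule ⊔ ⨆ α ∈ rootSet H, (rootSpace H (α : Module.Dual F H)).toSubmodule = ⊤ := by
  have h := congrArg LieSubmodule.toSubmodule (cartan_sup_iSup_rootSpace_eq_top (K := F) H)
  rw [eq_top_iff]
  rw [LieSubmodule.sup_toSubmodule, LieSubmodule.iSup_toSubmodule, LieSubmodule.top_toSubmodule] at h
  rw [← h]
  refine sup_le_sup le_rfl (iSup_le fun χ => ?_)
  rw [LieSubmodule.iSup_toSubmodule]
  refine iSup_le fun hχ => ?_
  exact le_iSup₂_of_le χ.toLinear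
    (mem_rootSet.mpr ⟨by simpa using hχ, χ.genWeightSpace_ne_bot⟩) le_rfl

theorem exists_triangularData_of_isKilling {b : LieSubalgebra F L} (hb : IsBorelSubalgebra b)
    (hH : H ≤ b) : ∃ (P R : Finset (Module.Dual F H)), Nonempty (TriangularData b H P R) := by
  classical
  obtain ⟨P, hPr, hPi, hPn, hbP⟩ := exists_eq_parabolicSubmodule hb hH
  choose e f he hf hef using fun α : P => exists_rootVectors (hPr α.2)
  have he0 : ∀ α, e α ≠ 0 := fun α h => by simpa [h] using hef α
  have hf0 : ∀ α, f α ≠ 0 := fun α h => by simpa [h] using hef α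
  have hspan : ∀ (v : P → L), ⨆ α, Submodule.span F {v α} = Submodule.span F (Set.range v) :=
    fun v => (Submodule.span_range_eq_iSup).symm
  have hE : (⨆ α ∈ P, (rootSpace H (α : Module.Dual F H)).toSubmodule) =
      Submodule.span F (Set.range e) := by
    rw [← hspan, iSup_subtype']
    exact iSup_congr fun α => rootSpace_eq_span (hPr α.2) (he α) (he0 α)
  have hsup_e : H.toSubmodule ⊔ Submodule.span F (Set.range e) = b.toSubmodule := by
    rw [hbP, parabolicSubmodule, hE]
  have hsup_f : b.toSubmodule ⊔ Submodule.span F (Set.range f) = ⊤ := by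
    rw [eq_top_iff, ← iSup_rootSpace_eq_top (H := H)]
    refine sup_le (le_sup_of_le_left fun x hx => hH hx) (iSup₂_le fun α hα => ?_)
    rcases hPn α hα with h | h
    · refine le_sup_of_le_left ?_
      rw [hbP, parabolicSubmodule]
      exact le_sup_of_le_right (le_iSup₂_of_le α h le_rfl)
    · refine le_sup_of_le_right ?_
      have := hf ⟨-α, h⟩
      simp only [neg_neg] at this
      rw [rootSpace_eq_span hα this (hf0 _)]
      exact Submodule.span_mono (by simp)
  have hne : ∀ α β : P, (α : Module.Dual F H) + β ≠ 0 := fun α β h => by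
    have := hPi.eq_zero_of_sum_eq_zero (s := {(α : Module.Dual F H), (β : Module.Dual F H)})
      (by simp) (by simpa using h)
    simp at this
  have hP0 : ∀ α : P, (α : Module.Dual F H) ≠ 0 := fun α => (mem_rootSet.mp (hPr α.2)).1
  refine ⟨P, rootSet H, ⟨
    { root := fun α => α.1
      e := e
      f := f
      u := fun γ => dualVec γ.1
      r := fun α => ⟨α.1, hPr α.2⟩
      lie_t := fun h h' => congrArg Subtype.val (trivial_lie_zero H H h h')
      lie_e := fun α h => lie_eq_smul_of_mem_rootSpace (he α) h
      lie_f := fun α h => by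
        have := lie_eq_smul_of_mem_rootSpace (hf α) h
        rw [LinearMap.neg_apply, neg_smul] at this
        exact this
      lie_e_f := fun α => by
        have := lie_eq_killingForm_smul_of_mem_rootSpace_of_mem_rootSpace_neg
          (α := weightOfMem (hPr α.2)) (he α) (hf α)
        rw [hef, one_smul] at this
        exact this
      sup_e := hsup_e
      sup_f := hsup_f
      rational := fun α γ => dualVec_rational (hPr α.2) γ.2
      indep := ?_
      casimir := lie_eq_zero_of_killingTensorHom_eq_id ?_ }⟩⟩
  -- A combination `β` of roots that vanishes on every `dualVec γ` has `dualVec β` killed by every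
  -- root, so `dualVec β = 0` by the expansion `sum_smul_dualVec`. Then `β = 0`, and independence
  -- over `ℕ` applies.
  · intro n hn
    set β : Module.Dual F H := ∑ α : P, n α • α.1 with hβ
    have hβu : ∀ γ : rootSet H, γ.1 (dualVec β) = 0 := fun γ => by
      rw [← killingForm_dualVec γ.1 (dualVec β), LieModule.traceForm_comm,
        killingForm_dualVec, hβ, LinearMap.sum_apply]
      simpa using hn γ
    have hβ0 : dualVec β = 0 := by
      rw [← sum_smul_dualVec (dualVec β)]
      exact Finset.sum_eq_zero fun γ _ => by rw [hβu, zero_smul]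
    have hβ0' : β = 0 := by simpa [dualVec] using hβ0
    have := hPi (fun α => if h : α ∈ P then n ⟨α, h⟩ else 0) (by
      rw [← Finset.sum_coe_sort P, ← hβ0', hβ]
      exact Finset.sum_congr rfl fun α _ => by simp)
    ext α
    simpa using this α α.2
  -- The tensor is shown to correspond to the identity by evaluating on `H`, on the `e β` and on the
  -- `f β`; orthogonality of root spaces leaves one kind of term in each case.
  · have hker : (⊤ : Submodule F L) ≤ LinearMap.ker (killingTensorHom (F := F) (∑ γ : rootSet H,
        (dualVec γ.1 : L) ⊗ₜ[F] (dualVec γ.1 : L) +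
          ∑ α, (e α ⊗ₜ[F] f α + f α ⊗ₜ[F] e α)) - LinearMap.id) := by
      rw [← hsup_f, ← hsup_e]
      refine sup_le (sup_le ?_ ?_) ?_
      · intro h hh
        have h1 : ∀ α, killingForm F L (e α) h = 0 := fun α =>
          killingForm_eq_zero (he α) (mem_rootSpace_zero hh) (by simpa using hP0 α)
        have h2 : ∀ α, killingForm F L (f α) h = 0 := fun α =>
          killingForm_eq_zero (hf α) (mem_rootSpace_zero hh) (by simpa using hP0 α)
        have h3 : ∑ γ : rootSet H, γ.1 ⟨h, hh⟩ • (dualVec γ.1 : L) = h := by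
          have := congrArg H.toSubmodule.subtype (sum_smul_dualVec (F := F) (L := L) ⟨h, hh⟩)
          simp only [map_sum, map_smul] at this
          exact this
        have h4 : ∀ γ : rootSet H, killingForm F L (dualVec γ.1) h = γ.1 ⟨h, hh⟩ := fun γ =>
          killingForm_dualVec γ.1 ⟨h, hh⟩
        rw [LinearMap.mem_ker]
        simp only [map_add, map_sum, LinearMap.sub_apply, LinearMap.add_apply, LinearMap.sum_apply,
          killingTensorHom_tmul, h1, h2, h4, zero_smul, add_zero, Finset.sum_const_zero, h3,
          LinearMap.id_apply, sub_self]
      · rw [Submodule.span_le]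
        rintro _ ⟨β, rfl⟩
        have h1 : ∀ α, killingForm F L (e α) (e β) = 0 := fun α =>
          killingForm_eq_zero (he α) (he β) (hne α β)
        have h2 : ∀ α, killingForm F L (f α) (e β) = if α = β then 1 else 0 := fun α => by
          split_ifs with h
          · rw [h, LieModule.traceForm_comm, hef]
          · refine killingForm_eq_zero (hf α) (he β) fun h0 => h (Subtype.ext ?_)
            rwa [neg_add_eq_zero] at h0
        have h4 : ∀ γ : rootSet H, killingForm F L (dualVec γ.1) (e β) = 0 := fun γ =>
          killingForm_eq_zero (mem_rootSpace_zero (dualVec γ.1).2) (he β) (by simpa using hP0 β)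
        simp [killingTensorHom_tmul, h1, h2, h4, LinearMap.sum_apply]
      · rw [Submodule.span_le]
        rintro _ ⟨β, rfl⟩
        have h1 : ∀ α, killingForm F L (f α) (f β) = 0 := fun α =>
          killingForm_eq_zero (hf α) (hf β) fun h0 => hne α β (by
            rw [← neg_add, neg_eq_zero] at h0
            exact h0)
        have h2 : ∀ α, killingForm F L (e α) (f β) = if α = β then 1 else 0 := fun α => by
          split_ifs with h
          · rw [h, hef]
          · refine killingForm_eq_zero (he α) (hf β) fun h0 => h (Subtype.ext ?_)
            rwa [add_neg_eq_zero] at h0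
        have h4 : ∀ γ : rootSet H, killingForm F L (dualVec γ.1) (f β) = 0 := fun γ =>
          killingForm_eq_zero (mem_rootSpace_zero (dualVec γ.1).2) (hf β) (by simpa using hP0 β)
        simp [killingTensorHom_tmul, h1, h2, h4, LinearMap.sum_apply]
    ext y
    have := hker (Submodule.mem_top (x := y))
    rw [LinearMap.mem_ker, LinearMap.sub_apply, sub_eq_zero] at this
    exact this

end Borel

/-! ### From the quotient by the center back to a reductive algebra. -/

section Reductive

open LieAlgebra LieModule

variable {F g L : Type*} [Field F] [LieRing g] [LieAlgebra F g] [LieRing L] [LieAlgebra F L]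

lemma isSolvable_of_ker_abelian (f : g →ₗ⁅F⁆ L) [IsSolvable L]
    (h : ∀ x y, f x = 0 → f y = 0 → ⁅x, y⁆ = 0) : IsSolvable g := by
  obtain ⟨k, hk⟩ := IsSolvable.solvable F L
  have hker : ∀ x ∈ derivedSeries F g k, f x = 0 := by
    intro x hx
    have := LieIdeal.derivedSeries_map_le (f := f) k (LieIdeal.mem_map hx)
    rw [hk] at this
    simpa using this
  refine IsSolvable.mk (R := F) (k := k + 1) ?_
  rw [derivedSeries_def, derivedSeriesOfIdeal_succ, ← derivedSeries_def, LieSubmodule.lie_eq_bot_iff]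
  exact fun x hx y hy => h x y (hker x hx) (hker y hy)

/-- The projection of a Lie algebra onto its quotient by an ideal. -/
def quotientProj (I : LieIdeal F g) : g →ₗ⁅F⁆ g ⧸ I :=
  { (LieSubmodule.Quotient.mk' I : g →ₗ[F] g ⧸ I) with
    map_lie' := fun {x y} => LieSubmodule.Quotient.mk_bracket I x y }

variable {π : g →ₗ⁅F⁆ L}

lemma lie_eq_zero_of_map_eq_zero (hker : ∀ x, π x = 0 ↔ x ∈ center F g) {x : g} (hx : π x = 0)
    (y : g) : ⁅x, y⁆ = 0 := by
  rw [hker, LieModule.mem_maxTrivSubmodule] at hx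
  rw [← lie_skew, hx, neg_zero]

lemma lie_eq_zero_of_map_eq_zero' (hker : ∀ x, π x = 0 ↔ x ∈ center F g) {x : g} (hx : π x = 0)
    (y : g) : ⁅y, x⁆ = 0 := by
  rw [← lie_skew, lie_eq_zero_of_map_eq_zero hker hx, neg_zero]

/-- The preimage of a solvable ideal is solvable because the kernel is central; it therefore lies in
the radical, which is the center, and has zero image. -/
lemma hasTrivialRadical_of_surjective [FiniteDimensional F g] [HasCentralRadical F g]
    (hπ : Function.Surjective π) (hker : ∀ x, π x = 0 ↔ x ∈ center F g) :
    HasTrivialRadical F L := by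
  refine hasTrivialRadical_of_no_solvable_ideals fun I hI => ?_
  let J : LieIdeal F g := I.comap π
  let φ : J →ₗ⁅F⁆ I :=
    { toFun := fun x => ⟨π x, LieIdeal.mem_comap.mp x.2⟩
      map_add' := fun x y => Subtype.ext (by simp)
      map_smul' := fun c x => Subtype.ext (by simp)
      map_lie' := fun {x y} => Subtype.ext (by simp) }
  have hJ : IsSolvable J := isSolvable_of_ker_abelian φ fun x y hx _ =>
    Subtype.ext (lie_eq_zero_of_map_eq_zero hker (congrArg Subtype.val hx) y)
  have hJ' : J ≤ center F g := by
    rw [← HasCentralRadical.radical_eq_center (R := F) (L := g)]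
    exact (LieIdeal.solvable_iff_le_radical F g J).mp hJ
  rw [LieSubmodule.eq_bot_iff]
  intro y hy
  obtain ⟨x, rfl⟩ := hπ y
  exact (hker x).mpr (hJ' (LieIdeal.mem_comap.mpr hy))

/-- A central extension of a Lie algebra with nondegenerate Killing form splits. -/
theorem exists_lieHom_section [FiniteDimensional F g] [FiniteDimensional F L] [IsKilling F L]
    (hπ : Function.Surjective π) (hker : ∀ x, π x = 0 ↔ x ∈ center F g) :
    ∃ σ : L →ₗ⁅F⁆ g, ∀ x, π (σ x) = x := by
  obtain ⟨s, hs⟩ := (π : g →ₗ[F] L).exists_rightInverse_of_surjective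
    (LinearMap.range_eq_top.mpr hπ)
  have hs' : ∀ x, π (s x) = x := fun x => LinearMap.congr_fun hs x
  have hcentral : ∀ (x y : L) (z : g), ⁅s ⁅x, y⁆, z⁆ = ⁅⁅s x, s y⁆, z⁆ := fun x y z => by
    rw [← sub_eq_zero, ← sub_lie]
    exact lie_eq_zero_of_map_eq_zero hker (by simp [hs']) z
  have hcentral' : ∀ (x y : L) (z : g), ⁅z, s ⁅x, y⁆⁆ = ⁅z, ⁅s x, s y⁆⁆ := fun x y z => by
    rw [← lie_skew, hcentral, lie_skew]
  -- The form `ψ ⁅s x, s y⁆` is a 2-cocycle. Writing it as `κ(D₀ x, y)` with the Killing form `κ`,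
  -- the cocycle identity says that `D₀` is a derivation. It is inner, `D₀ = ad u`, and invariance
  -- of `κ` turns the cocycle into the coboundary `κ(u, ⁅x, y⁆)`.
  have key : ∀ ψ : Module.Dual F g, ∃ u : L, ∀ x y, ψ ⁅s x, s y⁆ = killingForm F L u ⁅x, y⁆ := by
    intro ψ
    let κ : L ≃ₗ[F] Module.Dual F L :=
      LinearMap.BilinForm.toDual (killingForm F L) (IsKilling.killingForm_nondegenerate F L)
    let D₀ : L →ₗ[F] L := κ.symm.toLinearMap ∘ₗ
      (LinearMap.compl₂ ((LieModule.toEnd F g g : g →ₗ[F] _) ∘ₗ s) s).compr₂ ψ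
    have hD₀ : ∀ x y, killingForm F L (D₀ x) y = ψ ⁅s x, s y⁆ := by
      intro x y
      have : κ (D₀ x) y = ψ ⁅s x, s y⁆ := by
        simp only [D₀, LinearMap.comp_apply, LinearEquiv.coe_coe, LinearEquiv.apply_symm_apply]
        rfl
      exact this
    let D : LieDerivation F L L :=
      { D₀ with
        leibniz' := by
          intro x y
          apply κ.injective
          ext z
          change killingForm F L (D₀ ⁅x, y⁆) z = killingForm F L (⁅x, D₀ y⁆ - ⁅y, D₀ x⁆) z
          have e1 : ∀ v w : L, killingForm F L ⁅v, D₀ w⁆ z = - ψ ⁅s w, s ⁅v, z⁆⁆ := fun v w => by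
            rw [← lie_skew, map_neg, LinearMap.neg_apply, LieModule.traceForm_apply_lie_apply, hD₀]
          rw [map_sub, LinearMap.sub_apply, e1, e1, hD₀, hcentral, hcentral', hcentral',
            leibniz_lie (s x) (s y) (s z), map_add]
          ring }
    obtain ⟨u, hu⟩ := LieDerivation.IsKilling.exists_eq_ad D
    refine ⟨u, fun x y => ?_⟩
    rw [← hD₀, ← LieModule.traceForm_apply_lie_apply]
    have : D₀ x = ⁅u, x⁆ := by
      have := congrArg (fun d : LieDerivation F L L => d x) hu
      exact (show D x = _ from this.symm).trans (by simp)
    rw [this]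
  let K : Submodule F g := LinearMap.ker (π : g →ₗ[F] L)
  let p : g →ₗ[F] K := LinearMap.codRestrict K (LinearMap.id - s ∘ₗ (π : g →ₗ[F] L)) fun x => by
    simp [K, hs']
  let B := Module.finBasis F K
  choose u hu using fun k => key (B.coord k ∘ₗ p)
  -- The linear section is corrected by the coboundaries of the coordinates of `p = id - s ∘ π`. The
  -- correction at `⁅x, y⁆` is then `p ⁅s x, s y⁆`, so the value there becomes `⁅s x, s y⁆`; central
  -- corrections do not change brackets.
  let σ₀ : L →ₗ[F] g := s + ∑ k, (killingForm F L (u k)).smulRight (B k : g)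
  have hσ₀ : ∀ x, σ₀ x = s x + ∑ k, killingForm F L (u k) x • (B k : g) := fun x => by
    simp [σ₀, LinearMap.sum_apply]
  have hBK : ∀ k, π (B k : g) = 0 := fun k => (B k).2
  have hz : ∀ x, π (∑ k, killingForm F L (u k) x • (B k : g)) = 0 := fun x => by
    rw [map_sum]
    exact Finset.sum_eq_zero fun k _ => by rw [map_smul, hBK, smul_zero]
  refine ⟨{ σ₀ with map_lie' := ?_ }, fun x => ?_⟩
  · intro x y
    change σ₀ ⁅x, y⁆ = ⁅σ₀ x, σ₀ y⁆
    rw [hσ₀ x, hσ₀ y, add_lie, lie_add, lie_eq_zero_of_map_eq_zero hker (hz x),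
      lie_eq_zero_of_map_eq_zero' hker (hz y), add_zero, add_zero, hσ₀]
    have h1 : ∑ k, killingForm F L (u k) ⁅x, y⁆ • (B k : g) = p ⁅s x, s y⁆ := by
      conv_rhs => rw [← B.sum_repr (p ⁅s x, s y⁆)]
      rw [AddSubmonoidClass.coe_finsetSum]
      exact Finset.sum_congr rfl fun k _ => by rw [← hu]; rfl
    rw [h1]
    simp [p, hs']
  · change π (σ₀ x) = x
    rw [hσ₀, map_add, hz, add_zero, hs']

section Transfer

variable {t b : LieSubalgebra F g}

lemma center_le_of_isCartanSubalgebra [t.IsCartanSubalgebra] {x : g} (hx : x ∈ center F g) :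
    x ∈ t := by
  rw [← LieSubalgebra.IsCartanSubalgebra.self_normalizing (H := t), LieSubalgebra.mem_normalizer_iff']
  intro y _
  rw [(LieModule.mem_maxTrivSubmodule F g g x).mp hx y]
  exact t.zero_mem

/-- The homomorphism from a subalgebra onto its image. -/
def mapHom (π : g →ₗ⁅F⁆ L) (t : LieSubalgebra F g) : t →ₗ⁅F⁆ (t.map π) :=
  { toFun := fun x => ⟨π x, x, x.2, rfl⟩
    map_add' := fun x y => Subtype.ext (by simp)
    map_smul' := fun c x => Subtype.ext (by simp)
    map_lie' := fun {x y} => Subtype.ext (by simp) }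

lemma mapHom_surjective : Function.Surjective (mapHom π t) := by
  rintro ⟨_, x, hx, rfl⟩
  exact ⟨⟨x, hx⟩, rfl⟩

lemma isCartanSubalgebra_map [ht : t.IsCartanSubalgebra] (hπ : Function.Surjective π)
    (hker : ∀ x, π x = 0 ↔ x ∈ center F g) : (t.map π).IsCartanSubalgebra where
  nilpotent := (mapHom_surjective (π := π) (t := t)).lieAlgebra_isNilpotent
  self_normalizing := by
    refine le_antisymm (fun y hy => ?_) (LieSubalgebra.le_normalizer _)
    obtain ⟨x, rfl⟩ := hπ y
    refine ⟨x, ?_, rfl⟩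
    change x ∈ t
    rw [← ht.self_normalizing, LieSubalgebra.mem_normalizer_iff']
    intro h hh
    obtain ⟨h', hh', hhx⟩ := (LieSubalgebra.mem_normalizer_iff' _ _).mp hy (π h) ⟨h, hh, rfl⟩
    have hc : π (⁅h, x⁆ - h') = 0 := by
      rw [map_sub, LieHom.map_lie, sub_eq_zero]
      exact hhx.symm
    have := t.add_mem (center_le_of_isCartanSubalgebra (t := t) ((hker _).mp hc)) hh'
    rwa [sub_add_cancel] at this

lemma isTriangularizable_map (hπ : Function.Surjective π) [(t.map π).IsCartanSubalgebra]
    (hsplit : ∀ h : t, ⨆ c : F, (LieAlgebra.ad F g h).maxGenEigenspace c = ⊤) :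
    IsTriangularizable F (t.map π) L where
  maxGenEigenspace_eq_top := by
    rintro ⟨_, h, hh, rfl⟩
    have hr : LinearMap.range (π : g →ₗ[F] L) = ⊤ := LinearMap.range_eq_top.mpr hπ
    rw [eq_top_iff, ← hr, LinearMap.range_eq_map,
      ← hsplit ⟨h, hh⟩, Submodule.map_iSup]
    refine iSup_mono fun c => ?_
    rintro _ ⟨x, hx, rfl⟩
    obtain ⟨k, hk⟩ := (Module.End.mem_maxGenEigenspace _ _ _).mp hx
    refine (Module.End.mem_maxGenEigenspace _ _ _).mpr ⟨k, ?_⟩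
    have key : ∀ (k : ℕ) (y : g), ((toEnd F (t.map π) L ⟨π h, h, hh, rfl⟩ - c • 1) ^ k) (π y) =
        π (((LieAlgebra.ad F g h - c • 1) ^ k) y) := by
      intro k
      induction k with
      | zero => intro y; rfl
      | succ k ih =>
        intro y
        rw [pow_succ, pow_succ, Module.End.mul_apply, Module.End.mul_apply, ← ih]
        congr 1
        simp
    exact (key k x).trans (by
      have : ((LieAlgebra.ad F g h - c • 1) ^ k) x = 0 := hk
      rw [this, map_zero])

/-- A solvable subalgebra containing the image has solvable preimage, since the kernel is central,
and maximality of `b` applies to that preimage. -/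
lemma isBorelSubalgebra_map (hπ : Function.Surjective π)
    (hker : ∀ x, π x = 0 ↔ x ∈ center F g) (hb : IsBorelSubalgebra b) :
    IsBorelSubalgebra (b.map π) := by
  have hbs : IsSolvable b := hb.prop
  refine ⟨(mapHom_surjective (π := π) (t := b)).lieAlgebra_isSolvable, fun s hs hbs' => ?_⟩
  have : IsSolvable s := hs
  let φ : (s.comap π) →ₗ⁅F⁆ s :=
    { toFun := fun x => ⟨π x, x.2⟩
      map_add' := fun x y => Subtype.ext (by simp)
      map_smul' := fun c x => Subtype.ext (by simp)
      map_lie' := fun {x y} => Subtype.ext (by simp) }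
  have hs' : IsSolvable (s.comap π) := isSolvable_of_ker_abelian φ fun x y hx _ =>
    Subtype.ext (lie_eq_zero_of_map_eq_zero hker (congrArg Subtype.val hx) y)
  have hle : s.comap π ≤ b := hb.le_of_ge hs' fun x hx => hbs' ⟨x, hx, rfl⟩
  intro y hy
  obtain ⟨x, rfl⟩ := hπ y
  exact ⟨x, hle hy, rfl⟩

/-- Triangular data lift along a split central extension. -/
def TriangularData.lift {ι Γ : Type*} [Fintype ι] [Fintype Γ] {σ : L →ₗ⁅F⁆ g}
    [t.IsCartanSubalgebra] (htb : t ≤ b) (hker : ∀ x, π x = 0 ↔ x ∈ center F g)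
    (hσ : ∀ x, π (σ x) = x) (d : TriangularData (b.map π) (t.map π) ι Γ) :
    TriangularData b t ι Γ :=
  have hc : ∀ x, x - σ (π x) ∈ t := fun x =>
    center_le_of_isCartanSubalgebra ((hker _).mp (by rw [map_sub, hσ, sub_self]))
  have hmem : ∀ (s : LieSubalgebra F g), t ≤ s → ∀ y ∈ s.map π, σ y ∈ s := by
    rintro s hs _ ⟨x, hx, rfl⟩
    have := s.sub_mem hx (hs (hc x))
    rwa [sub_sub_cancel] at this
  -- Elements differing by a central element have the same brackets, so every bracket of `g` can be
  -- computed in `L` and carried back by `σ`.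
  have hlie : ∀ x y, ⁅x, y⁆ = σ ⁅π x, π y⁆ := fun x y => by
    have h1 : ⁅x - σ (π x), y⁆ = 0 :=
      lie_eq_zero_of_map_eq_zero hker (by rw [map_sub, hσ, sub_self]) y
    have h2 : ⁅σ (π x), y - σ (π y)⁆ = 0 :=
      lie_eq_zero_of_map_eq_zero' hker (by rw [map_sub, hσ, sub_self]) _
    rw [sub_lie, sub_eq_zero] at h1
    rw [lie_sub, sub_eq_zero] at h2
    rw [h1, h2, LieHom.map_lie]
  have hsup : ∀ (s : Submodule F g) (s' : Submodule F L) (v : ι → L) (r : Submodule F g),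
      t.toSubmodule ≤ s → s' ⊔ Submodule.span F (Set.range v) = r.map (π : g →ₗ[F] L) →
      (∀ y ∈ s', σ y ∈ s) → r ≤ s ⊔ Submodule.span F (Set.range fun i => σ (v i)) := by
    intro s s' v r hs h h' x hx
    have h1 : π x ∈ s' ⊔ Submodule.span F (Set.range v) := h ▸ ⟨x, hx, rfl⟩
    obtain ⟨y, hy, z, hz, hyz⟩ := Submodule.mem_sup.mp h1
    have h2 : x = (x - σ (π x)) + σ y + σ z := by rw [add_assoc, ← map_add, hyz, sub_add_cancel]
    rw [h2]
    refine Submodule.add_mem _ (Submodule.add_mem _ (Submodule.mem_sup_left (hs (hc x)))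
      (Submodule.mem_sup_left (h' y hy))) (Submodule.mem_sup_right ?_)
    have := Submodule.mem_map_of_mem (f := (σ : L →ₗ[F] g)) hz
    rw [Submodule.map_span, ← Set.range_comp] at this
    exact this
  { root := fun i => d.root i ∘ₗ (mapHom π t : t →ₗ[F] t.map π)
    e := fun i => σ (d.e i)
    f := fun i => σ (d.f i)
    u := fun γ => ⟨σ (d.u γ), hmem t le_rfl _ (d.u γ).2⟩
    r := d.r
    lie_t := fun h h' => by
      have := d.lie_t (mapHom π t h) (mapHom π t h')
      rw [hlie]
      exact (congrArg σ this).trans (map_zero σ)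
    lie_e := fun i h => by
      have := congrArg σ (d.lie_e i (mapHom π t h))
      rw [map_smul] at this
      rw [hlie, hσ]
      exact this
    lie_f := fun i h => by
      have := congrArg σ (d.lie_f i (mapHom π t h))
      rw [map_neg, map_smul] at this
      rw [hlie, hσ]
      exact this
    lie_e_f := fun i => by rw [← LieHom.map_lie, d.lie_e_f]
    sup_e := by
      refine le_antisymm (sup_le htb ?_) (hsup _ _ d.e _ le_rfl d.sup_e fun y hy => hmem t le_rfl y hy)
      rw [Submodule.span_le]
      rintro _ ⟨i, rfl⟩
      refine hmem b htb _ ?_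
      have : d.e i ∈ (b.map π).toSubmodule := by
        rw [← d.sup_e]
        exact Submodule.mem_sup_right (Submodule.subset_span ⟨i, rfl⟩)
      exact this
    sup_f := by
      rw [eq_top_iff]
      refine hsup _ _ d.f _ htb (d.sup_f.trans ?_) fun y hy => hmem b htb y hy
      rw [eq_comm, ← LinearMap.range_eq_map, LinearMap.range_eq_top]
      exact fun y => ⟨σ y, hσ y⟩
    rational := fun i γ => by
      obtain ⟨q, hq⟩ := d.rational i γ
      refine ⟨q, ?_⟩
      rw [← hq]
      exact congrArg (d.root i) (Subtype.ext (hσ _))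
    indep := fun n hn => d.indep n fun γ => by
      rw [← hn γ]
      exact Finset.sum_congr rfl fun i _ => congrArg (fun v => n i • d.root i v)
        (Subtype.ext (hσ _).symm)
    casimir := fun x => by
      have key : ∀ ω : L ⊗[F] L,
          ⁅x, TensorProduct.map (σ : L →ₗ[F] g) (σ : L →ₗ[F] g) ω⁆ =
          TensorProduct.map (σ : L →ₗ[F] g) (σ : L →ₗ[F] g) ⁅π x, ω⁆ := by
        intro ω
        induction ω using TensorProduct.induction_on with
        | zero => simp
        | add a b ha hb => rw [map_add, lie_add, ha, hb, lie_add, map_add]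
        | tmul a b =>
          rw [TensorProduct.map_tmul, TensorProduct.LieModule.lie_tmul_right,
            TensorProduct.LieModule.lie_tmul_right, map_add, TensorProduct.map_tmul,
            TensorProduct.map_tmul]
          simp only [LieHom.coe_toLinearMap]
          rw [hlie x (σ a), hlie x (σ b), hσ, hσ]
      have h := key (∑ γ, (d.u γ : L) ⊗ₜ[F] (d.u γ : L) +
        ∑ i, (d.e i ⊗ₜ[F] d.f i + d.f i ⊗ₜ[F] d.e i))
      rw [d.casimir (π x), map_zero] at h
      simp only [map_add, map_sum, TensorProduct.map_tmul] at h
      exact h }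

end Transfer

end Reductive

theorem exists_triangularData {F : Type u₁} {g : Type u₂} [Field F] [LieRing g] [LieAlgebra F g]
    [CharZero F] {b t : LieSubalgebra F g} (hbt : IsSplitReductiveTriple b t) :
    ∃ (ι Γ : Type (max u₁ u₂)) (_ : Fintype ι) (_ : Fintype Γ),
      Nonempty (TriangularData b t ι Γ) := by
  have := hbt.finiteDimensional
  have := hbt.reductive
  have := hbt.cartan
  let π := quotientProj (LieAlgebra.center F g)
  have hπ : Function.Surjective π := Submodule.Quotient.mk_surjective _
  have hker : ∀ x, π x = 0 ↔ x ∈ LieAlgebra.center F g := fun x =>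
    Submodule.Quotient.mk_eq_zero _
  have : FiniteDimensional F (g ⧸ LieAlgebra.center F g) :=
    Module.Finite.of_surjective (π : g →ₗ[F] _) hπ
  have := hasTrivialRadical_of_surjective hπ hker
  have := isCartanSubalgebra_map (t := t) hπ hker
  have := isTriangularizable_map hπ hbt.split
  obtain ⟨σ, hσ⟩ := exists_lieHom_section hπ hker
  obtain ⟨P, R, ⟨d⟩⟩ := exists_triangularData_of_isKilling (isBorelSubalgebra_map hπ hker hbt.borel)
    (H := t.map π) (by
      rintro _ ⟨x, hx, rfl⟩
      exact ⟨x, hbt.le_borel hx, rfl⟩)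
  exact ⟨P, R, inferInstance, inferInstance, ⟨d.lift hbt.le_borel hker hσ⟩⟩

/-! ### Generators of `U(g_E)` and local finiteness. -/

section Generators

attribute [local instance] LieRing.ofAssociativeRing

variable {F : Type*} [Field F] (E : Type*) [Field E] [Algebra F E]
variable {g : Type*} [LieRing g] [LieAlgebra F g]

/-- By the universal property, `ι` lifts to a map into the subalgebra it generates, and composing
with the inclusion gives the identity. -/
lemma adjoin_range_ι (L : Type*) [LieRing L] [LieAlgebra E L] :
    Algebra.adjoin E (Set.range (UniversalEnvelopingAlgebra.ι E : L → _)) = ⊤ := by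
  set S := Algebra.adjoin E (Set.range (UniversalEnvelopingAlgebra.ι E : L → _)) with hS
  let f : L →ₗ⁅E⁆ S :=
    { toFun := fun x => ⟨UniversalEnvelopingAlgebra.ι E x, Algebra.subset_adjoin ⟨x, rfl⟩⟩
      map_add' := fun x y => Subtype.ext (by simp)
      map_smul' := fun c x => Subtype.ext (by simp)
      map_lie' := fun {x y} => Subtype.ext (by
        simp [LieRing.of_associative_ring_bracket]) }
  have h : S.val.comp (UniversalEnvelopingAlgebra.lift E f) = AlgHom.id E _ := by
    apply UniversalEnvelopingAlgebra.hom_ext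
    ext x
    change S.val (UniversalEnvelopingAlgebra.lift E f (UniversalEnvelopingAlgebra.ι E x)) = _
    rw [UniversalEnvelopingAlgebra.lift_ι_apply]
    rfl
  rw [eq_top_iff]
  intro x _
  have := AlgHom.congr_fun h x
  rw [AlgHom.id_apply] at this
  rw [← this]
  exact (UniversalEnvelopingAlgebra.lift E f x).2

/-- The generator of `U(g_E)` attached to an element of `g`. -/
def gen (x : g) : UgE F E g := UniversalEnvelopingAlgebra.ι E ((1 : E) ⊗ₜ[F] x)

lemma gen_add (x y : g) : gen (F := F) E (x + y) = gen (F := F) E x + gen (F := F) E y := by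
  simp [gen, TensorProduct.tmul_add]

lemma gen_zero : gen (F := F) E (0 : g) = 0 := by
  simp [gen]

lemma gen_smul (c : F) (x : g) : gen (F := F) E (c • x) = algebraMap F E c • gen (F := F) E x := by
  rw [gen, gen, ← map_smul, TensorProduct.smul_tmul', ← TensorProduct.smul_tmul,
    Algebra.smul_def, smul_eq_mul]

lemma gen_lie (x y : g) : gen (F := F) E ⁅x, y⁆ =
    gen (F := F) E x * gen (F := F) E y - gen (F := F) E y * gen (F := F) E x := by
  rw [← LieRing.of_associative_ring_bracket, gen, gen, gen, ← LieHom.map_lie]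
  simp

lemma ι_tmul (c : E) (x : g) :
    UniversalEnvelopingAlgebra.ι E (c ⊗ₜ[F] x) = c • gen (F := F) E x := by
  rw [gen, ← map_smul, TensorProduct.smul_tmul', smul_eq_mul, mul_one]

lemma baseChangeIncl_tmul (s : LieSubalgebra F g) (c : E) (x : s) :
    baseChangeIncl E s (c ⊗ₜ[F] x) = c ⊗ₜ[F] (x : g) := rfl

lemma adjoin_range_gen : Algebra.adjoin E (Set.range (gen (F := F) (g := g) E)) = ⊤ := by
  rw [eq_top_iff, ← adjoin_range_ι, Algebra.adjoin_le_iff]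
  rintro _ ⟨x, rfl⟩
  change UniversalEnvelopingAlgebra.ι E x ∈ Algebra.adjoin E _
  induction x using TensorProduct.induction_on with
  | zero => simp
  | add x y hx hy => rw [map_add]; exact add_mem hx hy
  | tmul c x =>
    rw [ι_tmul]
    exact Subalgebra.smul_mem _ (Algebra.subset_adjoin (Set.mem_range_self x)) c

variable {E}
variable {M : Type*} [AddCommGroup M] [Module E M]
  [Module (UgE F E g) M] [IsScalarTower E (UgE F E g) M]

lemma gen_lie_smul (x y : g) (m : M) :
    gen (F := F) E ⁅x, y⁆ • m =
      gen (F := F) E x • gen (F := F) E y • m - gen (F := F) E y • gen (F := F) E x • m := by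
  rw [gen_lie, sub_smul, mul_smul, mul_smul]

lemma smul_gen_comm (c : E) (a : UgE F E g) (m : M) : a • c • m = c • a • m := by
  rw [← algebraMap_smul (UgE F E g) c m, ← algebraMap_smul (UgE F E g) c (a • m), smul_smul,
    smul_smul, Algebra.commutes]

lemma smul_mem_of_gen_smul_mem {V : Submodule E M}
    (hV : ∀ (x : g), ∀ m ∈ V, gen (F := F) E x • m ∈ V) (a : UgE F E g) {m : M} (hm : m ∈ V) :
    a • m ∈ V := by
  have ha : a ∈ Algebra.adjoin E (Set.range (gen (F := F) (g := g) E)) := by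
    rw [adjoin_range_gen]; trivial
  induction ha using Algebra.adjoin_induction generalizing m with
  | mem _ h => obtain ⟨x, rfl⟩ := h; exact hV x m hm
  | algebraMap c => rw [algebraMap_smul]; exact V.smul_mem c hm
  | add a b _ _ ha hb => rw [add_smul]; exact V.add_mem (ha hm) (hb hm)
  | mul a b _ _ ha hb => rw [mul_smul]; exact ha (hb hm)

/-- A subspace stable under `g`, as a submodule over `U(g_E)`. -/
def submoduleOfGen (V : Submodule E M) (hV : ∀ (x : g), ∀ m ∈ V, gen (F := F) E x • m ∈ V) :
    Submodule (UgE F E g) M :=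
  { V with smul_mem' := fun a _ hm => smul_mem_of_gen_smul_mem hV a hm }

/-- A subspace is stable under a subalgebra `s` of `g`. -/
def IsStableUnder (s : LieSubalgebra F g) (V : Submodule E M) : Prop :=
  ∀ x ∈ s, ∀ m ∈ V, gen (F := F) E x • m ∈ V

lemma IsStableUnder.envelopingIncl_smul_mem {s : LieSubalgebra F g} {V : Submodule E M}
    (hV : IsStableUnder s V) (a : UniversalEnvelopingAlgebra E (E ⊗[F] s)) {m : M} (hm : m ∈ V) :
    envelopingIncl E s a • m ∈ V := by
  have ha : a ∈ Algebra.adjoin E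
      (Set.range (UniversalEnvelopingAlgebra.ι E : E ⊗[F] s → _)) := by
    rw [adjoin_range_ι]; trivial
  induction ha using Algebra.adjoin_induction generalizing m with
  | mem _ h =>
    obtain ⟨x, rfl⟩ := h
    rw [envelopingIncl, UniversalEnvelopingAlgebra.lift_ι_apply]
    change UniversalEnvelopingAlgebra.ι E (baseChangeIncl E s x) • m ∈ V
    induction x using TensorProduct.induction_on with
    | zero => simp
    | add x y hx hy => rw [map_add, map_add, add_smul]; exact V.add_mem hx hy
    | tmul c x =>
      rw [baseChangeIncl_tmul, ι_tmul, smul_assoc]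
      exact V.smul_mem c (hV x x.2 m hm)
  | algebraMap c => rw [AlgHom.commutes, algebraMap_smul]; exact V.smul_mem c hm
  | add a b _ _ ha hb => rw [map_add, add_smul]; exact V.add_mem (ha hm) (hb hm)
  | mul a b _ _ ha hb => rw [map_mul, mul_smul]; exact ha (hb hm)

lemma IsStableUnder.ι_smul_mem {s : LieSubalgebra F g} {V : Submodule E M}
    (hV : IsStableUnder s V) (a : E ⊗[F] s) {m : M} (hm : m ∈ V) :
    UniversalEnvelopingAlgebra.ι E (baseChangeIncl E s a) • m ∈ V := by
  have := hV.envelopingIncl_smul_mem (UniversalEnvelopingAlgebra.ι E a) hm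
  rwa [envelopingIncl, UniversalEnvelopingAlgebra.lift_ι_apply] at this

lemma isLocallyFinite_iff (b : LieSubalgebra F g) :
    IsLocallyFinite E M b ↔ ∀ m : M, ∃ V : Submodule E M, FiniteDimensional E V ∧ m ∈ V ∧
      IsStableUnder b V := by
  refine forall_congr' fun m => ⟨fun h => ⟨_, h, ⟨1, ?_⟩, ?_⟩, ?_⟩
  · change envelopingIncl E b 1 • m = m
    rw [map_one, one_smul]
  · rintro x hx _ ⟨a, rfl⟩
    refine ⟨UniversalEnvelopingAlgebra.ι E ((1 : E) ⊗ₜ[F] (⟨x, hx⟩ : b)) * a, ?_⟩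
    change envelopingIncl E b _ • m = gen (F := F) E x • envelopingIncl E b a • m
    rw [map_mul, mul_smul, envelopingIncl, UniversalEnvelopingAlgebra.lift_ι_apply]
    rfl
  · rintro ⟨V, hV, hm, hs⟩
    refine Submodule.finiteDimensional_of_le (S₂ := V) ?_
    rintro _ ⟨a, rfl⟩
    exact hs.envelopingIncl_smul_mem a hm

section Transfer

variable {M' : Type*} [AddCommGroup M'] [Module E M']
  [Module (UgE F E g) M'] [IsScalarTower E (UgE F E g) M']
variable {M'' : Type*} [AddCommGroup M''] [Module E M'']
  [Module (UgE F E g) M''] [IsScalarTower E (UgE F E g) M'']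
variable {b : LieSubalgebra F g}

lemma IsStableUnder.map {V : Submodule E M} (hV : IsStableUnder b V) (f : M →ₗ[UgE F E g] M') :
    IsStableUnder b (V.map (f.restrictScalars E)) := by
  rintro x hx _ ⟨m, hm, rfl⟩
  exact ⟨gen (F := F) E x • m, hV x hx m hm, f.map_smul _ _⟩

lemma IsStableUnder.comap {V : Submodule E M'} (hV : IsStableUnder b V)
    (f : M →ₗ[UgE F E g] M') : IsStableUnder b (V.comap (f.restrictScalars E)) := by
  intro x hx m hm
  change f (gen (F := F) E x • m) ∈ V
  rw [f.map_smul]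
  exact hV x hx _ hm

lemma IsStableUnder.sup {V W : Submodule E M} (hV : IsStableUnder b V) (hW : IsStableUnder b W) :
    IsStableUnder b (V ⊔ W) := by
  intro x hx m hm
  obtain ⟨y, hy, z, hz, rfl⟩ := Submodule.mem_sup.mp hm
  rw [smul_add]
  exact Submodule.add_mem_sup (hV x hx y hy) (hW x hx z hz)

lemma isLocallyFinite_of_injective (h : IsLocallyFinite E M' b) (f : M →ₗ[UgE F E g] M')
    (hf : Function.Injective f) : IsLocallyFinite E M b := by
  rw [isLocallyFinite_iff] at h ⊢
  intro m
  obtain ⟨V, hV, hm, hs⟩ := h (f m)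
  refine ⟨V.comap (f.restrictScalars E), ?_, hm, hs.comap f⟩
  let φ : V.comap (f.restrictScalars E) →ₗ[E] V :=
    (f.restrictScalars E).restrict fun x hx => hx
  exact FiniteDimensional.of_injective φ fun x y hxy =>
    Subtype.ext (hf (congrArg Subtype.val hxy))

lemma isLocallyFinite_of_surjective (h : IsLocallyFinite E M b) (f : M →ₗ[UgE F E g] M')
    (hf : Function.Surjective f) : IsLocallyFinite E M' b := by
  rw [isLocallyFinite_iff] at h ⊢
  intro m
  obtain ⟨m, rfl⟩ := hf m
  obtain ⟨V, hV, hm, hs⟩ := h m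
  exact ⟨V.map (f.restrictScalars E), inferInstance, ⟨m, hm, rfl⟩, hs.map f⟩

lemma IsLocallyFinite.exists_of_finite (h : IsLocallyFinite E M b) {S : Set M} (hS : S.Finite) :
    ∃ V : Submodule E M, FiniteDimensional E V ∧ S ⊆ V ∧ IsStableUnder b V := by
  rw [isLocallyFinite_iff] at h
  induction S, hS using Set.Finite.induction_on with
  | empty => exact ⟨⊥, inferInstance, by simp, fun x _ m hm => by
      rw [Submodule.mem_bot] at hm ⊢; rw [hm, smul_zero]⟩
  | @insert a S _ _ ih =>
    obtain ⟨V, hV, hSV, hs⟩ := ih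
    obtain ⟨W, hW, ha, hs'⟩ := h a
    refine ⟨V ⊔ W, inferInstance, ?_, hs.sup hs'⟩
    rw [Set.insert_subset_iff]
    exact ⟨Submodule.mem_sup_right ha, fun x hx => Submodule.mem_sup_left (hSV hx)⟩

/-- Take a finite-dimensional stable `V` around `p m` and a linear section `s` over `E`. The
failures of `s` to commute with a basis of `b` on a basis of `V` are finitely many elements coming
from `M`; a finite-dimensional stable `W` absorbs them, and `s V + f W` is stable. -/
lemma isLocallyFinite_of_exact [FiniteDimensional F g] (h : IsLocallyFinite E M b)
    (h'' : IsLocallyFinite E M'' b) (f : M →ₗ[UgE F E g] M') (p : M' →ₗ[UgE F E g] M'')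
    (hp : Function.Surjective p) (hfp : Function.Exact f p) : IsLocallyFinite E M' b := by
  rw [isLocallyFinite_iff]
  rw [isLocallyFinite_iff] at h''
  intro m
  obtain ⟨V, hV, hm, hs⟩ := h'' (p m)
  obtain ⟨s, hps⟩ := (p.restrictScalars E).exists_rightInverse_of_surjective
    (LinearMap.range_eq_top.mpr hp)
  replace hps : ∀ y, p (s y) = y := fun y => LinearMap.congr_fun hps y
  let B := Module.finBasis F b
  let C := Module.finBasis E V
  have hn : ∀ i j, ∃ n, f n =
      gen (F := F) E (B i : g) • s (C j) - s (gen (F := F) E (B i : g) • (C j : M'')) :=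
    fun i j => (hfp _).mp (by rw [map_sub, p.map_smul, hps, hps, sub_self])
  choose n hn using hn
  obtain ⟨n₀, hn₀⟩ : ∃ n, f n = m - s (p m) := (hfp _).mp (by rw [map_sub, hps, sub_self])
  obtain ⟨W, hW, hSW, hsW⟩ := h.exists_of_finite
    ((Set.finite_range fun ij : _ × _ => n ij.1 ij.2).insert n₀)
  let U : Submodule E M' := V.map s ⊔ W.map (f.restrictScalars E)
  refine ⟨U, inferInstance, ?_, ?_⟩
  · rw [← sub_add_cancel m (s (p m)), ← hn₀, add_comm]
    exact Submodule.add_mem_sup ⟨_, hm, rfl⟩ ⟨n₀, hSW (Set.mem_insert _ _), rfl⟩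
  · intro x hx y hy
    obtain ⟨_, ⟨z, hz, rfl⟩, w, hw, rfl⟩ := Submodule.mem_sup.mp hy
    rw [smul_add]
    refine Submodule.add_mem _ ?_ (Submodule.mem_sup_right ((hsW.map f) x hx w hw))
    have hbase : ∀ i j, gen (F := F) E (B i : g) • s (C j) ∈ U := fun i j => by
      rw [← sub_add_cancel (gen (F := F) E (B i : g) • s (C j))
        (s (gen (F := F) E (B i : g) • (C j : M''))), ← hn,
        add_comm]
      exact Submodule.add_mem_sup ⟨_, hs _ (B i).2 _ (C j).2, rfl⟩
        ⟨n i j, hSW (Set.mem_insert_of_mem _ ⟨(i, j), rfl⟩), rfl⟩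
    have hx' : ∀ j, gen (F := F) E x • s (C j) ∈ U := by
      intro j
      have hspan : (⟨x, hx⟩ : b) ∈ Submodule.span F (Set.range B) := by
        rw [B.span_eq]; trivial
      have : ∀ y : b, y ∈ Submodule.span F (Set.range B) → gen (F := F) E (y : g) • s (C j) ∈ U := by
        intro y hy
        induction hy using Submodule.span_induction with
        | mem _ h => obtain ⟨i, rfl⟩ := h; exact hbase i j
        | zero => rw [show ((0 : b) : g) = 0 from rfl, gen_zero, zero_smul]; exact U.zero_mem
        | add y z _ _ hy hz =>
          rw [show ((y + z : b) : g) = (y : g) + (z : g) from rfl, gen_add, add_smul]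
          exact U.add_mem hy hz
        | smul c y _ hy =>
          rw [show ((c • y : b) : g) = c • (y : g) from rfl, gen_smul, smul_assoc]
          exact U.smul_mem _ hy
      exact this _ hspan
    have : ∀ z : V, gen (F := F) E x • s z ∈ U := by
      intro z
      rw [← C.sum_repr z, AddSubmonoidClass.coe_finsetSum, map_sum, Finset.smul_sum]
      refine Submodule.sum_mem _ fun j _ => ?_
      rw [Submodule.coe_smul, map_smul, smul_gen_comm]
      exact U.smul_mem _ (hx' j)
    exact this ⟨z, hz⟩

end Transfer

end Generators

/-! ### Elements annihilated by a split polynomial. -/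

section Eigenspaces

open Polynomial

/-- The space may be infinite-dimensional. Splitting off the full power of one root leaves a coprime
factor of smaller degree, and the kernel of the product is the sum of the two kernels. -/
lemma mem_iSup_maxGenEigenspace_of_aeval_eq_zero {K V : Type*} [Field K] [AddCommGroup V]
    [Module K V] (φ : Module.End K V) {p : K[X]} (hp : p ≠ 0) (hs : p.Splits) {m : V}
    (hm : aeval φ p m = 0) : m ∈ ⨆ c : K, φ.maxGenEigenspace c := by
  induction hn : p.natDegree using Nat.strong_induction_on generalizing p m with
  | _ n ih =>
    by_cases h0 : p.degree = 0
    · rw [Polynomial.eq_C_of_degree_eq_zero h0] at hm hp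
      rw [aeval_C, Module.algebraMap_end_apply] at hm
      rw [(smul_eq_zero.mp hm).resolve_left fun h => hp (by rw [h, C_0])]
      exact Submodule.zero_mem _
    · obtain ⟨a, ha⟩ := hs.exists_eval_eq_zero h0
      obtain ⟨q, hpq, hq⟩ := p.exists_eq_pow_rootMultiplicity_mul_and_not_dvd hp a
      set k := p.rootMultiplicity a with hk
      have hk0 : 0 < k := (rootMultiplicity_pos hp).mpr ha
      have hq0 : q ≠ 0 := fun h => hp (by rw [hpq, h, mul_zero])
      have hcop : IsCoprime ((X - C a) ^ k) q :=
        IsCoprime.pow_left ((irreducible_X_sub_C a).coprime_iff_not_dvd.mpr hq)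
      have hmem : m ∈ LinearMap.ker (aeval φ ((X - C a) ^ k * q)) := by
        rw [← hpq]; exact hm
      rw [← sup_ker_aeval_eq_ker_aeval_mul_of_coprime φ hcop] at hmem
      obtain ⟨x, hx, y, hy, rfl⟩ := Submodule.mem_sup.mp hmem
      refine Submodule.add_mem _ (Submodule.mem_iSup_of_mem a ?_) ?_
      · rw [Module.End.mem_maxGenEigenspace]
        refine ⟨k, ?_⟩
        simpa [Algebra.algebraMap_eq_smul_one] using hx
      · refine ih q.natDegree ?_ hq0 (hs.of_dvd hp ⟨(X - C a) ^ k, by rw [mul_comm]; exact hpq⟩) hy rfl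
        rw [← hn, hpq, natDegree_mul (pow_ne_zero _ (X_sub_C_ne_zero a)) hq0, natDegree_pow,
          natDegree_X_sub_C]
        omega

end Eigenspaces

/-! ### Generalized weight spaces, `E`-split and algebraic modules. -/

section Weights

attribute [local instance] LieRing.ofAssociativeRing

variable {F : Type*} [Field F] {E : Type*} [Field E] [Algebra F E]
variable {g : Type*} [LieRing g] [LieAlgebra F g]

variable (t : LieSubalgebra F g) {M : Type*} [AddCommGroup M] [Module E M]
  [Module (UgE F E g) M] [IsScalarTower E (UgE F E g) M]

/-- The action of `t_E` on a `U(g_E)`-module. -/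
@[reducible] def baseChangeLieRingModule : LieRingModule (E ⊗[F] t) M where
  bracket h m := UniversalEnvelopingAlgebra.ι E (baseChangeIncl E t h) • m
  add_lie h h' m := by
    change UniversalEnvelopingAlgebra.ι E (baseChangeIncl E t (h + h')) • m = _
    rw [map_add, map_add, add_smul]
  lie_add h m m' := smul_add _ m m'
  leibniz_lie h h' m := by
    change _ • _ • m = UniversalEnvelopingAlgebra.ι E (baseChangeIncl E t ⁅h, h'⁆) • m + _ • _ • m
    rw [LieHom.map_lie, LieHom.map_lie, LieRing.of_associative_ring_bracket, sub_smul, mul_smul,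
      mul_smul, sub_add_cancel]

attribute [local instance] baseChangeLieRingModule

lemma baseChange_lie_def (h : E ⊗[F] t) (m : M) :
    ⁅h, m⁆ = UniversalEnvelopingAlgebra.ι E (baseChangeIncl E t h) • m := rfl

lemma baseChangeLieModule : LieModule E (E ⊗[F] t) M where
  smul_lie c h m := by
    rw [baseChange_lie_def, baseChange_lie_def, map_smul, map_smul, smul_assoc]
  lie_smul c h m := by
    rw [baseChange_lie_def, baseChange_lie_def]
    exact smul_gen_comm (F := F) c _ m

attribute [local instance] baseChangeLieModule

lemma sub_algebraMap_pow_smul (h : E ⊗[F] t) (c : E) (k : ℕ) (m : M) :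
    (UniversalEnvelopingAlgebra.ι E (baseChangeIncl E t h) - algebraMap E (UgE F E g) c) ^ k • m =
      ((LieModule.toEnd E (E ⊗[F] t) M h - c • 1) ^ k) m := by
  induction k generalizing m with
  | zero => simp
  | succ k ih =>
    rw [pow_succ, pow_succ, mul_smul, Module.End.mul_apply, ← ih]
    congr 1
    rw [sub_smul, algebraMap_smul]
    rfl

/-- Only an inclusion: on the left one exponent serves all `h`, on the right it may depend on `h`.
This is enough to transport independence. -/
lemma genWeightSpace_le_genWeightSpace [IsLieAbelian t] (μ : t →ₗ[F] E) :
    genWeightSpace E t M μ ≤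
      (LieModule.genWeightSpace M (μ.liftBaseChange E : E ⊗[F] t → E)).toSubmodule := by
  intro m hm
  obtain ⟨i, -, hi⟩ := (mem_genWeightSpace_iff E t μ m).mp hm
  rw [mem_weightSpace_iff] at hi
  rw [LieSubmodule.mem_toSubmodule, LieModule.mem_genWeightSpace]
  intro h
  refine ⟨i, ?_⟩
  rw [← sub_algebraMap_pow_smul]
  exact hi h

lemma iSupIndep_genWeightSpace [IsLieAbelian t] : iSupIndep (genWeightSpace E t M) := by
  have h := LieSubmodule.iSupIndep_toSubmodule.mpr
    (LieModule.iSupIndep_genWeightSpace E (E ⊗[F] t) M)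
  refine (h.comp (f := fun μ : t →ₗ[F] E => (μ.liftBaseChange E : E ⊗[F] t → E)) ?_).mono
    fun μ => genWeightSpace_le_genWeightSpace t μ
  intro μ ν hμν
  ext x
  simpa using congrFun hμν (1 ⊗ₜ x)

variable {t} in
lemma mem_weightSpace_one_iff {μ : t →ₗ[F] E} {m : M} :
    m ∈ weightSpace E t M μ 1 ↔ ∀ h : t, gen (F := F) E (h : g) • m = μ h • m := by
  rw [mem_weightSpace_iff]
  constructor
  · intro H h
    have := H (1 ⊗ₜ h)
    rw [pow_one, sub_smul, algebraMap_smul, sub_eq_zero, LinearMap.liftBaseChange_tmul,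
      one_smul] at this
    exact this
  · intro H h
    rw [pow_one, sub_smul, algebraMap_smul, sub_eq_zero]
    induction h using TensorProduct.induction_on with
    | zero => simp
    | add x y hx hy => rw [map_add, map_add, add_smul, map_add, add_smul, hx, hy]
    | tmul c x =>
      rw [baseChangeIncl_tmul, ι_tmul, smul_assoc, H, LinearMap.liftBaseChange_tmul, smul_smul,
        smul_eq_mul]

lemma weightSpace_one_le (μ : t →ₗ[F] E) : weightSpace E t M μ 1 ≤ genWeightSpace E t M μ :=
  le_iSup (fun i => weightSpace E t M μ (i + 1)) 0

lemma iSupIndep_weightSpace_one [IsLieAbelian t] :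
    iSupIndep fun μ => weightSpace E t M μ 1 :=
  (iSupIndep_genWeightSpace t).mono (weightSpace_one_le t)

open scoped Classical in
lemma isESplit_iff [IsLieAbelian t] :
    IsESplit E t M ↔ ⨆ μ, genWeightSpace E t M μ = ⊤ := by
  rw [IsESplit, DirectSum.isInternal_submodule_iff_iSupIndep_and_iSup_eq_top]
  exact and_iff_right (iSupIndep_genWeightSpace t)

open scoped Classical in
lemma isDiagonalizable_iff [IsLieAbelian t] :
    IsDiagonalizable E t M ↔ ⨆ μ, weightSpace E t M μ 1 = ⊤ := by
  rw [IsDiagonalizable, DirectSum.isInternal_submodule_iff_iSupIndep_and_iSup_eq_top]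
  exact and_iff_right (iSupIndep_weightSpace_one t)

lemma IsDiagonalizable.isESplit [IsLieAbelian t] (h : IsDiagonalizable E t M) :
    IsESplit E t M := by
  rw [isDiagonalizable_iff] at h
  rw [isESplit_iff, eq_top_iff, ← h]
  exact iSup_mono (weightSpace_one_le t)

variable {t} in
open scoped Classical in
lemma isAlgebraicModule_iff [IsLieAbelian t] (X : AddSubgroup (Module.Dual F t)) :
    IsAlgebraicModule E t M X ↔ ⨆ μ : algWeights E X, genWeightSpace E t M μ.1 = ⊤ := by
  rw [IsAlgebraicModule, DirectSum.isInternal_submodule_iff_iSupIndep_and_iSup_eq_top, isESplit_iff]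
  refine ⟨fun h => h.2.2, fun h => ⟨?_, (iSupIndep_genWeightSpace t).comp
    Subtype.val_injective, h⟩⟩
  rw [eq_top_iff, ← h]
  exact iSup_le fun μ => le_iSup (genWeightSpace E t M) μ.1

variable {t} in
-- In this form, as vanishing of the other weight spaces, the condition passes to submodules and
-- extensions element by element.
lemma isAlgebraicModule_iff_genWeightSpace_eq_bot [IsLieAbelian t]
    (X : AddSubgroup (Module.Dual F t)) :
    IsAlgebraicModule E t M X ↔
      IsESplit E t M ∧ ∀ μ ∉ algWeights E X, genWeightSpace E t M μ = ⊥ := by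
  constructor
  · refine fun h => ⟨h.1, fun μ hμ => ?_⟩
    rw [isAlgebraicModule_iff] at h
    have := iSupIndep_genWeightSpace (E := E) (M := M) t μ
    rw [show ⨆ ν, ⨆ (_ : ν ≠ μ), genWeightSpace E t M ν = ⊤ from ?_, disjoint_top] at this
    · exact this
    · rw [eq_top_iff, ← h]
      exact iSup_le fun ν => le_iSup₂_of_le ν.1 (fun h => hμ (h ▸ ν.2)) le_rfl
  · rintro ⟨h, h'⟩
    rw [isESplit_iff] at h
    rw [isAlgebraicModule_iff, eq_top_iff, ← h]
    refine iSup_le fun μ => ?_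
    by_cases hμ : μ ∈ algWeights E X
    · exact le_iSup (fun ν : algWeights E X => genWeightSpace E t M ν.1) ⟨μ, hμ⟩
    · rw [h' μ hμ]; exact bot_le

section Split

open Polynomial

variable (M) in
/-- Every element of `M` is annihilated by a split polynomial in each element of `t_E`. -/
def IsLocallySplit (E : Type*) [Field E] [Algebra F E] [Module E M]
    [Module (UgE F E g) M] [IsScalarTower E (UgE F E g) M] : Prop :=
  ∀ (h : E ⊗[F] t) (m : M), ∃ p : E[X], p ≠ 0 ∧ p.Splits ∧
    aeval (UniversalEnvelopingAlgebra.ι E (baseChangeIncl E t h)) p • m = 0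

variable {t} in
lemma IsESplit.isLocallySplit [IsLieAbelian t] (hM : IsESplit E t M) :
    IsLocallySplit t M E := by
  intro h m
  rw [isESplit_iff] at hM
  have hm : m ∈ ⨆ μ, genWeightSpace E t M μ := by rw [hM]; trivial
  induction hm using Submodule.iSup_induction' with
  | mem μ x hx =>
    obtain ⟨i, -, hi⟩ := (mem_genWeightSpace_iff E t μ x).mp hx
    refine ⟨(X - C (μ.liftBaseChange E h)) ^ i, pow_ne_zero _ (X_sub_C_ne_zero _),
      (Splits.X_sub_C _).pow _, ?_⟩
    have := (mem_weightSpace_iff E t μ i x).mp hi h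
    simpa using this
  | zero => exact ⟨1, one_ne_zero, Splits.one, by simp⟩
  | add x y _ _ hx hy =>
    obtain ⟨p, hp, hps, hpx⟩ := hx
    obtain ⟨q, hq, hqs, hqy⟩ := hy
    refine ⟨p * q, mul_ne_zero hp hq, hps.mul hqs, ?_⟩
    rw [smul_add, map_mul, mul_smul _ _ y, hqy, smul_zero, add_zero, ← map_mul, mul_comm, map_mul,
      mul_smul, hpx, smul_zero]

/-- A stable subspace as a submodule over `t_E`. -/
def IsStableUnder.lieSubmodule {V : Submodule E M} (hV : IsStableUnder t V) :
    LieSubmodule E (E ⊗[F] t) M :=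
  { V with lie_mem := fun {h _} hm => hV.ι_smul_mem h hm }

variable {t} in
lemma IsLocallySplit.isTriangularizable (hM : IsLocallySplit t M E)
    {V : Submodule E M} (hV : IsStableUnder t V) :
    LieModule.IsTriangularizable E (E ⊗[F] t) hV.lieSubmodule := by
  refine ⟨fun h => ?_⟩
  rw [eq_top_iff]
  rintro m -
  obtain ⟨p, hp, hps, hpm⟩ := hM h (m : M)
  refine mem_iSup_maxGenEigenspace_of_aeval_eq_zero _ hp hps (m := m) (Subtype.ext ?_)
  rw [← show _ = ((0 : hV.lieSubmodule) : M) from hpm]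
  clear hpm hp hps
  induction p using Polynomial.induction_on' with
  | add p q hp hq =>
    rw [map_add, map_add, LinearMap.add_apply, add_smul, ← hp, ← hq]; rfl
  | monomial n a =>
    rw [aeval_monomial, aeval_monomial, Module.End.mul_apply, Module.algebraMap_end_apply, mul_smul,
      algebraMap_smul]
    change a • _ = _
    congr 1
    induction n with
    | zero => simp
    | succ n ih => rw [pow_succ', pow_succ', mul_smul, ← ih]; rfl

/-- In characteristic zero a weight of a finite-dimensional module is a linear functional, hence
determined by its values on `1 ⊗ h`. -/
lemma LieModule.Weight.exists_liftBaseChange [CharZero E] [IsLieAbelian t] {V : Type*}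
    [AddCommGroup V] [Module E V] [LieRingModule (E ⊗[F] t) V] [LieModule E (E ⊗[F] t) V]
    [FiniteDimensional E V] (χ : LieModule.Weight E (E ⊗[F] t) V) :
    ∃ μ : t →ₗ[F] E, ∀ h, μ.liftBaseChange E h = χ h := by
  refine ⟨(χ.toLinear.restrictScalars F) ∘ₗ (TensorProduct.mk F E t 1), fun h => ?_⟩
  rw [← LieModule.Weight.toLinear_apply]
  congr 1
  ext
  simp

variable {t} in
-- Local finiteness places each element in a finite-dimensional `t`-stable subspace, where the
-- commuting triangularizable operators have a joint generalized eigenspace decomposition.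
lemma IsLocallySplit.isESplit [CharZero E] [IsLieAbelian t] (hM : IsLocallySplit t M E)
    {b : LieSubalgebra F g} (htb : t ≤ b) (hb : IsLocallyFinite E M b) : IsESplit E t M := by
  rw [isESplit_iff, eq_top_iff]
  rintro m -
  rw [isLocallyFinite_iff] at hb
  obtain ⟨V, hVf, hm, hVb⟩ := hb m
  have hV : IsStableUnder t V := fun x hx => hVb x (htb hx)
  have : FiniteDimensional E hV.lieSubmodule := hVf
  have := hM.isTriangularizable hV
  have htop := LieModule.iSup_genWeightSpace_eq_top' E (E ⊗[F] t) hV.lieSubmodule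
  rw [← LieSubmodule.toSubmodule_inj, LieSubmodule.iSup_toSubmodule,
    LieSubmodule.top_toSubmodule] at htop
  have hm' : (⟨m, hm⟩ : hV.lieSubmodule) ∈ (⊤ : Submodule E hV.lieSubmodule) := trivial
  rw [← htop] at hm'
  have key : ∀ x : hV.lieSubmodule,
      x ∈ ⨆ χ : LieModule.Weight E (E ⊗[F] t) hV.lieSubmodule,
        (LieModule.genWeightSpace hV.lieSubmodule χ).toSubmodule →
      (x : M) ∈ ⨆ μ, genWeightSpace E t M μ := by
    intro x hx
    induction hx using Submodule.iSup_induction' with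
    | zero => exact Submodule.zero_mem _
    | add x y _ _ hx hy => exact Submodule.add_mem _ hx hy
    | mem χ x hx =>
      obtain ⟨μ, hμ⟩ := LieModule.Weight.exists_liftBaseChange t χ
      -- The dimension of the subspace is an exponent valid for all `h` at once; one is added only
      -- to have an exponent at least `1`.
      refine Submodule.mem_iSup_of_mem μ ((mem_genWeightSpace_iff E t μ _).mpr
        ⟨Module.finrank E hV.lieSubmodule + 1, by omega,
          weightSpace_mono E t M μ (Nat.le_succ _) ((mem_weightSpace_iff E t μ _ _).mpr fun h => ?_)⟩)
      rw [LieSubmodule.mem_toSubmodule, LieModule.mem_genWeightSpace] at hx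
      have hx' := (Module.End.mem_maxGenEigenspace _ _ _).mpr (hx h)
      rw [Module.End.maxGenEigenspace_eq_genEigenspace_finrank,
        Module.End.mem_genEigenspace_nat, LinearMap.mem_ker] at hx'
      rw [sub_algebraMap_pow_smul, hμ]
      have := congrArg Subtype.val hx'
      refine Eq.trans ?_ this
      generalize Module.finrank E hV.lieSubmodule = n
      clear hx' this hx
      induction n with
      | zero => rfl
      | succ n ih => rw [pow_succ', pow_succ', Module.End.mul_apply, ih]; rfl
  exact key _ hm'

variable {M' : Type*} [AddCommGroup M'] [Module E M']
  [Module (UgE F E g) M'] [IsScalarTower E (UgE F E g) M']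
variable {M'' : Type*} [AddCommGroup M''] [Module E M'']
  [Module (UgE F E g) M''] [IsScalarTower E (UgE F E g) M'']

variable {t}

lemma IsLocallySplit.of_injective (h : IsLocallySplit t M' E) (f : M →ₗ[UgE F E g] M')
    (hf : Function.Injective f) : IsLocallySplit t M E := by
  intro x m
  obtain ⟨p, hp, hps, hpm⟩ := h x (f m)
  exact ⟨p, hp, hps, hf (by rw [map_smul, hpm, map_zero])⟩

lemma IsLocallySplit.of_exact (h : IsLocallySplit t M E) (h'' : IsLocallySplit t M'' E)
    (f : M →ₗ[UgE F E g] M') (p : M' →ₗ[UgE F E g] M'') (hfp : Function.Exact f p) :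
    IsLocallySplit t M' E := by
  intro x m
  obtain ⟨q, hq, hqs, hqm⟩ := h'' x (p m)
  rw [← map_smul] at hqm
  obtain ⟨n, hn⟩ := (hfp _).mp hqm
  obtain ⟨r, hr, hrs, hrm⟩ := h x n
  refine ⟨r * q, mul_ne_zero hr hq, hrs.mul hqs, ?_⟩
  rw [map_mul, mul_smul, ← hn, ← map_smul, hrm, map_zero]

lemma map_mem_weightSpace (f : M →ₗ[UgE F E g] M') {μ : t →ₗ[F] E} {i : ℕ} {m : M}
    (hm : m ∈ weightSpace E t M μ i) : f m ∈ weightSpace E t M' μ i := by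
  rw [mem_weightSpace_iff] at hm ⊢
  intro h
  rw [← map_smul, hm, map_zero]

lemma map_mem_genWeightSpace (f : M →ₗ[UgE F E g] M') {μ : t →ₗ[F] E} {m : M}
    (hm : m ∈ genWeightSpace E t M μ) : f m ∈ genWeightSpace E t M' μ := by
  rw [mem_genWeightSpace_iff] at hm ⊢
  obtain ⟨i, hi, hm⟩ := hm
  exact ⟨i, hi, map_mem_weightSpace f hm⟩

lemma mem_genWeightSpace_of_injective (f : M →ₗ[UgE F E g] M') (hf : Function.Injective f)
    {μ : t →ₗ[F] E} {m : M} (hm : f m ∈ genWeightSpace E t M' μ) :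
    m ∈ genWeightSpace E t M μ := by
  rw [mem_genWeightSpace_iff] at hm ⊢
  obtain ⟨i, hi, hm⟩ := hm
  refine ⟨i, hi, ?_⟩
  rw [mem_weightSpace_iff] at hm ⊢
  intro h
  exact hf (by rw [map_smul, hm, map_zero])

lemma iSup_eq_top_of_surjective {ι : Type*} (f : M →ₗ[UgE F E g] M')
    (hf : Function.Surjective f) {V : ι → Submodule E M} {V' : ι → Submodule E M'}
    (hV : ∀ i, ∀ m ∈ V i, f m ∈ V' i) (h : ⨆ i, V i = ⊤) : ⨆ i, V' i = ⊤ := by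
  rw [eq_top_iff]
  rintro m -
  obtain ⟨m, rfl⟩ := hf m
  have hm : m ∈ ⨆ i, V i := by rw [h]; trivial
  induction hm using Submodule.iSup_induction' with
  | mem i x hx => exact Submodule.mem_iSup_of_mem i (hV i x hx)
  | zero => rw [map_zero]; exact Submodule.zero_mem _
  | add x y _ _ hx hy => rw [map_add]; exact Submodule.add_mem _ hx hy

variable [IsLieAbelian t]

lemma IsESplit.of_surjective (h : IsESplit E t M) (f : M →ₗ[UgE F E g] M')
    (hf : Function.Surjective f) : IsESplit E t M' := by
  rw [isESplit_iff] at h ⊢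
  exact iSup_eq_top_of_surjective f hf (fun _ _ => map_mem_genWeightSpace f) h

variable {X : AddSubgroup (Module.Dual F t)}

lemma IsAlgebraicModule.of_surjective (h : IsAlgebraicModule E t M X) (f : M →ₗ[UgE F E g] M')
    (hf : Function.Surjective f) : IsAlgebraicModule E t M' X := by
  rw [isAlgebraicModule_iff] at h ⊢
  exact iSup_eq_top_of_surjective f hf (fun _ _ => map_mem_genWeightSpace f) h

lemma IsAlgebraicModule.of_injective (h : IsAlgebraicModule E t M' X) (f : M →ₗ[UgE F E g] M')
    (hf : Function.Injective f) (hM : IsESplit E t M) : IsAlgebraicModule E t M X := by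
  rw [isAlgebraicModule_iff_genWeightSpace_eq_bot] at h ⊢
  refine ⟨hM, fun μ hμ => (Submodule.eq_bot_iff _).mpr fun m hm => hf ?_⟩
  have := map_mem_genWeightSpace f hm
  rwa [h.2 μ hμ, Submodule.mem_bot, ← map_zero f] at this

lemma IsAlgebraicModule.of_exact (h : IsAlgebraicModule E t M X)
    (h'' : IsAlgebraicModule E t M'' X) (f : M →ₗ[UgE F E g] M') (p : M' →ₗ[UgE F E g] M'')
    (hf : Function.Injective f) (hfp : Function.Exact f p) (hM : IsESplit E t M') :
    IsAlgebraicModule E t M' X := by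
  rw [isAlgebraicModule_iff_genWeightSpace_eq_bot] at h h'' ⊢
  refine ⟨hM, fun μ hμ => (Submodule.eq_bot_iff _).mpr fun m hm => ?_⟩
  have := map_mem_genWeightSpace p hm
  rw [h''.2 μ hμ, Submodule.mem_bot] at this
  obtain ⟨n, rfl⟩ := (hfp m).mp this
  have := mem_genWeightSpace_of_injective f hf hm
  rw [h.2 μ hμ, Submodule.mem_bot] at this
  rw [this, map_zero]

end Split

end Weights

/-! ### Existence of highest weight vectors. -/

section HighestWeight

attribute [local instance] LieRing.ofAssociativeRing baseChangeLieRingModule baseChangeLieModule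

variable {F : Type*} [Field F] {E : Type*} [Field E] [Algebra F E]
variable {g : Type*} [LieRing g] [LieAlgebra F g] {b t : LieSubalgebra F g}
variable {M : Type*} [AddCommGroup M] [Module E M]
  [Module (UgE F E g) M] [IsScalarTower E (UgE F E g) M]
variable {ι Γ : Type*} [Fintype ι] [Fintype Γ]

lemma gen_smul_smul (c : F) (x : g) (m : M) :
    gen (F := F) E (c • x) • m = algebraMap F E c • gen (F := F) E x • m := by
  rw [gen_smul, smul_assoc]

namespace TriangularData

variable (D : TriangularData b t ι Γ)

lemma isLieAbelian (D : TriangularData b t ι Γ) : IsLieAbelian t :=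
  ⟨fun h h' => Subtype.ext (D.lie_t h h')⟩

lemma le_borel (D : TriangularData b t ι Γ) : t ≤ b := by
  intro x hx
  have : x ∈ t.toSubmodule ⊔ Submodule.span F (Set.range D.e) := Submodule.mem_sup_left hx
  rwa [D.sup_e] at this

lemma e_mem_borel (i : ι) : D.e i ∈ b := by
  have : D.e i ∈ t.toSubmodule ⊔ Submodule.span F (Set.range D.e) :=
    Submodule.mem_sup_right (Submodule.subset_span ⟨i, rfl⟩)
  rwa [D.sup_e] at this

variable (E) in
/-- A root as a weight with values in `E`. -/
def rootE (i : ι) : t →ₗ[F] E := Algebra.linearMap F E ∘ₗ D.root i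

lemma rootE_apply (i : ι) (h : t) : D.rootE E i h = algebraMap F E (D.root i h) := rfl

lemma gen_e_smul_mem {μ : t →ₗ[F] E} {m : M} (hm : m ∈ weightSpace E t M μ 1) (i : ι) :
    gen (F := F) E (D.e i) • m ∈ weightSpace E t M (μ + D.rootE E i) 1 := by
  rw [mem_weightSpace_one_iff] at hm ⊢
  intro h
  have := gen_lie_smul (F := F) (E := E) (h : g) (D.e i) m
  rw [D.lie_e, gen_smul_smul, hm, smul_gen_comm, eq_sub_iff_add_eq] at this
  rw [← this, LinearMap.add_apply, add_smul, add_comm, rootE_apply]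

lemma gen_f_smul_mem {μ : t →ₗ[F] E} {m : M} (hm : m ∈ weightSpace E t M μ 1) (i : ι) :
    gen (F := F) E (D.f i) • m ∈ weightSpace E t M (μ - D.rootE E i) 1 := by
  rw [mem_weightSpace_one_iff] at hm ⊢
  intro h
  have := gen_lie_smul (F := F) (E := E) (h : g) (D.f i) m
  rw [D.lie_f, ← neg_smul, gen_smul_smul, hm, smul_gen_comm, eq_sub_iff_add_eq] at this
  rw [← this, LinearMap.sub_apply, sub_smul, map_neg, neg_smul, rootE_apply, add_comm,
    sub_eq_add_neg]

lemma gen_t_smul_mem {μ : t →ₗ[F] E} {m : M} (hm : m ∈ weightSpace E t M μ 1) (h : t) :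
    gen (F := F) E (h : g) • m ∈ weightSpace E t M μ 1 := by
  rw [mem_weightSpace_one_iff.mp hm h]
  exact Submodule.smul_mem _ _ hm

lemma eq_zero_of_sum_smul_rootE_eq_zero {n : ι → ℕ} (hn : ∑ i, n i • D.rootE E i = 0) : n = 0 := by
  refine D.indep n fun γ => ?_
  apply (algebraMap F E).injective
  have := LinearMap.congr_fun hn (D.u γ)
  simpa [rootE_apply, LinearMap.sum_apply] using this

lemma gen_induction {p : g → Prop} (ht : ∀ h : t, p h) (he : ∀ i, p (D.e i)) (hf : ∀ i, p (D.f i))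
    (hadd : ∀ x y, p x → p y → p (x + y)) (hsmul : ∀ (c : F) x, p x → p (c • x)) (x : g) : p x := by
  have h0 : p 0 := by simpa using ht 0
  let P : Submodule F g :=
    { carrier := {x | p x}, add_mem' := fun {x y} hx hy => hadd x y hx hy, zero_mem' := h0,
      smul_mem' := fun c x hx => hsmul c x hx }
  have : (⊤ : Submodule F g) ≤ P := by
    rw [← D.sup_f, ← D.sup_e]
    refine sup_le (sup_le (fun h hh => ht ⟨h, hh⟩) (Submodule.span_le.mpr ?_))
      (Submodule.span_le.mpr ?_)
    · rintro _ ⟨i, rfl⟩; exact he i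
    · rintro _ ⟨i, rfl⟩; exact hf i
  exact this trivial

lemma gen_smul_mem_of_generators {V : Submodule E M}
    {m : M} (ht : ∀ h : t, gen (F := F) E (h : g) • m ∈ V)
    (he : ∀ i, gen (F := F) E (D.e i) • m ∈ V) (hf : ∀ i, gen (F := F) E (D.f i) • m ∈ V) (x : g) :
    gen (F := F) E x • m ∈ V := by
  refine D.gen_induction (p := fun x => gen (F := F) E x • m ∈ V) ht he hf ?_ ?_ x
  · intro x y hx hy
    rw [gen_add, add_smul]
    exact V.add_mem hx hy
  · intro c x hx
    rw [gen_smul_smul]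
    exact V.smul_mem _ hx

end TriangularData

lemma finite_setOf_weightSpace_ne_bot [IsLieAbelian t] (V : Submodule E M)
    [FiniteDimensional E V] :
    {μ : t →ₗ[F] E | ∃ v ∈ V, v ≠ 0 ∧ v ∈ weightSpace E t M μ 1}.Finite := by
  set S := {μ : t →ₗ[F] E | ∃ v ∈ V, v ≠ 0 ∧ v ∈ weightSpace E t M μ 1}
  have hS : ∀ μ : S, ∃ v ∈ V, v ≠ 0 ∧ v ∈ weightSpace E t M μ.1 1 := fun μ => μ.2
  choose v hv hv0 hw using hS
  have hli : LinearIndependent E v :=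
    ((iSupIndep_weightSpace_one (E := E) (M := M) t).comp
      (Subtype.val_injective (p := fun μ => μ ∈ S))).linearIndependent _ hw hv0
  have hli' : LinearIndependent E (fun μ : S => (⟨v μ, hv μ⟩ : V)) :=
    LinearIndependent.of_comp V.subtype hli
  have : Finite S := hli'.finite
  exact S.toFinite

lemma IsLocallySplit.exists_weightVector [CharZero E] [IsLieAbelian t]
    (hM : IsLocallySplit t M E) {V : Submodule E M} [FiniteDimensional E V]
    (hV : IsStableUnder t V) (hV0 : V ≠ ⊥) :
    ∃ μ : t →ₗ[F] E, ∃ v ∈ V, v ≠ 0 ∧ v ∈ weightSpace E t M μ 1 := by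
  have : FiniteDimensional E hV.lieSubmodule := ‹FiniteDimensional E V›
  have := hM.isTriangularizable hV
  have : Nontrivial hV.lieSubmodule := Submodule.nontrivial_iff_ne_bot.mpr hV0
  have htop := LieModule.iSup_genWeightSpace_eq_top' E (E ⊗[F] t) hV.lieSubmodule
  have : Nonempty (LieModule.Weight E (E ⊗[F] t) hV.lieSubmodule) := by
    by_contra h
    rw [not_nonempty_iff] at h
    rw [iSup_of_empty] at htop
    exact bot_ne_top htop
  obtain ⟨χ⟩ := this
  obtain ⟨v, hv, hχ⟩ := LieModule.exists_forall_lie_eq_smul E (E ⊗[F] t) hV.lieSubmodule χ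
  obtain ⟨μ, hμ⟩ := LieModule.Weight.exists_liftBaseChange t χ
  refine ⟨μ, v, v.2, fun h => hv (Subtype.ext h), mem_weightSpace_one_iff.mpr fun h => ?_⟩
  have := congrArg Subtype.val (hχ (1 ⊗ₜ h))
  rw [← hμ, LinearMap.liftBaseChange_tmul, one_smul] at this
  exact this

/-- A highest weight vector of weight `μ`. -/
structure IsHighestWeightVector (D : TriangularData b t ι Γ) (μ : t →ₗ[F] E) (v : M) : Prop where
  mem_weightSpace : v ∈ weightSpace E t M μ 1
  e_smul : ∀ i, gen (F := F) E (D.e i) • v = 0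

theorem IsLocallySplit.exists_isHighestWeightVector [CharZero E] (D : TriangularData b t ι Γ)
    (hM : IsLocallySplit t M E) {V : Submodule E M} [FiniteDimensional E V]
    (hV : IsStableUnder b V) (hV0 : V ≠ ⊥) :
    ∃ (μ : t →ₗ[F] E) (v : M), v ∈ V ∧ v ≠ 0 ∧ IsHighestWeightVector D μ v := by
  have := D.isLieAbelian
  set S := {μ : t →ₗ[F] E | ∃ v ∈ V, v ≠ 0 ∧ v ∈ weightSpace E t M μ 1} with hS
  have hfin : S.Finite := finite_setOf_weightSpace_ne_bot V
  obtain ⟨μ₀, hμ₀⟩ : S.Nonempty := hM.exists_weightVector (fun x hx => hV x (D.le_borel hx)) hV0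
  have := hfin.to_subtype
  -- Here `r μ ν` says that `μ` lies strictly above `ν`, so an `r`-minimal weight is a highest one.
  -- Independence of the roots over `ℕ` makes `r` irreflexive, and `S` is finite. A nonzero `e i`
  -- image would have a weight above `μ` in `S`.
  let r : S → S → Prop := fun μ ν => ∃ n : ι → ℕ, n ≠ 0 ∧ μ.1 = ν.1 + ∑ i, n i • D.rootE E i
  have : IsTrans S r := ⟨by
    rintro κ μ ν ⟨m, hm, h⟩ ⟨n, hn, h'⟩
    refine ⟨m + n, fun h0 => hm ?_, ?_⟩
    · funext i
      have := congrFun h0 i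
      simp only [Pi.add_apply, Pi.zero_apply, Nat.add_eq_zero_iff] at this
      exact this.1
    · rw [h, h', add_assoc, ← Finset.sum_add_distrib]
      simp [add_smul, add_comm]⟩
  have : Std.Irrefl r := ⟨by
    rintro μ ⟨n, hn, h⟩
    exact hn (D.eq_zero_of_sum_smul_rootE_eq_zero (by simpa using h))⟩
  have hwf : WellFounded r := Finite.wellFounded_of_trans_of_irrefl r
  obtain ⟨⟨μ, v, hv, hv0, hvμ⟩, -, hmin⟩ := hwf.has_min Set.univ ⟨⟨μ₀, hμ₀⟩, trivial⟩
  refine ⟨μ, v, hv, hv0, hvμ, fun i => ?_⟩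
  by_contra hne
  classical
  refine hmin ⟨μ + D.rootE E i, _, hV _ (D.e_mem_borel i) v hv, hne, D.gen_e_smul_mem hvμ i⟩ trivial
    ⟨Pi.single i 1, ?_, ?_⟩
  · simp
  · simp [Pi.single_apply, Finset.sum_ite_eq']

end HighestWeight

/-! ### The Casimir element and the words in the lowering operators. -/

section Casimir

attribute [local instance] LieRing.ofAssociativeRing

variable {F : Type*} [Field F] {E : Type*} [Field E] [Algebra F E]
variable {g : Type*} [LieRing g] [LieAlgebra F g] {b t : LieSubalgebra F g}
variable {M : Type*} [AddCommGroup M] [Module E M]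
  [Module (UgE F E g) M] [IsScalarTower E (UgE F E g) M]
variable {ι Γ : Type*} [Fintype ι] [Fintype Γ]

variable (F E g) in
/-- `x ↦ gen x` as an additive map. -/
def genAddHom : g →+ UgE F E g := AddMonoidHom.mk' (gen (F := F) E) (gen_add E)

variable (F E g) in
/-- The map `g ⊗ g → U(g_E)`, `x ⊗ y ↦ x y`. -/
def tensorMul : g ⊗[F] g →+ UgE F E g :=
  TensorProduct.liftAddHom ((AddMonoidHom.mul.comp (genAddHom F E g)).compl₂ (genAddHom F E g))
    fun c x y => by
      change gen (F := F) E (c • x) * gen (F := F) E y = gen (F := F) E x * gen (F := F) E (c • y)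
      rw [gen_smul, gen_smul, smul_mul_assoc, mul_smul_comm]

lemma tensorMul_tmul (x y : g) :
    tensorMul F E g (x ⊗ₜ y) = gen (F := F) E x * gen (F := F) E y := rfl

lemma tensorMul_lie (x : g) (z : g ⊗[F] g) :
    tensorMul F E g ⁅x, z⁆ = gen (F := F) E x * tensorMul F E g z
      - tensorMul F E g z * gen (F := F) E x := by
  induction z using TensorProduct.induction_on with
  | zero => simp
  | add z w hz hw => rw [lie_add, map_add, hz, hw, map_add, mul_add, add_mul]; abel
  | tmul a c =>
    rw [TensorProduct.LieModule.lie_tmul_right, map_add, tensorMul_tmul, tensorMul_tmul,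
      tensorMul_tmul, gen_lie, gen_lie]
    noncomm_ring

namespace TriangularData

variable (D : TriangularData b t ι Γ)

variable (E) in
/-- The Casimir element of `U(g_E)`. -/
def casimirElement : UgE F E g :=
  tensorMul F E g (∑ γ, (D.u γ : g) ⊗ₜ[F] (D.u γ : g) +
    ∑ i, (D.e i ⊗ₜ[F] D.f i + D.f i ⊗ₜ[F] D.e i))

lemma commute_casimirElement (a : UgE F E g) : Commute (D.casimirElement E) a := by
  have ha : a ∈ Algebra.adjoin E (Set.range (gen (F := F) (g := g) E)) := by
    rw [adjoin_range_gen]; trivial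
  induction ha using Algebra.adjoin_induction with
  | mem _ h =>
    obtain ⟨x, rfl⟩ := h
    have := tensorMul_lie (E := E) x (∑ γ, (D.u γ : g) ⊗ₜ[F] (D.u γ : g) +
      ∑ i, (D.e i ⊗ₜ[F] D.f i + D.f i ⊗ₜ[F] D.e i))
    rw [D.casimir, map_zero] at this
    exact (sub_eq_zero.mp this.symm).symm
  | algebraMap c => exact Algebra.commute_algebraMap_right c _
  | add a b _ _ ha hb => exact ha.add_right hb
  | mul a b _ _ ha hb => exact ha.mul_right hb

/-- The scalar by which the Casimir element acts on a highest weight vector of weight `μ`. -/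
def casimirScalar (μ : t →ₗ[F] E) : E := ∑ γ, μ (D.u γ) ^ 2 + ∑ i, μ (D.u (D.r i))

variable {D}

/-- On a highest weight vector `f i * e i` acts by zero, and `e i * f i` acts as `⁅e i, f i⁆ = u (r
i)`. -/
lemma _root_.ThickCategoryO.IsHighestWeightVector.casimirElement_smul {μ : t →ₗ[F] E} {v : M}
    (hv : IsHighestWeightVector D μ v) :
    D.casimirElement E • v = D.casimirScalar μ • v := by
  have hw := mem_weightSpace_one_iff.mp hv.mem_weightSpace
  rw [casimirElement, casimirScalar, map_add, map_sum, map_sum, add_smul, Finset.sum_smul,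
    Finset.sum_smul, add_smul, Finset.sum_smul, Finset.sum_smul]
  congr 1
  · refine Finset.sum_congr rfl fun γ _ => ?_
    rw [tensorMul_tmul, mul_smul, hw, smul_gen_comm, hw, smul_smul, sq]
  · refine Finset.sum_congr rfl fun i _ => ?_
    rw [map_add, tensorMul_tmul, tensorMul_tmul, add_smul, mul_smul, mul_smul, hv.e_smul, smul_zero,
      add_zero, ← hw, ← D.lie_e_f, gen_lie_smul, hv.e_smul, smul_zero, sub_zero]

lemma _root_.ThickCategoryO.IsHighestWeightVector.casimirElement_smul_of_span {μ : t →ₗ[F] E}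
    {v : M} (hv : IsHighestWeightVector D μ v) (hspan : Submodule.span (UgE F E g) {v} = ⊤)
    (m : M) : D.casimirElement E • m = D.casimirScalar μ • m := by
  have hm : m ∈ Submodule.span (UgE F E g) {v} := by rw [hspan]; trivial
  obtain ⟨a, rfl⟩ := Submodule.mem_span_singleton.mp hm
  rw [smul_smul, (D.commute_casimirElement a).eq, mul_smul, hv.casimirElement_smul, smul_gen_comm]

variable (D)

/-- The weight `μ - ∑ nᵢ αᵢ`. -/
def lowerWeight (μ : t →ₗ[F] E) (n : ι → ℕ) : t →ₗ[F] E := μ - ∑ i, n i • D.rootE E i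

lemma finite_setOf_casimirScalar_lowerWeight_eq [CharZero F] [CharZero E] (μ : t →ₗ[F] E) :
    {n : ι → ℕ | D.casimirScalar (D.lowerWeight μ n) = D.casimirScalar μ}.Finite := by
  classical
  choose q hq using D.rational
  have hind : ∀ n : ι → ℕ, (∀ γ, ∑ i, (n i : ℚ) * q i γ = 0) → n = 0 := by
    refine fun n hn => D.indep n fun γ => ?_
    have := congrArg (Rat.cast : ℚ → F) (hn γ)
    push_cast at this
    simpa [hq, nsmul_eq_mul] using this
  -- With `B γ = ∑ nᵢ q i γ`, the weight `μ - ∑ nᵢ αᵢ` takes the value `μ (u γ) - B γ` on `u γ`. The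
  -- difference of the two Casimir scalars is then the sum of `B γ ^ 2 - c γ * B γ`, where `c γ` is
  -- `2 μ (u γ)` plus the number of `i` with `r i = γ`.
  refine (finite_setOf_sum_sq_add_eq_zero q hind fun γ =>
    2 * μ (D.u γ) + (Finset.univ.filter fun i => D.r i = γ).card).subset fun n hn => ?_
  have hval : ∀ γ, D.lowerWeight μ n (D.u γ) = μ (D.u γ) - (∑ i, n i * q i γ : ℚ) := by
    intro γ
    simp [lowerWeight, LinearMap.sum_apply, rootE_apply, hq]
  have hr : ∀ c : Γ → E, ∑ i, c (D.r i) =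
      ∑ γ, ((Finset.univ.filter fun i => D.r i = γ).card : E) * c γ := by
    intro c
    rw [← Finset.sum_fiberwise (s := Finset.univ) (g := D.r)]
    refine Finset.sum_congr rfl fun γ _ => ?_
    rw [Finset.sum_congr rfl fun i hi => by rw [(Finset.mem_filter.mp hi).2], Finset.sum_const,
      nsmul_eq_mul]
  rw [Set.mem_ofPred_eq, casimirScalar, casimirScalar, hr fun γ => D.lowerWeight μ n (D.u γ),
    hr fun γ => μ (D.u γ), ← Finset.sum_add_distrib, ← Finset.sum_add_distrib, ← sub_eq_zero,
    ← Finset.sum_sub_distrib] at hn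
  rw [Set.mem_ofPred_eq, ← hn]
  refine Finset.sum_congr rfl fun γ _ => ?_
  rw [hval]
  ring

/-- The action of a word in the lowering operators. -/
def word (v : M) (l : List ι) : M := l.foldr (fun i m => gen (F := F) E (D.f i) • m) v

open scoped Classical in
/-- The multiplicities of the letters of a word. -/
def content (l : List ι) : ι → ℕ := fun i => l.count i

variable {D}

lemma word_cons (v : M) (i : ι) (l : List ι) :
    D.word (E := E) v (i :: l) = gen (F := F) E (D.f i) • D.word (E := E) v l := rfl

lemma word_mem_weightSpace {μ : t →ₗ[F] E} {v : M} (hv : v ∈ weightSpace E t M μ 1)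
    (l : List ι) : D.word (E := E) v l ∈ weightSpace E t M (D.lowerWeight μ (content l)) 1 := by
  classical
  induction l with
  | nil => simpa [lowerWeight, content, word] using hv
  | cons i l ih =>
    rw [word_cons]
    convert D.gen_f_smul_mem ih i using 2
    simp only [lowerWeight, content, List.count_cons, add_smul, Finset.sum_add_distrib, sub_sub]
    simp [Finset.sum_ite_eq]

/-- Words may have their letters in any order. Stability is proved for all `x` in `g` simultaneously
by induction on the word: `e j f i w = ⁅e j, f i⁆ w + f i e j w`, where the bracket is again in `g`.
-/
lemma span_range_word {μ : t →ₗ[F] E} {v : M} (hv : IsHighestWeightVector D μ v)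
    (hspan : Submodule.span (UgE F E g) {v} = ⊤) :
    Submodule.span E (Set.range (D.word (E := E) v)) = ⊤ := by
  set U := Submodule.span E (Set.range (D.word (E := E) v)) with hU
  have hword : ∀ l, D.word (E := E) v l ∈ U := fun l => Submodule.subset_span ⟨l, rfl⟩
  have hf : ∀ i, ∀ m ∈ U, gen (F := F) E (D.f i) • m ∈ U := by
    intro i m hm
    induction hm using Submodule.span_induction with
    | mem _ h => obtain ⟨l, rfl⟩ := h; exact hword (i :: l)
    | zero => rw [smul_zero]; exact U.zero_mem
    | add x y _ _ hx hy => rw [smul_add]; exact U.add_mem hx hy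
    | smul c x _ hx => rw [smul_gen_comm]; exact U.smul_mem c hx
  have ht : ∀ (h : t) (l : List ι), gen (F := F) E (h : g) • D.word (E := E) v l ∈ U := by
    intro h l
    rw [mem_weightSpace_one_iff.mp (word_mem_weightSpace hv.mem_weightSpace l) h]
    exact U.smul_mem _ (hword l)
  have key : ∀ (l : List ι) (x : g), gen (F := F) E x • D.word (E := E) v l ∈ U := by
    intro l
    induction l with
    | nil =>
      refine D.gen_smul_mem_of_generators (fun h => ht h []) (fun i => ?_) fun i => hword [i]
      change gen (F := F) E (D.e i) • v ∈ U
      rw [hv.e_smul]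
      exact U.zero_mem
    | cons i l ih =>
      refine D.gen_smul_mem_of_generators (fun h => ht h _) (fun j => ?_)
        fun j => hword (j :: i :: l)
      rw [word_cons, ← sub_add_cancel (gen (F := F) E (D.e j) • gen (F := F) E (D.f i) •
        D.word (E := E) v l) (gen (F := F) E (D.f i) • gen (F := F) E (D.e j) • D.word (E := E) v l),
        ← gen_lie_smul]
      exact U.add_mem (ih _) (hf i _ (ih _))
  have hstable : ∀ (x : g), ∀ m ∈ U, gen (F := F) E x • m ∈ U := by
    intro x m hm
    induction hm using Submodule.span_induction with
    | mem _ h => obtain ⟨l, rfl⟩ := h; exact key l x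
    | zero => rw [smul_zero]; exact U.zero_mem
    | add x y _ _ hx hy => rw [smul_add]; exact U.add_mem hx hy
    | smul c x _ hx => rw [smul_gen_comm]; exact U.smul_mem c hx
  rw [eq_top_iff]
  rintro m -
  have hm : m ∈ Submodule.span (UgE F E g) {v} := by rw [hspan]; trivial
  exact (Submodule.span_le (p := submoduleOfGen U hstable)).mpr
    (Set.singleton_subset_iff.mpr (hword [])) hm

/-- The elements of a highest weight module `M` whose weights may occur as weights of highest
weight vectors of subquotients of `M`. -/
def linkedSubspace (D : TriangularData b t ι Γ) (μ : t →ₗ[F] E) (v : M) : Submodule E M :=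
  Submodule.span E (D.word (E := E) v ''
    {l | D.casimirScalar (D.lowerWeight μ (content l)) = D.casimirScalar μ})

lemma finiteDimensional_linkedSubspace [CharZero F] [CharZero E] (μ : t →ₗ[F] E) (v : M) :
    FiniteDimensional E (linkedSubspace D μ v) := by
  classical
  refine FiniteDimensional.span_of_finite E (Set.Finite.image _ ?_)
  have hfin := D.finite_setOf_casimirScalar_lowerWeight_eq μ
  -- Finitely many contents bound the length of the words, and a finite alphabet has finitely many
  -- words of bounded length.
  obtain ⟨N, hN⟩ := (hfin.image fun n => ∑ i, n i).bddAbove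
  refine (List.finite_length_le ι N).subset fun l hl => ?_
  have := hN ⟨_, hl, rfl⟩
  rw [Set.mem_ofPred_eq]
  refine le_trans (le_of_eq ?_) this
  simpa [content] using
    (Multiset.sum_count_eq_card (s := Finset.univ) (m := (l : Multiset ι)) (by simp)).symm

end TriangularData

end Casimir

/-! ### Finite length and stability properties of the thick category. -/

section FiniteLength

attribute [local instance] LieRing.ofAssociativeRing

variable {F : Type*} [Field F] [CharZero F] {E : Type*} [Field E] [CharZero E] [Algebra F E]
variable {g : Type*} [LieRing g] [LieAlgebra F g] {b t : LieSubalgebra F g}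
variable {ι Γ : Type*} [Fintype ι] [Fintype Γ] {D : TriangularData b t ι Γ}

section HighestWeightModule

variable {M : Type*} [AddCommGroup M] [Module E M]
  [Module (UgE F E g) M] [IsScalarTower E (UgE F E g) M]

open TriangularData in
lemma mem_sup_linkedSubspace {μ : t →ₗ[F] E} {v : M} (hv : IsHighestWeightVector D μ v)
    (hspan : Submodule.span (UgE F E g) {v} = ⊤) {ν : t →ₗ[F] E}
    (hν : D.casimirScalar ν = D.casimirScalar μ) (m : M) :
    m ∈ (linkedSubspace D μ v ⊓ weightSpace E t M ν 1) ⊔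
      ⨆ κ, ⨆ (_ : κ ≠ ν), weightSpace E t M κ 1 := by
  have hm : m ∈ Submodule.span E (Set.range (D.word (E := E) v)) := by
    rw [span_range_word hv hspan]; trivial
  refine Submodule.span_le.mpr ?_ hm
  rintro _ ⟨l, rfl⟩
  have hl := word_mem_weightSpace (D := D) hv.mem_weightSpace l
  by_cases h : D.lowerWeight μ (content l) = ν
  · refine Submodule.mem_sup_left ⟨Submodule.subset_span ⟨l, ?_, rfl⟩, h ▸ hl⟩
    rw [Set.mem_ofPred_eq, h, hν]
  · exact Submodule.mem_sup_right (Submodule.mem_iSup_of_mem _ (Submodule.mem_iSup_of_mem h hl))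

open TriangularData in
-- The quotient `N₂ / N₁` contains a highest weight vector. Its weight `ν` has the Casimir scalar of
-- `μ`, because the Casimir element acts on all of `M` by one scalar. The component of weight `ν` of
-- a lift is then the required element.
lemma exists_mem_linkedSubspace {μ : t →ₗ[F] E} {v : M} (hv : IsHighestWeightVector D μ v)
    (hspan : Submodule.span (UgE F E g) {v} = ⊤) (hM : IsLocallySplit t M E)
    (hb : IsLocallyFinite E M b) {N₁ N₂ : Submodule (UgE F E g) M} (h : N₁ < N₂) :
    ∃ y ∈ N₂, y ∈ linkedSubspace D μ v ∧ y ∉ N₁ := by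
  have := D.isLieAbelian
  obtain ⟨x, hx2, hx1⟩ := SetLike.exists_of_lt h
  have hbN := isLocallyFinite_of_injective hb N₂.subtype Subtype.val_injective
  rw [isLocallyFinite_iff] at hbN
  obtain ⟨V, hV, hxV, hVs⟩ := hbN ⟨x, hx2⟩
  have hMQ : IsLocallySplit t (M ⧸ N₁) E :=
    IsESplit.isLocallySplit ((hM.isESplit D.le_borel hb).of_surjective N₁.mkQ N₁.mkQ_surjective)
  let φ : N₂ →ₗ[UgE F E g] (M ⧸ N₁) := N₁.mkQ ∘ₗ N₂.subtype
  have hne : V.map (φ.restrictScalars E) ≠ ⊥ := by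
    intro h0
    have hmem : φ ⟨x, hx2⟩ ∈ V.map (φ.restrictScalars E) := ⟨_, hxV, rfl⟩
    rw [h0, Submodule.mem_bot] at hmem
    exact hx1 ((Submodule.Quotient.mk_eq_zero N₁).mp hmem)
  obtain ⟨ν, w, hw, hw0, hwν⟩ := hMQ.exists_isHighestWeightVector D (hVs.map φ) hne
  obtain ⟨⟨y, hy2⟩, -, hyw⟩ := hw
  replace hyw : N₁.mkQ y = w := hyw
  have hcas : D.casimirScalar ν = D.casimirScalar μ := by
    have h1 := hwν.casimirElement_smul
    rw [← hyw, ← map_smul, hv.casimirElement_smul_of_span hspan y] at h1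
    replace h1 : D.casimirScalar μ • N₁.mkQ y = D.casimirScalar ν • N₁.mkQ y := h1
    rw [hyw] at h1
    exact (smul_left_injective E hw0 h1).symm
  obtain ⟨y₁, ⟨hy₁, hy₁ν⟩, y₂, hy₂, rfl⟩ :=
    Submodule.mem_sup.mp (mem_sup_linkedSubspace hv hspan hcas y)
  have hmk2 : N₁.mkQ y₂ ∈ ⨆ κ, ⨆ (_ : κ ≠ ν), weightSpace E t (M ⧸ N₁) κ 1 := by
    have hle : (⨆ κ, ⨆ (_ : κ ≠ ν), weightSpace E t M κ 1) ≤
        (⨆ κ, ⨆ (_ : κ ≠ ν), weightSpace E t (M ⧸ N₁) κ 1).comap (N₁.mkQ.restrictScalars E) :=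
      iSup₂_le fun κ hκ m hm => Submodule.mem_iSup_of_mem κ
        (Submodule.mem_iSup_of_mem hκ (map_mem_weightSpace N₁.mkQ hm))
    exact hle hy₂
  have hmk2' : N₁.mkQ y₂ ∈ weightSpace E t (M ⧸ N₁) ν 1 := by
    rw [map_add] at hyw
    rw [eq_sub_of_add_eq' hyw]
    exact Submodule.sub_mem _ hwν.mem_weightSpace (map_mem_weightSpace N₁.mkQ hy₁ν)
  -- The image of `y₂` has weight `ν` and is also a sum of vectors of other weights, so it vanishes.
  have h0 : N₁.mkQ y₂ = 0 :=
    Submodule.disjoint_def.mp (iSupIndep_weightSpace_one (E := E) (M := M ⧸ N₁) t ν) _ hmk2' hmk2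
  have hy₂N : y₂ ∈ N₁ := (Submodule.Quotient.mk_eq_zero N₁).mp h0
  refine ⟨y₁, ?_, hy₁, fun hmem => hw0 ?_⟩
  · simpa using N₂.sub_mem hy2 (h.le hy₂N)
  · rw [← hyw, map_add, h0, add_zero]
    exact (Submodule.Quotient.mk_eq_zero N₁).mpr hmem

open TriangularData in
-- Intersecting with the finite-dimensional linked subspace is strictly monotone on submodules, so
-- both chain conditions are inherited from its lattice of subspaces.
lemma isNoetherian_and_isArtinian_of_span {μ : t →ₗ[F] E} {v : M}
    (hv : IsHighestWeightVector D μ v) (hspan : Submodule.span (UgE F E g) {v} = ⊤)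
    (hM : IsLocallySplit t M E) (hb : IsLocallyFinite E M b) :
    IsNoetherian (UgE F E g) M ∧ IsArtinian (UgE F E g) M := by
  let W := linkedSubspace D μ v
  have : FiniteDimensional E W := finiteDimensional_linkedSubspace μ v
  let φ : Submodule (UgE F E g) M → Submodule E W :=
    fun N => (N.restrictScalars E).comap W.subtype
  have hφ : StrictMono φ := by
    intro N₁ N₂ h
    obtain ⟨y, hy2, hyW, hy1⟩ := exists_mem_linkedSubspace hv hspan hM hb h
    refine SetLike.lt_iff_le_and_exists.mpr ⟨fun x hx => h.le hx, ⟨y, hyW⟩, hy2, hy1⟩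
  exact ⟨isNoetherian_iff'.mpr hφ.wellFoundedGT, hφ.wellFoundedLT⟩

end HighestWeightModule

/-- Dividing by the submodule generated by a highest weight vector in `V` kills that vector, so the
image of `V` has smaller dimension and still generates the quotient. -/
lemma isNoetherian_and_isArtinian_of_finrank (D : TriangularData b t ι Γ) (n : ℕ)
    (M : Type v) [AddCommGroup M] [Module E M] [Module (UgE F E g) M]
    [IsScalarTower E (UgE F E g) M] (hM : IsLocallySplit t M E) (hb : IsLocallyFinite E M b)
    (V : Submodule E M) [FiniteDimensional E V] (hV : IsStableUnder b V)
    (hn : Module.finrank E V = n) (hspan : Submodule.span (UgE F E g) (V : Set M) = ⊤) :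
    IsNoetherian (UgE F E g) M ∧ IsArtinian (UgE F E g) M := by
  have := D.isLieAbelian
  induction n using Nat.strong_induction_on generalizing M with
  | _ n ih =>
    by_cases hV0 : V = ⊥
    · have : Subsingleton M := by
        rw [← Submodule.subsingleton_iff (UgE F E g), ← subsingleton_iff_bot_eq_top, ← hspan, hV0]
        simp
      exact ⟨inferInstance, inferInstance⟩
    · obtain ⟨μ, v, hvV, hv0, hv⟩ := hM.exists_isHighestWeightVector D hV hV0
      let N : Submodule (UgE F E g) M := Submodule.span _ {v}
      have hvN : v ∈ N := Submodule.mem_span_singleton_self v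
      have h1 : IsNoetherian (UgE F E g) N ∧ IsArtinian (UgE F E g) N := by
        refine isNoetherian_and_isArtinian_of_span (D := D) (μ := μ) (v := (⟨v, hvN⟩ : N))
          ⟨?_, fun i => Subtype.ext (hv.e_smul i)⟩ ?_
          (hM.of_injective N.subtype Subtype.val_injective)
          (isLocallyFinite_of_injective hb N.subtype Subtype.val_injective)
        · rw [mem_weightSpace_one_iff]
          exact fun h => Subtype.ext (mem_weightSpace_one_iff.mp hv.mem_weightSpace h)
        · rw [eq_top_iff]
          rintro ⟨m, hm⟩ -
          obtain ⟨a, rfl⟩ := Submodule.mem_span_singleton.mp hm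
          exact Submodule.mem_span_singleton.mpr ⟨a, rfl⟩
      let φ : V →ₗ[E] M ⧸ N := (N.mkQ.restrictScalars E) ∘ₗ V.subtype
      have hφ : LinearMap.range φ = V.map (N.mkQ.restrictScalars E) := by
        rw [LinearMap.range_comp, Submodule.range_subtype]
      have hker : 0 < Module.finrank E (LinearMap.ker φ) := by
        rw [Module.finrank_pos_iff, Submodule.nontrivial_iff_ne_bot, Submodule.ne_bot_iff]
        exact ⟨⟨v, hvV⟩, (Submodule.Quotient.mk_eq_zero N).mpr hvN,
          fun h => hv0 (congrArg Subtype.val h)⟩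
      have hrank := φ.finrank_range_add_finrank_ker
      rw [hφ, hn] at hrank
      have h2 : IsNoetherian (UgE F E g) (M ⧸ N) ∧ IsArtinian (UgE F E g) (M ⧸ N) := by
        refine ih _ (by omega) (M ⧸ N)
          (IsESplit.isLocallySplit
            ((hM.isESplit D.le_borel hb).of_surjective N.mkQ N.mkQ_surjective))
          (isLocallyFinite_of_surjective hb N.mkQ N.mkQ_surjective)
          (V.map (N.mkQ.restrictScalars E)) (hV.map N.mkQ) rfl ?_
        change Submodule.span (UgE F E g) (N.mkQ '' (V : Set M)) = ⊤
        rw [Submodule.span_image, hspan, Submodule.map_top, Submodule.range_mkQ]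
      exact ⟨(isNoetherian_iff_submodule_quotient N).mpr ⟨h1.1, h2.1⟩,
        (isArtinian_iff_submodule_quotient N).mpr ⟨h1.2, h2.2⟩⟩

variable (b t) in
/-- Membership in the thick category `O` for unbundled modules. -/
structure IsThick (E : Type*) [Field E] [Algebra F E] (M : Type*) [AddCommGroup M] [Module E M]
    [Module (UgE F E g) M] [IsScalarTower E (UgE F E g) M] : Prop where
  finite : Module.Finite (UgE F E g) M
  isESplit : IsESplit E t M
  isLocallyFinite : IsLocallyFinite E M b

variable {M : Type*} [AddCommGroup M] [Module E M]
  [Module (UgE F E g) M] [IsScalarTower E (UgE F E g) M]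
variable {M' : Type*} [AddCommGroup M'] [Module E M']
  [Module (UgE F E g) M'] [IsScalarTower E (UgE F E g) M']
variable {M'' : Type*} [AddCommGroup M''] [Module E M'']
  [Module (UgE F E g) M''] [IsScalarTower E (UgE F E g) M'']

namespace IsThick

lemma isNoetherian_and_isArtinian (D : TriangularData b t ι Γ) (hM : IsThick b t E M) :
    IsNoetherian (UgE F E g) M ∧ IsArtinian (UgE F E g) M := by
  have := D.isLieAbelian
  obtain ⟨S, hS⟩ := hM.finite.fg_top
  obtain ⟨V, hV, hSV, hVs⟩ := hM.isLocallyFinite.exists_of_finite S.finite_toSet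
  refine isNoetherian_and_isArtinian_of_finrank D _ M hM.isESplit.isLocallySplit
    hM.isLocallyFinite V hVs rfl ?_
  rw [eq_top_iff, ← hS]
  exact Submodule.span_mono hSV

lemma isFiniteLength (D : TriangularData b t ι Γ) (hM : IsThick b t E M) :
    IsFiniteLength (UgE F E g) M :=
  isFiniteLength_iff_isNoetherian_isArtinian.mpr (hM.isNoetherian_and_isArtinian D)

lemma of_injective (D : TriangularData b t ι Γ) (hM : IsThick b t E M')
    (f : M →ₗ[UgE F E g] M') (hf : Function.Injective f) : IsThick b t E M := by
  have := D.isLieAbelian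
  have := (hM.isNoetherian_and_isArtinian D).1
  have hb := isLocallyFinite_of_injective hM.isLocallyFinite f hf
  exact ⟨Module.Finite.of_injective f hf,
    (hM.isESplit.isLocallySplit.of_injective f hf).isESplit D.le_borel hb, hb⟩

lemma of_surjective (D : TriangularData b t ι Γ) (hM : IsThick b t E M)
    (f : M →ₗ[UgE F E g] M') (hf : Function.Surjective f) : IsThick b t E M' := by
  have := D.isLieAbelian
  have := hM.finite
  exact ⟨Module.Finite.of_surjective f hf, hM.isESplit.of_surjective f hf,
    isLocallyFinite_of_surjective hM.isLocallyFinite f hf⟩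

lemma of_exact [FiniteDimensional F g] (D : TriangularData b t ι Γ) (hM : IsThick b t E M)
    (hM'' : IsThick b t E M'') (f : M →ₗ[UgE F E g] M') (p : M' →ₗ[UgE F E g] M'')
    (hp : Function.Surjective p) (hfp : Function.Exact f p) : IsThick b t E M' := by
  have := D.isLieAbelian
  have hb := isLocallyFinite_of_exact hM.isLocallyFinite hM''.isLocallyFinite f p hp hfp
  refine ⟨⟨Submodule.fg_of_fg_map_of_fg_inf_ker p ?_ ?_⟩,
    (hM.isESplit.isLocallySplit.of_exact hM''.isESplit.isLocallySplit f p hfp).isESplit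
      D.le_borel hb, hb⟩
  · rw [Submodule.map_top, LinearMap.range_eq_top.mpr hp]
    exact hM''.finite.fg_top
  · rw [top_inf_eq, hfp.linearMap_ker_eq, ← Submodule.map_top]
    exact hM.finite.fg_top.map f

lemma of_subsingleton (D : TriangularData b t ι Γ) [Subsingleton M] : IsThick b t E M := by
  have := D.isLieAbelian
  refine ⟨inferInstance, ?_, fun m => inferInstance⟩
  rw [isESplit_iff]
  exact Subsingleton.elim _ _

end IsThick

namespace TriangularData

lemma weightSpace_one_le_iSup (μ : t →ₗ[F] E) :
    weightSpace E t M μ 1 ≤ ⨆ ν, weightSpace E t M ν 1 :=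
  le_iSup (fun ν => weightSpace E t M ν 1) μ

lemma gen_smul_mem_iSup_weightSpace (D : TriangularData b t ι Γ) (x : g) {m : M}
    (hm : m ∈ ⨆ μ, weightSpace E t M μ 1) :
    gen (F := F) E x • m ∈ ⨆ μ, weightSpace E t M μ 1 := by
  induction hm using Submodule.iSup_induction' with
  | zero => rw [smul_zero]; exact Submodule.zero_mem _
  | add y z _ _ hy hz => rw [smul_add]; exact Submodule.add_mem _ hy hz
  | mem μ m hm =>
    exact D.gen_smul_mem_of_generators
      (fun h => weightSpace_one_le_iSup _ (gen_t_smul_mem hm h))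
      (fun i => weightSpace_one_le_iSup _ (D.gen_e_smul_mem hm i))
      (fun i => weightSpace_one_le_iSup _ (D.gen_f_smul_mem hm i)) x

variable (E M) in
/-- The largest diagonalizable submodule. -/
def diagonalPart (D : TriangularData b t ι Γ) : Submodule (UgE F E g) M :=
  submoduleOfGen (⨆ μ, weightSpace E t M μ 1) fun x _ => D.gen_smul_mem_iSup_weightSpace x

lemma mem_diagonalPart {m : M} :
    m ∈ D.diagonalPart E M ↔ m ∈ ⨆ μ, weightSpace E t M μ 1 := Iff.rfl

lemma isDiagonalizable_of_diagonalPart_eq_top (h : D.diagonalPart E M = ⊤) :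
    IsDiagonalizable E t M := by
  have := D.isLieAbelian
  rw [isDiagonalizable_iff, eq_top_iff]
  intro m _
  rw [← mem_diagonalPart (D := D), h]
  trivial

lemma isDiagonalizable_of_range_eq (f : M →ₗ[UgE F E g] M') (hf : Function.Injective f)
    (hr : LinearMap.range f = D.diagonalPart E M') : IsDiagonalizable E t M := by
  have := D.isLieAbelian
  rw [isDiagonalizable_iff, eq_top_iff]
  intro m _
  have hle : (⨆ μ, weightSpace E t M' μ 1) ≤
      (⨆ μ, weightSpace E t M μ 1).map (f.restrictScalars E) := by
    refine iSup_le fun μ x hx => ?_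
    have hx' : x ∈ LinearMap.range f := by
      rw [hr]; exact weightSpace_one_le_iSup μ hx
    obtain ⟨y, rfl⟩ := hx'
    refine ⟨y, weightSpace_one_le_iSup μ ?_, rfl⟩
    rw [mem_weightSpace_one_iff] at hx ⊢
    intro h
    apply hf
    rw [map_smul, hx]
    exact ((f.restrictScalars E).map_smul _ _).symm
  have hm : f m ∈ D.diagonalPart E M' := hr ▸ ⟨m, rfl⟩
  obtain ⟨y, hy, hym⟩ := hle hm
  rwa [← hf hym]

/-- A common eigenvector of `t_E` exists in a finite-dimensional `b`-stable subspace. -/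
lemma diagonalPart_ne_bot [Nontrivial M] (hM : IsThick b t E M) : D.diagonalPart E M ≠ ⊥ := by
  have := D.isLieAbelian
  obtain ⟨m, hm⟩ := exists_ne (0 : M)
  obtain ⟨V, hV, hmV, hVs⟩ := (isLocallyFinite_iff b).mp hM.isLocallyFinite m
  obtain ⟨μ, v, -, hv0, hv⟩ := hM.isESplit.isLocallySplit.exists_weightVector
    (fun x hx => hVs x (D.le_borel hx)) ((Submodule.ne_bot_iff V).mpr ⟨m, hmV, hm⟩)
  exact (Submodule.ne_bot_iff _).mpr ⟨v, weightSpace_one_le_iSup μ hv, hv0⟩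

end TriangularData

end FiniteLength

/-! ### The filtration with diagonalizable pieces. -/

section Filtration

attribute [local instance] LieRing.ofAssociativeRing

variable {F : Type*} [Field F] [CharZero F] {E : Type*} [Field E] [CharZero E] [Algebra F E]
variable {g : Type*} [LieRing g] [LieAlgebra F g] {b t : LieSubalgebra F g}
variable {ι Γ : Type*} [Fintype ι] [Fintype Γ] (D : TriangularData b t ι Γ)
variable {M : Type*} [AddCommGroup M] [Module E M]
  [Module (UgE F E g) M] [IsScalarTower E (UgE F E g) M]

lemma exists_injective_submoduleOf {A M : Type*} [Ring A] [AddCommGroup M] [Module A M]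
    (N N' : Submodule A M) :
    ∃ f : (N' ⧸ N.submoduleOf N') →ₗ[A] M ⧸ N, Function.Injective f ∧
      LinearMap.range f = N'.map N.mkQ := by
  refine ⟨(N.submoduleOf N').mapQ N N'.subtype le_rfl, ?_, ?_⟩
  · rw [injective_iff_map_eq_zero]
    intro x hx
    obtain ⟨x, rfl⟩ := (N.submoduleOf N').mkQ_surjective x
    exact (Submodule.Quotient.mk_eq_zero _).mpr ((Submodule.Quotient.mk_eq_zero N).mp hx)
  · ext y
    constructor
    · rintro ⟨x, rfl⟩
      obtain ⟨x, rfl⟩ := (N.submoduleOf N').mkQ_surjective x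
      exact ⟨x, x.2, rfl⟩
    · rintro ⟨x, hx, rfl⟩
      exact ⟨(N.submoduleOf N').mkQ ⟨x, hx⟩, rfl⟩

variable (E M) in
/-- The ascending filtration of `M` with graded pieces the largest diagonalizable submodules. -/
def TriangularData.diagonalFiltration : ℕ → Submodule (UgE F E g) M
  | 0 => ⊥
  | k + 1 => (D.diagonalPart E (M ⧸ TriangularData.diagonalFiltration k)).comap
      (TriangularData.diagonalFiltration k).mkQ

lemma TriangularData.diagonalFiltration_succ (k : ℕ) :
    D.diagonalFiltration E M (k + 1) =
      (D.diagonalPart E (M ⧸ D.diagonalFiltration E M k)).comap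
        (D.diagonalFiltration E M k).mkQ := rfl

lemma TriangularData.monotone_diagonalFiltration : Monotone (D.diagonalFiltration E M) := by
  refine monotone_nat_of_le_succ fun k => ?_
  rw [D.diagonalFiltration_succ]
  exact Submodule.le_comap_mkQ _ _

/-- The filtration stabilizes by the Noetherian property. A proper stable stage would leave a
nonzero quotient with zero diagonal part. -/
lemma IsThick.exists_diagonalFiltration_eq_top (hM : IsThick b t E M) :
    ∃ n, D.diagonalFiltration E M n = ⊤ := by
  have := (hM.isNoetherian_and_isArtinian D).1
  obtain ⟨n, hn⟩ := monotone_stabilizes_iff_noetherian.mpr this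
    ⟨D.diagonalFiltration E M, D.monotone_diagonalFiltration⟩
  refine ⟨n, ?_⟩
  by_contra hne
  set N := D.diagonalFiltration E M n with hN
  have h1 : N = (D.diagonalPart E (M ⧸ N)).comap N.mkQ := hn (n + 1) (Nat.le_succ n)
  have : Nontrivial (M ⧸ N) := Submodule.Quotient.nontrivial_iff.mpr hne
  refine D.diagonalPart_ne_bot (M := M ⧸ N) (E := E)
    (hM.of_surjective D N.mkQ N.mkQ_surjective) ?_
  rw [eq_bot_iff]
  intro y hy
  obtain ⟨x, rfl⟩ := N.mkQ_surjective y
  have hx : x ∈ (D.diagonalPart E (M ⧸ N)).comap N.mkQ := hy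
  rw [← h1] at hx
  exact (Submodule.Quotient.mk_eq_zero N).mpr hx

end Filtration

/-! ### Translation to categories of modules, and the theorem. -/

section Categories

attribute [local instance] LieRing.ofAssociativeRing

lemma eq_top_of_simple {A : Type*} [Ring A] {P : ObjectProperty (ModuleCat.{v} A)}
    (S : P.FullSubcategory) [Simple S] (N : Submodule A S.obj) (hN : P (ModuleCat.of A N))
    (hN0 : N ≠ ⊥) : N = ⊤ := by
  let Y : P.FullSubcategory := ⟨ModuleCat.of A N, hN⟩
  let f : Y ⟶ S := ObjectProperty.homMk (ModuleCat.ofHom N.subtype)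
  have : Mono (P.ι.map f) := (ModuleCat.mono_iff_injective _).mpr Subtype.val_injective
  have : Mono f := P.ι.mono_of_mono_map this
  have hf : f ≠ 0 := by
    intro h
    obtain ⟨x, hx, hx0⟩ := (Submodule.ne_bot_iff N).mp hN0
    have h' : f.hom = 0 := congrArg (fun f => f.hom) h
    exact hx0 (LinearMap.congr_fun (congrArg ModuleCat.Hom.hom h') ⟨x, hx⟩)
  have hiso : IsIso f := isIso_of_mono_of_nonzero hf
  have : Epi f.hom := inferInstance
  have hsurj : Function.Surjective f.hom := (ModuleCat.epi_iff_surjective _).mp this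
  rw [eq_top_iff]
  rintro x -
  obtain ⟨y, rfl⟩ := hsurj x
  exact y.2

lemma nontrivial_of_simple {A : Type*} [Ring A] {P : ObjectProperty (ModuleCat.{v} A)}
    (S : P.FullSubcategory) [Simple S] : Nontrivial S.obj := by
  by_contra h
  rw [not_nontrivial_iff_subsingleton] at h
  refine id_nonzero S (ObjectProperty.hom_ext _ ?_)
  ext x
  exact Subsingleton.elim _ _

lemma HasFiltrationBy.induction {A : Type*} [Ring A] {P : ObjectProperty (ModuleCat.{v} A)}
    {M : ModuleCat.{v} A} (h : HasFiltrationBy P M) (p : Submodule A M → Prop) (h0 : p ⊥)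
    (hs : ∀ N N' : Submodule A M, N ≤ N' → p N →
      P (ModuleCat.of A (N' ⧸ N.submoduleOf N')) → p N') : p ⊤ := by
  obtain ⟨n, N, hmono, hbot, htop, hP⟩ := h
  rw [← htop]
  induction Fin.last n using Fin.induction with
  | zero => rwa [hbot]
  | succ k ih => exact hs _ _ (hmono (Fin.castSucc_lt_succ).le) ih (hP k)

variable {F : Type*} [Field F] [CharZero F] {E : Type*} [Field E] [CharZero E] [Algebra F E]
variable {g : Type*} [LieRing g] [LieAlgebra F g] {b t : LieSubalgebra F g}
variable {ι Γ : Type*} [Fintype ι] [Fintype Γ] (D : TriangularData b t ι Γ)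
variable {X : AddSubgroup (Module.Dual F t)}

lemma catOInf_iff {M : ModuleCat.{v} (UgE F E g)} : catOInf E b t M ↔ IsThick b t E M :=
  ⟨fun h => ⟨h.1, h.2.1, h.2.2⟩, fun h => ⟨h.1, h.2, h.3⟩⟩

lemma exact_inclusion_mkQ {A M : Type*} [Ring A] [AddCommGroup M] [Module A M]
    {N N' : Submodule A M} (h : N ≤ N') :
    Function.Exact (Submodule.inclusion h) (N.submoduleOf N').mkQ := by
  rw [LinearMap.exact_iff, Submodule.ker_mkQ, Submodule.range_inclusion]
  rfl

lemma isAlgebraicModule_of_subsingleton [IsLieAbelian t] {M : Type*} [AddCommGroup M] [Module E M]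
    [Module (UgE F E g) M] [IsScalarTower E (UgE F E g) M] [Subsingleton M]
    (X : AddSubgroup (Module.Dual F t)) : IsAlgebraicModule E t M X := by
  rw [isAlgebraicModule_iff]
  exact Subsingleton.elim _ _

include D

lemma catOInf_of_catO {M : ModuleCat.{v} (UgE F E g)} (h : catO E b t M) : catOInf E b t M := by
  have := D.isLieAbelian
  exact ⟨h.1, h.2.1.isESplit, h.2.2⟩

/-- The property `P` is left open so that one filtration serves both `O` and `O_alg`; all that `P`
has to see is that the pieces lie in `O` and embed into quotients of `M`. -/
lemma hasFiltrationBy_of_isThick {P : ObjectProperty (ModuleCat.{v} (UgE F E g))}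
    {M : ModuleCat.{v} (UgE F E g)} (hM : IsThick b t E M)
    (hP : ∀ (N : Submodule (UgE F E g) M) (Q : ModuleCat.{v} (UgE F E g))
      (f : Q →ₗ[UgE F E g] M ⧸ N), Function.Injective f → catO E b t Q → P Q) :
    HasFiltrationBy P M := by
  obtain ⟨n, hn⟩ := hM.exists_diagonalFiltration_eq_top D
  refine ⟨n, fun k => D.diagonalFiltration E M k,
    fun i j hij => D.monotone_diagonalFiltration hij, rfl, hn, fun k => ?_⟩
  change P (ModuleCat.of _ (D.diagonalFiltration E M (k + 1) ⧸
    (D.diagonalFiltration E M k).submoduleOf (D.diagonalFiltration E M (k + 1))))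
  set N := D.diagonalFiltration E M k with hN
  set N' := D.diagonalFiltration E M (k + 1) with hN'
  obtain ⟨f, hf, hr⟩ := exists_injective_submoduleOf N N'
  have hr' : LinearMap.range f = D.diagonalPart E (M ⧸ N) :=
    hr.trans (Submodule.map_comap_eq_of_surjective N.mkQ_surjective _)
  have hQ : IsThick b t E (ModuleCat.of (UgE F E g) (N' ⧸ N.submoduleOf N')) :=
    (hM.of_surjective D N.mkQ N.mkQ_surjective).of_injective D f hf
  exact hP N (ModuleCat.of _ _) f hf
    ⟨hQ.finite, TriangularData.isDiagonalizable_of_range_eq f hf hr', hQ.isLocallyFinite⟩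

lemma hasFiltrationBy_catO {M : ModuleCat.{v} (UgE F E g)} (hM : catOInf E b t M) :
    HasFiltrationBy (catO E b t) M :=
  hasFiltrationBy_of_isThick D (catOInf_iff.mp hM) fun _ _ _ _ h => h

lemma hasFiltrationBy_catOAlg {M : ModuleCat.{v} (UgE F E g)} (hM : catOInfAlg E b t X M) :
    HasFiltrationBy (catOAlg E b t X) M := by
  have := D.isLieAbelian
  refine hasFiltrationBy_of_isThick D (catOInf_iff.mp hM.1) fun N _ f hf h => ⟨h, ?_⟩
  exact (hM.2.of_surjective N.mkQ N.mkQ_surjective).of_injective f hf h.2.1.isESplit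

lemma catOInf_of_hasFiltrationBy [FiniteDimensional F g] {M : ModuleCat.{v} (UgE F E g)}
    (h : HasFiltrationBy (catO E b t) M) : catOInf E b t M := by
  rw [catOInf_iff]
  refine IsThick.of_surjective D (h.induction (fun N => IsThick b t E N)
    (IsThick.of_subsingleton D) fun N N' hle hN hQ => ?_) (Submodule.topEquiv).toLinearMap
    Submodule.topEquiv.surjective
  exact hN.of_exact D (catOInf_iff.mp (catOInf_of_catO D hQ)) (Submodule.inclusion hle)
    (N.submoduleOf N').mkQ (Submodule.mkQ_surjective _) (exact_inclusion_mkQ hle)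

lemma catOInfAlg_of_hasFiltrationBy [FiniteDimensional F g] {M : ModuleCat.{v} (UgE F E g)}
    (h : HasFiltrationBy (catOAlg E b t X) M) : catOInfAlg E b t X M := by
  have := D.isLieAbelian
  have key : IsThick b t E (⊤ : Submodule (UgE F E g) M) ∧
      IsAlgebraicModule E t (⊤ : Submodule (UgE F E g) M) X := by
    refine h.induction (fun N => IsThick b t E N ∧ IsAlgebraicModule E t N X)
      ⟨IsThick.of_subsingleton D, isAlgebraicModule_of_subsingleton X⟩
      fun N N' hle hN hQ => ?_
    have hth := hN.1.of_exact D (catOInf_iff.mp (catOInf_of_catO D hQ.1))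
      (Submodule.inclusion hle) (N.submoduleOf N').mkQ (Submodule.mkQ_surjective _)
      (exact_inclusion_mkQ hle)
    exact ⟨hth, hN.2.of_exact hQ.2 (Submodule.inclusion hle) (N.submoduleOf N').mkQ
      (Submodule.inclusion_injective hle) (exact_inclusion_mkQ hle) hth.isESplit⟩
  exact ⟨catOInf_iff.mpr (key.1.of_surjective D (Submodule.topEquiv).toLinearMap
    Submodule.topEquiv.surjective), key.2.of_surjective (Submodule.topEquiv).toLinearMap
    Submodule.topEquiv.surjective⟩

lemma isSerreClass_catOInf [FiniteDimensional F g] :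
    (catOInf E b t : ObjectProperty (ModuleCat.{v} (UgE F E g))).IsSerreClass where
  exists_zero := ⟨ModuleCat.of _ PUnit, ModuleCat.isZero_of_subsingleton _,
    catOInf_iff.mpr (IsThick.of_subsingleton D)⟩
  prop_of_mono f _ hY := catOInf_iff.mpr ((catOInf_iff.mp hY).of_injective D f.hom
    ((ModuleCat.mono_iff_injective f).mp inferInstance))
  prop_of_epi f _ hX := catOInf_iff.mpr ((catOInf_iff.mp hX).of_surjective D f.hom
    ((ModuleCat.epi_iff_surjective f).mp inferInstance))
  prop_X₂_of_shortExact {S} hS h₁ h₃ := catOInf_iff.mpr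
    ((catOInf_iff.mp h₁).of_exact D (catOInf_iff.mp h₃) S.f.hom S.g.hom hS.moduleCat_surjective_g
      ((ShortComplex.ShortExact.moduleCat_exact_iff_function_exact S).mp hS.exact))

lemma isSerreClass_catOInfAlg [FiniteDimensional F g] :
    (catOInfAlg E b t X : ObjectProperty (ModuleCat.{v} (UgE F E g))).IsSerreClass := by
  have := D.isLieAbelian
  have hS := isSerreClass_catOInf (E := E) D
  exact
    { exists_zero := ⟨ModuleCat.of _ PUnit, ModuleCat.isZero_of_subsingleton _,
        catOInf_iff.mpr (IsThick.of_subsingleton D), isAlgebraicModule_of_subsingleton X⟩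
      prop_of_mono := fun f _ hY => by
        have h := ObjectProperty.prop_of_mono _ f hY.1
        exact ⟨h, hY.2.of_injective f.hom
          ((ModuleCat.mono_iff_injective f).mp inferInstance) h.2.1⟩
      prop_of_epi := fun f _ hX => ⟨ObjectProperty.prop_of_epi _ f hX.1,
        hX.2.of_surjective f.hom ((ModuleCat.epi_iff_surjective f).mp inferInstance)⟩
      prop_X₂_of_shortExact := fun {S} hS h₁ h₃ => by
        have h := ObjectProperty.prop_X₂_of_shortExact _ hS h₁.1 h₃.1
        exact ⟨h, h₁.2.of_exact h₃.2 S.f.hom S.g.hom hS.moduleCat_injective_f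
          ((ShortComplex.ShortExact.moduleCat_exact_iff_function_exact S).mp hS.exact) h.2.1⟩ }

/-- The diagonal part is a nonzero subobject, hence everything. The hypothesis `hP` makes it an
object of the subcategory in which `S` is simple. -/
lemma catO_of_simple {P : ObjectProperty (ModuleCat.{v} (UgE F E g))} (S : P.FullSubcategory)
    [Simple S] (hS : catOInf E b t S.obj)
    (hP : ∀ N : Submodule (UgE F E g) S.obj, P (ModuleCat.of _ N)) : catO E b t S.obj := by
  have := nontrivial_of_simple S
  have htop := eq_top_of_simple S (D.diagonalPart E S.obj) (hP _)
    (D.diagonalPart_ne_bot (catOInf_iff.mp hS))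
  exact ⟨hS.1, TriangularData.isDiagonalizable_of_diagonalPart_eq_top htop, hS.2.2⟩

end Categories

end ThickCategoryO

end

theorem mainTheorem4 {p : ℕ} [Fact p.Prime]
    {F : Type*} [Field F] [Algebra ℚ_[p] F] [FiniteDimensional ℚ_[p] F]
    {E : Type*} [Field E] [Algebra F E] [FiniteDimensional F E]
    {g : Type*} [LieRing g] [LieAlgebra F g]
    (b t : LieSubalgebra F g) (hbt : ThickCategoryO.IsSplitReductiveTriple b t)
    (X : AddSubgroup (Module.Dual F t)) :
    ((ThickCategoryO.catOInf E b t :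
        ObjectProperty (ModuleCat.{v} (ThickCategoryO.UgE F E g))).IsClosedUnderExtensions ∧
      (ThickCategoryO.catOInf E b t :
        ObjectProperty (ModuleCat.{v} (ThickCategoryO.UgE F E g))).IsSerreClass ∧
      (ThickCategoryO.catOInfAlg E b t X :
        ObjectProperty (ModuleCat.{v} (ThickCategoryO.UgE F E g))).IsClosedUnderExtensions ∧
      (ThickCategoryO.catOInfAlg E b t X :
        ObjectProperty (ModuleCat.{v} (ThickCategoryO.UgE F E g))).IsSerreClass) ∧
    (∀ M : ModuleCat.{v} (ThickCategoryO.UgE F E g), ThickCategoryO.catOInf E b t M ↔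
      ThickCategoryO.HasFiltrationBy (ThickCategoryO.catO E b t) M) ∧
    (∀ M : ModuleCat.{v} (ThickCategoryO.UgE F E g), ThickCategoryO.catOInfAlg E b t X M ↔
      ThickCategoryO.HasFiltrationBy (ThickCategoryO.catOAlg E b t X) M) ∧
    ((∀ S : (ThickCategoryO.catOInf E b t :
        ObjectProperty (ModuleCat.{v} (ThickCategoryO.UgE F E g))).FullSubcategory,
        Simple S → ThickCategoryO.catO E b t S.obj) ∧
      (∀ S : (ThickCategoryO.catOInfAlg E b t X :
        ObjectProperty (ModuleCat.{v} (ThickCategoryO.UgE F E g))).FullSubcategory,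
        Simple S → ThickCategoryO.catOAlg E b t X S.obj) ∧
      (∀ M : ModuleCat.{v} (ThickCategoryO.UgE F E g), ThickCategoryO.catOInf E b t M →
        IsFiniteLength (ThickCategoryO.UgE F E g) M) ∧
      (∀ M : ModuleCat.{v} (ThickCategoryO.UgE F E g), ThickCategoryO.catOInfAlg E b t X M →
        IsFiniteLength (ThickCategoryO.UgE F E g) M)) := by
  have hF : CharZero F := charZero_of_injective_algebraMap (algebraMap ℚ_[p] F).injective
  have hE : CharZero E := charZero_of_injective_algebraMap (algebraMap F E).injective
  have hg := hbt.finiteDimensional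
  obtain ⟨ι, Γ, _, _, ⟨D⟩⟩ := ThickCategoryO.exists_triangularData hbt
  have hS := ThickCategoryO.isSerreClass_catOInf.{v} (E := E) D
  have hSa := ThickCategoryO.isSerreClass_catOInfAlg.{v} (E := E) (X := X) D
  have hlen : ∀ M : ModuleCat.{v} (ThickCategoryO.UgE F E g), ThickCategoryO.catOInf E b t M →
      IsFiniteLength (ThickCategoryO.UgE F E g) M := fun M hM =>
    (ThickCategoryO.catOInf_iff.mp hM).isFiniteLength D
  have hsub : ∀ (M : ModuleCat.{v} (ThickCategoryO.UgE F E g))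
      (N : Submodule (ThickCategoryO.UgE F E g) M),
      Mono (ModuleCat.ofHom N.subtype) := fun M N =>
    (ModuleCat.mono_iff_injective _).mpr Subtype.val_injective
  -- Closure under extensions is part of being a Serre class.
  refine ⟨⟨inferInstance, hS, inferInstance, hSa⟩,
    fun M => ⟨ThickCategoryO.hasFiltrationBy_catO D, ThickCategoryO.catOInf_of_hasFiltrationBy D⟩,
    fun M => ⟨ThickCategoryO.hasFiltrationBy_catOAlg D,
      ThickCategoryO.catOInfAlg_of_hasFiltrationBy D⟩,
    fun S _ => ?_, fun S _ => ⟨?_, S.property.2⟩, hlen, fun M hM => hlen M hM.1⟩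
  · exact ThickCategoryO.catO_of_simple D S S.property fun N =>
      have := hsub S.obj N
      ObjectProperty.prop_of_mono _ (ModuleCat.ofHom N.subtype) S.property
  · exact ThickCategoryO.catO_of_simple D S S.property.1 fun N =>
      have := hsub S.obj N
      ObjectProperty.prop_of_mono _ (ModuleCat.ofHom N.subtype) S.property
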